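/- **Setting.** Fix $\tau\in(0,1)$. Consider a sequence of problems. In each of them $(X,Y)\in\mathbb R^{p+1}\times\mathbb R$ with $X=(x_0,\dots,x_p)^{\mathrm T}$, $x_0\equiv 1$, the conditional $\tau$-quantile of $Y$ given $X$ is $X^{\mathrm T}\beta^*$, and $\varepsilon=Y-X^{\mathrm T}\beta^*$ has a conditional density $f_{\varepsilon|X}$ given $X$. An i.i.d. sample $(X_i,Y_i)$ of size $N=mn$ is stored on $m$ machines with $n$ observations each; $\mathcal M_1$ is the central machine. All quantities may vary along the sequence, and $N\to\infty$. Let $A=\{0\le j\le p:\beta^*_j\ne0\}$ be the full support of $\beta^*$ (it contains the intercept index $0$ if and only if $\beta_0^*\neq 0$), $A^c=\{0,\dots,p\}\setminus A$, $s=|A|\ge1$, and $S=A\setminus\{0\}=\{j\ge 1:\beta^*_j\neq0\}$. Write $|\cdot|_q$ for the $\ell_q$-norm and $\|\cdot\|_\infty$ for the maximal absolute row sum of a matrix. **Estimator.** Let $K_h(u)=K(u/h)/h$. For an initial estimator $\widehat\beta_0$ (any random vector) let $\widehat e_i=Y_i-X_i^{\mathrm T}\widehat\beta_0$, $\widehat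 D_h=\frac1N\sum_{i\le N}K_h(\widehat e_i)X_iX_i^{\mathrm T}$, $\widehat D_{1,b}=\frac1n\sum_{i\in\mathcal M_1}K_b(\widehat e_i)X_iX_i^{\mathrm T}$ and $z_N=\frac1N\sum_{i\le N}\{K_h(\widehat e_i)X_iX_i^{\mathrm T}\widehat\beta_0-X_i(I(\widehat e_i\le0)-\tau)\}$. The one-step estimator $\widehat\beta_1$ is a minimizer over $\beta\in\mathbb R^{p+1}$ (measurably chosen, wherever a minimizer exists) of $$\tfrac12\beta^{\mathrm T}\widehat D_{1,b}\beta-\beta^{\mathrm T}\{z_N+(\widehat D_{1,b}-\widehat D_h)\widehat\beta_0\}+\lambda_N|\beta|_1 ,$$ and $\widehat S_1=\{j\ge1:\widehat\beta_{1,j}\ne0\}$. **Assumptions**, with constants that do not vary along the sequence: 1. $K$ is symmetric, non-negative, bounded, integrates to one, $\int u^2K(u)\,du<\infty$, $\min_{|u|\le1}K(u)>0$, and $K$ is differentiable with bounded derivative. 2. Almost surely $0<f_1\le f_{\varepsilon|X}(0)\le f_2$ and $|f_{\varepsilon|X}(u)-f_{\varepsilon|X}(v)|\le l_0|u-v|$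 for all $u,v\in\mathbb R$. 3. $\mathbb P(|X^{\mathrm T}\Sigma^{-1/2}\delta|\ge c_1t)\le2e^{-t^2/2}$ for all unit vectors $\delta$ and all $t>0$, where $\Sigma=\mathbb E(XX^{\mathrm T})$ and $c_1>0$. 4. $I=\mathbb E\{f_{\varepsilon|X}(0)XX^{\mathrm T}\}$ satisfies $\|I_{A^c\times A}I_{A\times A}^{-1}\|_\infty\le1-\alpha$ with $0<\alpha<1$, and its eigenvalues lie in $[\lambda_-,\lambda_+]$ with $\lambda_-,\lambda_+>0$. 5. $p=O(N^\nu)$, $n\ge N^c$, $s=O(n^r)$ with $\nu>0$, $0<c<1$, $0\le r<1/3$; and $h\asymp(s\log N/N)^{1/3}$, $b\asymp(s\log n/n)^{1/3}$, $a_N\asymp\sqrt{s\log N/n}$. 6. $\mathbb P(\{0\le j\le p:\widehat\beta_{0,j}\ne0\}\subseteq A)\to1$. Let $\eta=\max\{(s\log n/n)^{1/3},\sqrt{s\log N/n}\}$ and $\lambda_N=C(\sqrt{\log N/N}+a_N\eta)$. **Theorem.** For every $M>0$ there is $C_0>0$, and for every $C\ge C_0$ there is $C_1>0$, depending only on $K$,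 $\tau$, $M$, the constants $f_1,f_2,l_0,c_1,\alpha,\lambda_\pm,\nu,c,r$ and the constants in the relations $\asymp$ (and $C_1$ also on $C$), such that the following holds for every such sequence. (a) If $\mathbb P(|\widehat\beta_0-\beta^*|_2\le Ma_N)\to1$, then $\mathbb P(\widehat S_1\subseteq S)\to1$. If in addition, for all large $N$, $$\min_{j\in S}|\beta_j^*|\ge C_1\|I_{A\times A}^{-1}\|_\infty\Big(\sqrt{\tfrac{\log N}{N}}+a_N\eta\Big),\qquad(*)$$ then $\mathbb P(\widehat S_1=S)\to1$. (b) More generally, for every $\varepsilon\ge 0$, if $\limsup\mathbb P(|\widehat\beta_0-\beta^*|_2>Ma_N)\le\varepsilon$, then $\limsup\mathbb P(\widehat S_1\not\subseteq S)\le\varepsilon$; and if in addition $(*)$ holds for all large $N$, then $\limsup\mathbb P(\widehat S_1\ne S)\le\varepsilon$. In particular, if only $|\widehat\beta_0-\beta^*|_2=O_{\mathbb P}(a_N)$ in the usual sense, then for every $\varepsilon>0$ both conclusions hold with asymptotic probability at least $1-\varepsilon$ for all constants $C\geq C_0(\varepsilon)$, $C_1=C_1(\varepsilon,C)$. -/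

import Mathlib

open MeasureTheory ProbabilityTheory Filter Topology Matrix

universe u

noncomputable section

namespace DHSQR

/-! ### Norms, quantiles, kernels -/

/-- The Euclidean norm of a vector. -/
def l2norm {ι : Type*} [Fintype ι] (v : ι → ℝ) : ℝ := Real.sqrt (∑ j, v j ^ 2)

/-- The `ℓ₁` norm of a vector. -/
def l1norm {ι : Type*} [Fintype ι] (v : ι → ℝ) : ℝ := ∑ j, |v j|

/-- The matrix norm `‖A‖_∞`: the largest absolute row sum (zero for a matrix without rows). -/
def rowSumNorm {ι κ : Type*} [Fintype κ] (A : Matrix ι κ ℝ) : ℝ := ⨆ i, ∑ j, |A i j|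

/-- The `τ`-quantile `inf {y : F(y) ≥ τ}` of a distribution on the line. -/
def quantile (ρ : Measure ℝ) (τ : ℝ) : ℝ := sInf {y : ℝ | ENNReal.ofReal τ ≤ ρ (Set.Iic y)}

/-- The conditions on the kernel function. -/
structure IsSmoothingKernel (K : ℝ → ℝ) : Prop where
  symm : ∀ u, K (-u) = K u
  nonneg : ∀ u, 0 ≤ K u
  bounded : ∃ B, ∀ u, K u ≤ B
  integrable : Integrable K
  integral_eq_one : ∫ u, K u = 1
  second_moment : Integrable fun u => u ^ 2 * K u
  pos_near_zero : ∃ δ > 0, ∀ u, |u| ≤ 1 → δ ≤ K u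
  differentiable : Differentiable ℝ K
  deriv_bounded : ∃ B, ∀ u, |deriv K u| ≤ B

/-- The rescaled kernel `K_h(u) = K(u / h) / h`. -/
def scaledKernel (K : ℝ → ℝ) (h u : ℝ) : ℝ := K (u / h) / h

/-! ### The linear quantile model -/

/-- The law of a pair `(X, Y)` that follows the linear `τ`-quantile model: the covariate
`X = (x_0, …, x_p)` has `x_0 = 1`, the conditional `τ`-quantile of `Y` given `X` is `Xᵀ β*`, and
the error `ε = Y - Xᵀ β*` has a conditional density `dens x = f_{ε | X = x}` given `X`. -/
structure Population (τ : ℝ) where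
  p : ℕ
  law : Measure ((Fin (p + 1) → ℝ) × ℝ)
  [prob_law : IsProbabilityMeasure law]
  betaStar : Fin (p + 1) → ℝ
  dens : (Fin (p + 1) → ℝ) → ℝ → ℝ
  intercept : ∀ᵐ z ∂law, z.1 0 = 1
  quantile_eq : ∀ᵐ x ∂(law.map Prod.fst),
    quantile (condDistrib Prod.snd Prod.fst law x) τ = x ⬝ᵥ betaStar
  measurable_dens : Measurable (Function.uncurry dens)
  dens_nonneg : ∀ x u, 0 ≤ dens x u
  dens_eq : ∀ᵐ x ∂(law.map Prod.fst),
    condDistrib (fun z : (Fin (p + 1) → ℝ) × ℝ => z.2 - z.1 ⬝ᵥ betaStar) Prod.fst law x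
      = volume.withDensity fun u => ENNReal.ofReal (dens x u)

attribute [instance] Population.prob_law

namespace Population

variable {τ : ℝ} (Q : Population τ)

/-- The indices of the nonzero coordinates of `β*`, the intercept (index `0`) included when it
is nonzero. -/
def active : Finset (Fin (Q.p + 1)) := Finset.univ.filter fun j => Q.betaStar j ≠ 0

/-- The support of the slopes, `S = {j ≥ 1 : β*_j ≠ 0}`. -/
def supp : Finset (Fin (Q.p + 1)) := Finset.univ.filter fun j => j ≠ 0 ∧ Q.betaStar j ≠ 0

/-- The sparsity of `β*`. -/
def s : ℕ := Q.active.card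

/-- `Σ = E (X Xᵀ)`. -/
def Sigma : Matrix (Fin (Q.p + 1)) (Fin (Q.p + 1)) ℝ :=
  fun j k => ∫ z, z.1 j * z.1 k ∂Q.law

/-- `I = E (f_{ε | X}(0) X Xᵀ)`. -/
def Info : Matrix (Fin (Q.p + 1)) (Fin (Q.p + 1)) ℝ :=
  fun j k => ∫ z, Q.dens z.1 0 * (z.1 j * z.1 k) ∂Q.law

/-- The block of `I` with rows and columns in the support of `β*`. -/
def infoSS : Matrix {j // j ∈ Q.active} {j // j ∈ Q.active} ℝ :=
  Q.Info.submatrix Subtype.val Subtype.val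

/-- The block of `I` with rows outside and columns inside the support of `β*`. -/
def infoScS : Matrix {j // j ∉ Q.active} {j // j ∈ Q.active} ℝ :=
  Q.Info.submatrix Subtype.val Subtype.val

/-- The condition on the conditional density of the error. -/
def DensityCondition (f₁ f₂ l₀ : ℝ) : Prop :=
  ∀ᵐ x ∂(Q.law.map Prod.fst),
    (f₁ ≤ Q.dens x 0 ∧ Q.dens x 0 ≤ f₂) ∧
      ∀ u v : ℝ, |Q.dens x u - Q.dens x v| ≤ l₀ * |u - v|

/-- The covariate is sub-Gaussian; `R` is the matrix `Σ^{-1/2}`. -/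
def SubGaussian (c₁ : ℝ) : Prop :=
  ∃ R : Matrix (Fin (Q.p + 1)) (Fin (Q.p + 1)) ℝ, R.PosDef ∧ R * R = Q.Sigma⁻¹ ∧
    ∀ δ : Fin (Q.p + 1) → ℝ, l2norm δ = 1 → ∀ t : ℝ, 0 < t →
      Q.law {z | c₁ * t ≤ |z.1 ⬝ᵥ (R *ᵥ δ)|} ≤ ENNReal.ofReal (2 * Real.exp (-t ^ 2 / 2))

/-- The irrepresentable condition and the bounds on the eigenvalues of `I`. -/
def Irrepresentable (α lamMin lamMax : ℝ) : Prop :=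
  rowSumNorm (Q.infoScS * Q.infoSS⁻¹) ≤ 1 - α ∧
    ∀ μ : ℝ, Module.End.HasEigenvalue (Matrix.toLin' Q.Info) μ → lamMin ≤ μ ∧ μ ≤ lamMax

end Population

/-! ### The distributed sample and the one-step estimator -/

/-- A linear quantile model together with an i.i.d. sample from it, stored in `m` machines with
`n` observations each, one of which is the central machine. -/
structure Experiment (τ : ℝ) extends Population τ where
  m : ℕ
  n : ℕ
  Ω : Type u
  [measurableSpace : MeasurableSpace Ω]
  P : Measure Ω
  [prob : IsProbabilityMeasure P]
  central : Fin m
  X : Fin m → Fin n → Ω → Fin (p + 1) → ℝ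
  Y : Fin m → Fin n → Ω → ℝ
  measurable_X : ∀ k i, Measurable (X k i)
  measurable_Y : ∀ k i, Measurable (Y k i)
  law_eq : ∀ k i, P.map (fun ω => (X k i ω, Y k i ω)) = law
  indep : iIndepFun (fun (q : Fin m × Fin n) ω => (X q.1 q.2 ω, Y q.1 q.2 ω)) P

attribute [instance] Experiment.measurableSpace Experiment.prob

namespace Experiment

variable {τ : ℝ} (E : Experiment.{u} τ)

/-- The total sample size `N = m n`. -/
def N : ℕ := E.m * E.n

variable (K : ℝ → ℝ) (β₀ : Fin (E.p + 1) → ℝ)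

/-- The residual `ê_{0,i} = Y_i - X_iᵀ β̂_0`. -/
def resid (k : Fin E.m) (i : Fin E.n) (ω : E.Ω) : ℝ := E.Y k i ω - E.X k i ω ⬝ᵥ β₀

/-- `I(ê_{0,i} ≤ 0)`. -/
def indic (k : Fin E.m) (i : Fin E.n) (ω : E.Ω) : ℝ :=
  if E.resid β₀ k i ω ≤ 0 then 1 else 0

/-- The pseudo covariate `X̃_{i,h} = √(K_h(ê_{0,i})) X_i`. -/
def pseudoX (h : ℝ) (k : Fin E.m) (i : Fin E.n) (ω : E.Ω) : Fin (E.p + 1) → ℝ :=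
  Real.sqrt (scaledKernel K h (E.resid β₀ k i ω)) • E.X k i ω

/-- The pseudo response `Ỹ_{i,h} = X̃_{i,h}ᵀ β̂_0 - (I(ê_{0,i} ≤ 0) - τ) / √(K_h(ê_{0,i}))`, which
is meaningful where `K_h(ê_{0,i}) ≠ 0`. -/
def pseudoY (h : ℝ) (k : Fin E.m) (i : Fin E.n) (ω : E.Ω) : ℝ :=
  E.pseudoX K β₀ h k i ω ⬝ᵥ β₀
    - 1 / Real.sqrt (scaledKernel K h (E.resid β₀ k i ω)) * (E.indic β₀ k i ω - τ)

/-- The product `X̃_{i,h} Ỹ_{i,h}`, with the factor `√(K_h(ê_{0,i}))` cancelled in the second term,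
so that it is also meaningful where `K_h(ê_{0,i}) = 0`. -/
def pseudoXY (h : ℝ) (k : Fin E.m) (i : Fin E.n) (ω : E.Ω) : Fin (E.p + 1) → ℝ :=
  (E.pseudoX K β₀ h k i ω ⬝ᵥ β₀) • E.pseudoX K β₀ h k i ω
    - (E.indic β₀ k i ω - τ) • E.X k i ω

/-- Where the kernel does not vanish, `pseudoXY` is the product of the pseudo response and the
pseudo covariate. -/
theorem pseudoXY_eq (h : ℝ) (k : Fin E.m) (i : Fin E.n) (ω : E.Ω)
    (hpos : 0 < scaledKernel K h (E.resid β₀ k i ω)) :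
    E.pseudoXY K β₀ h k i ω = E.pseudoY K β₀ h k i ω • E.pseudoX K β₀ h k i ω := by
  have hs := (Real.sqrt_pos.2 hpos).ne'
  ext j
  simp only [pseudoXY, pseudoY, pseudoX, Pi.sub_apply, Pi.smul_apply, smul_eq_mul]
  field_simp

/-- The local matrix `D̂_{k,h}` of machine `k`. -/
def Dlocal (h : ℝ) (k : Fin E.m) (ω : E.Ω) : Matrix (Fin (E.p + 1)) (Fin (E.p + 1)) ℝ :=
  (1 / (E.n : ℝ)) • ∑ i, vecMulVec (E.pseudoX K β₀ h k i ω) (E.pseudoX K β₀ h k i ω)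

/-- The global matrix `D̂_h`. -/
def Dglobal (h : ℝ) (ω : E.Ω) : Matrix (Fin (E.p + 1)) (Fin (E.p + 1)) ℝ :=
  (1 / (E.m : ℝ)) • ∑ k, E.Dlocal K β₀ h k ω

/-- The vector `z_N`, the average of `X̃_{i,h} Ỹ_{i,h}` over the whole sample. -/
def zN (h : ℝ) (ω : E.Ω) : Fin (E.p + 1) → ℝ :=
  (1 / (E.N : ℝ)) • ∑ k, ∑ i, E.pseudoXY K β₀ h k i ω

/-- The shifted loss with global bandwidth `h` and local bandwidth `b`. -/
def shiftedLoss (h b : ℝ) (ω : E.Ω) (β : Fin (E.p + 1) → ℝ) : ℝ :=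
  1 / (2 * (E.n : ℝ)) * ∑ i, (E.pseudoX K β₀ b E.central i ω ⬝ᵥ β) ^ 2
    - β ⬝ᵥ (E.zN K β₀ h ω
        + (E.Dlocal K β₀ b E.central ω - E.Dglobal K β₀ h ω) *ᵥ β₀)

/-- `β` minimizes the `ℓ₁`-penalized shifted loss. -/
def IsOneStepMinimizer (h b lam : ℝ) (ω : E.Ω) (β : Fin (E.p + 1) → ℝ) : Prop :=
  ∀ β' : Fin (E.p + 1) → ℝ,
    E.shiftedLoss K β₀ h b ω β + lam * l1norm β
      ≤ E.shiftedLoss K β₀ h b ω β' + lam * l1norm β'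

/-- `β̂_1` is a one-step estimator started at `β̂_0`: a measurable random vector that minimizes the
penalized shifted loss at every sample point where this function has a minimizer. -/
structure IsOneStepEstimator (K : ℝ → ℝ) (h b lam : ℝ)
    (beta0 beta1 : E.Ω → Fin (E.p + 1) → ℝ) : Prop where
  measurable : Measurable beta1
  minimizes : ∀ ω, (∃ β, E.IsOneStepMinimizer K (beta0 ω) h b lam ω β) →
    E.IsOneStepMinimizer K (beta0 ω) h b lam ω (beta1 ω)

end Experiment

/-- The support `{j ≥ 1 : β_j ≠ 0}` of the slopes of a coefficient vector. -/
def slopeSupp {p : ℕ} (β : Fin (p + 1) → ℝ) : Finset (Fin (p + 1)) :=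
  Finset.univ.filter fun j => j ≠ 0 ∧ β j ≠ 0

/-! ### Rates -/

/-- `η = max {(s log n / n)^{1/3}, (s log N / n)^{1/2}}`. -/
def eta {τ : ℝ} (E : Experiment.{u} τ) : ℝ :=
  max ((E.s * Real.log E.n / E.n) ^ (1 / 3 : ℝ)) (Real.sqrt (E.s * Real.log E.N / E.n))

/-- The rate `√(log N / N) + a_N η`. -/
def rate {τ : ℝ} (E : Experiment.{u} τ) (a : ℝ) : ℝ :=
  Real.sqrt (Real.log E.N / E.N) + a * eta E

/-- `u ≍ v`, with explicit constants. -/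
def AsympWith (κ₁ κ₂ : ℝ) (u v : ℕ → ℝ) : Prop :=
  ∀ᶠ k in atTop, κ₁ * v k ≤ u k ∧ u k ≤ κ₂ * v k

/-- The growth conditions on a sequence of experiments and the orders of the two bandwidths and
of `a_N`. -/
structure RateConditions {τ : ℝ} (E : ℕ → Experiment.{u} τ) (ν c r κ₁ κ₂ : ℝ)
    (h b a : ℕ → ℝ) : Prop where
  sample_size : Tendsto (fun k => (E k).N) atTop atTop
  sparsity_pos : ∀ k, 1 ≤ (E k).s
  dimension : (fun k => ((E k).p : ℝ)) =O[atTop] fun k => ((E k).N : ℝ) ^ ν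
  local_size : ∀ᶠ k in atTop, ((E k).N : ℝ) ^ c ≤ (E k).n
  sparsity : (fun k => ((E k).s : ℝ)) =O[atTop] fun k => ((E k).n : ℝ) ^ r
  global_bandwidth : AsympWith κ₁ κ₂ h
    fun k => ((E k).s * Real.log (E k).N / (E k).N) ^ (1 / 3 : ℝ)
  local_bandwidth : AsympWith κ₁ κ₂ b
    fun k => ((E k).s * Real.log (E k).n / (E k).n) ^ (1 / 3 : ℝ)
  initial_rate : AsympWith κ₁ κ₂ a
    fun k => Real.sqrt ((E k).s * Real.log (E k).N / (E k).n)

end DHSQR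

end

/-!
The one-step estimator is a lasso. In the linear coefficient of the shifted loss the global matrix
`D̂_h` cancels, so that with `v = β̂_0 - β*` the gradient of the quadratic part at `β*` is

  `mean of X (1(ε ≤ 0) - τ)  +  mean of X {1(ε ≤ Xᵀ v) - 1(ε ≤ 0)}  -  D̂_{1,b} v`

(`zN_sub_Dglobal_mulVec`, `gradient_apply`). The first term is centred and of order `√(log N / N)`.
The second has mean `I v + O(|v|²)`, and the third is `I v + O(η |v|)`, because the local Hessian
`D̂_{1,b}` is within `O(η)` of `I`. The terms `I v` cancel, and the whole gradient is of order
`√(log N / N) + a_N η`, the order of the penalty level (`Experiment.abs_gradient_le`).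

The deterministic half of the argument is `CloseToIrrepresentable.lasso_support_recovery`. If the
rows of a matrix `D` are within `κ` of those of `I` on vectors supported in `A`, with `√s κ` small,
then the irrepresentable condition carries over from `I` to `D`. If in addition the gradient is at
most `α λ / 8`, then a primal-dual witness shows that a minimizer exists and that every minimizer
vanishes off `A` and is within `2 λ ‖I_{AA}⁻¹‖_∞` of `β*` in the maximum norm.

The probabilistic half has to be uniform in the initial estimator, which is an arbitrary random
vector; all that is known is that `v` is supported in `A` and has norm at most `M a_N`. The averages
are therefore controlled at the points of a grid of mesh `N⁻⁸` in the unit ball of `ℝ^A`, which has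
`N^{O(s)}` points. At each point Bernstein's inequality in its form for variables with exponential
moments (`bernstein`) applies, with the second moments of `scoreDiff_moment`, `nearFn_moment` and
`kernFn_moment`; `Experiment.measure_not_isGood_le` collects the union bound. Between the grid
points the Hessian varies little since the kernel is Lipschitz, while the increment of the score,
which is discontinuous, is dominated by the average of `|X_j| 1(|ε - Xᵀ v| ≤ 1/N)`, itself one of
the averages under control.

The conditions of the two halves meet in the regime `InRegime`. The condition `r < 1/3` enters
through `s³ (log N)³ / n → 0`, which makes both `√s η` and `s a_N` small: the first is needed for
the irrepresentable condition of the perturbed matrix, the second makes Bernstein's exponent for the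
increments of the score, of order `log N / a_N`, exceed the entropy `s log N` of the grid. Outside
an event of probability `11 / N` every initial estimator with the right support and error at most
`M a_N` leads to the right support (`exists_recovery_event`). The failure probability of
`β̂_1` is thus at most that of `β̂_0` up to a null sequence, which gives both parts.
-/

noncomputable section

namespace DHSQR

/-! ### Elementary facts on the vector and matrix norms -/

section Norms

theorem rowSumNorm_nonneg {ι κ : Type*} [Fintype κ] (B : Matrix ι κ ℝ) : 0 ≤ rowSumNorm B :=
  Real.iSup_nonneg fun _ => Finset.sum_nonneg fun _ _ => abs_nonneg _

variable {ι κ : Type*} [Fintype ι] [Fintype κ]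

theorem l2norm_nonneg (v : ι → ℝ) : 0 ≤ l2norm v := Real.sqrt_nonneg _

theorem l2norm_sq (v : ι → ℝ) : l2norm v ^ 2 = ∑ j, v j ^ 2 :=
  Real.sq_sqrt (Finset.sum_nonneg fun _ _ => sq_nonneg _)

theorem l2norm_sq_eq_dotProduct (v : ι → ℝ) : l2norm v ^ 2 = v ⬝ᵥ v := by
  rw [l2norm_sq, dotProduct]; exact Finset.sum_congr rfl fun _ _ => sq _

theorem abs_le_l2norm (v : ι → ℝ) (j : ι) : |v j| ≤ l2norm v := by
  rw [l2norm, ← Real.sqrt_sq_eq_abs]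
  exact Real.sqrt_le_sqrt (Finset.single_le_sum (f := fun j => v j ^ 2)
    (fun _ _ => sq_nonneg _) (Finset.mem_univ j))

theorem l2norm_smul (c : ℝ) (v : ι → ℝ) : l2norm (c • v) = |c| * l2norm v := by
  have : ∑ j, (c • v) j ^ 2 = c ^ 2 * ∑ j, v j ^ 2 := by
    rw [Finset.mul_sum]; exact Finset.sum_congr rfl fun _ _ => by simp; ring
  rw [l2norm, this, Real.sqrt_mul (sq_nonneg c), Real.sqrt_sq_eq_abs, l2norm]

theorem l2norm_single [DecidableEq ι] (j : ι) : l2norm (Pi.single j (1 : ℝ)) = 1 := by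
  rw [l2norm, Finset.sum_eq_single j] <;> simp +contextual

theorem abs_dotProduct_le_l2norm (v w : ι → ℝ) : |v ⬝ᵥ w| ≤ l2norm v * l2norm w := by
  apply abs_le_of_sq_le_sq _ (mul_nonneg (l2norm_nonneg v) (l2norm_nonneg w))
  rw [mul_pow, l2norm_sq, l2norm_sq]
  exact Finset.sum_mul_sq_le_sq_mul_sq _ _ _

/-- A vector with support in `A` and entries at most `x` has Euclidean norm at most `√|A| x`. -/
theorem l2norm_le_of_support {A : Finset ι} {v : ι → ℝ} {x : ℝ} (hx : 0 ≤ x)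
    (hA : ∀ j, j ∉ A → v j = 0) (hv : ∀ j ∈ A, |v j| ≤ x) :
    l2norm v ≤ Real.sqrt A.card * x := by
  rw [← Real.sqrt_sq hx, ← Real.sqrt_mul (Nat.cast_nonneg _), l2norm]
  apply Real.sqrt_le_sqrt
  rw [← Finset.sum_subset (Finset.subset_univ A) fun j _ hj => by rw [hA j hj]; ring]
  calc ∑ j ∈ A, v j ^ 2 ≤ ∑ _j ∈ A, x ^ 2 :=
        Finset.sum_le_sum fun j hj => sq_le_sq' (by linarith [abs_le.1 (hv j hj)])
          (abs_le.1 (hv j hj)).2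
    _ = _ := by simp

/-- The maximal row sum bounds the operator norm for the maximum norm. -/
theorem abs_mulVec_le_rowSumNorm (B : Matrix ι κ ℝ) (v : κ → ℝ) {x : ℝ}
    (hv : ∀ k, |v k| ≤ x) (i : ι) : |(B *ᵥ v) i| ≤ rowSumNorm B * x := by
  rcases isEmpty_or_nonempty κ with hκ | ⟨⟨k₀⟩⟩
  · simp [mulVec, dotProduct, rowSumNorm]
  have hx : 0 ≤ x := (abs_nonneg _).trans (hv k₀)
  have h1 : ∑ k, |B i k| ≤ rowSumNorm B :=
    le_ciSup (f := fun i => ∑ k, |B i k|) (Set.finite_range _).bddAbove i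
  calc |(B *ᵥ v) i| ≤ ∑ k, |B i k * v k| := Finset.abs_sum_le_sum_abs _ _
    _ ≤ ∑ k, |B i k| * x := Finset.sum_le_sum fun k _ => by
        rw [abs_mul]; exact mul_le_mul_of_nonneg_left (hv k) (abs_nonneg _)
    _ = (∑ k, |B i k|) * x := by rw [Finset.sum_mul]
    _ ≤ _ := mul_le_mul_of_nonneg_right h1 hx

end Norms

/-! ### The lasso with a quadratic loss -/

section Lasso

variable {ι : Type*} [Fintype ι]

/-- The `ℓ₁`-penalized quadratic loss `½ βᵀ D β - βᵀ q + λ |β|₁`. -/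
def lassoLoss (D : Matrix ι ι ℝ) (q : ι → ℝ) (lam : ℝ) (β : ι → ℝ) : ℝ :=
  1 / 2 * (β ⬝ᵥ D *ᵥ β) - β ⬝ᵥ q + lam * l1norm β

theorem lassoLoss_add {D : Matrix ι ι ℝ} (hD : Dᵀ = D) (q : ι → ℝ) (lam : ℝ) (β v : ι → ℝ) :
    lassoLoss D q lam (β + v) = lassoLoss D q lam β + 1 / 2 * (v ⬝ᵥ D *ᵥ v)
      + v ⬝ᵥ (D *ᵥ β - q) + lam * (l1norm (β + v) - l1norm β) := by
  have h : β ⬝ᵥ D *ᵥ v = v ⬝ᵥ D *ᵥ β := by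
    rw [dotProduct_comm, ← vecMul_transpose, hD, ← dotProduct_mulVec]
  simp only [lassoLoss, mulVec_add, add_dotProduct, dotProduct_add, dotProduct_sub, h]
  ring

theorem nonpos_of_forall_le_mul {x c : ℝ} (h : ∀ t, 0 < t → x ≤ t * c) : x ≤ 0 := by
  by_contra! hx
  have hc : 0 < |c| + 1 := by positivity
  have h1 := h (x / (2 * (|c| + 1))) (by positivity)
  have h2 : x / (2 * (|c| + 1)) * c ≤ x / (2 * (|c| + 1)) * (|c| + 1) :=
    mul_le_mul_of_nonneg_left (by linarith [le_abs_self c]) (by positivity)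
  have h3 : x / (2 * (|c| + 1)) * (|c| + 1) = x / 2 := by field_simp
  linarith

/-- The optimality condition of a one-dimensional lasso problem. -/
theorem foc_of_forall_nonneg {a r lam b : ℝ}
    (h : ∀ e : ℝ, 0 ≤ 1 / 2 * (e ^ 2 * a) + e * r + lam * (|b + e| - |b|)) (hl : 0 ≤ lam) :
    |r| ≤ lam ∧ b * r + lam * |b| = 0 := by
  have h1 : |r| ≤ lam := by
    have key : ∀ σ : ℝ, |σ| = 1 → -(σ * r) - lam ≤ 0 := by
      intro σ hσ
      refine nonpos_of_forall_le_mul (c := a / 2) fun t ht => ?_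
      have := h (t * σ)
      have h2 : |b + t * σ| - |b| ≤ t := by
        have := abs_add_le b (t * σ)
        rw [abs_mul, hσ, abs_of_pos ht] at this; linarith
      have h3 := mul_le_mul_of_nonneg_left h2 hl
      have h4 : σ ^ 2 = 1 := by rw [← sq_abs, hσ, one_pow]
      have h5 : 0 ≤ t * (1 / 2 * (t * a) + σ * r + lam) := by
        rw [mul_pow, h4, mul_one] at this
        linear_combination this + h3
      have := nonneg_of_mul_nonneg_right h5 ht
      linarith
    rw [abs_le]
    have k1 := key 1 (by simp)
    have k2 := key (-1) (by simp)
    constructor <;> linarith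
  refine ⟨h1, le_antisymm ?_ ?_⟩
  · refine nonpos_of_forall_le_mul (c := b ^ 2 * |a| + abs (b * r + lam * |b|)) fun t ht => ?_
    rcases le_or_gt 1 t with h2 | h2
    · have := le_abs_self (b * r + lam * |b|)
      have h3 : 0 ≤ b ^ 2 * |a| := by positivity
      nlinarith [abs_nonneg (b * r + lam * |b|)]
    · have := h (-(t * b))
      have h3 : |b + -(t * b)| = (1 - t) * |b| := by
        rw [show b + -(t * b) = (1 - t) * b by ring, abs_mul, abs_of_pos (by linarith)]
      rw [h3] at this
      have h5 : 0 ≤ t * (1 / 2 * (t * (b ^ 2 * a)) - (b * r + lam * |b|)) := by nlinarith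
      have h6 := nonneg_of_mul_nonneg_right h5 ht
      have h7 : t * (b ^ 2 * a) ≤ t * (b ^ 2 * |a|) := by
        gcongr; exact le_abs_self a
      have h8 : 0 ≤ t * (b ^ 2 * |a|) := by positivity
      have h9 : 0 ≤ t * abs (b * r + lam * |b|) := by positivity
      nlinarith
  · have h2 : -(|b| * |r|) ≤ b * r := by rw [← abs_mul]; exact neg_abs_le _
    nlinarith [abs_nonneg b]

/-- First-order conditions for a minimizer of the lasso loss among the vectors supported
in `A`. -/
theorem lassoLoss_foc [DecidableEq ι] {D : Matrix ι ι ℝ} (hD : Dᵀ = D) {q : ι → ℝ} {lam : ℝ}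
    (hl : 0 ≤ lam) {A : Finset ι} {β : ι → ℝ} (hβ : ∀ j, j ∉ A → β j = 0)
    (hmin : ∀ β' : ι → ℝ, (∀ j, j ∉ A → β' j = 0) → lassoLoss D q lam β ≤ lassoLoss D q lam β')
    {j : ι} (hj : j ∈ A) :
    |(D *ᵥ β - q) j| ≤ lam ∧ β j * (D *ᵥ β - q) j + lam * |β j| = 0 := by
  refine foc_of_forall_nonneg (a := D j j) (fun e => ?_) hl
  have h1 := hmin (β + Pi.single j e) fun k hk => by
    have : k ≠ j := fun h => hk (h ▸ hj)
    simp [hβ k hk, this]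
  rw [lassoLoss_add hD] at h1
  have h2 : l1norm (β + Pi.single j e) - l1norm β = |β j + e| - |β j| := by
    rw [l1norm, l1norm, ← Finset.sum_sub_distrib, Finset.sum_eq_single j]
    · simp
    · intro k _ hk; simp [hk]
    · simp
  rw [h2] at h1
  simp only [single_dotProduct, mulVec_single] at h1
  simp only [Pi.smul_apply, MulOpposite.smul_eq_mul_unop, MulOpposite.unop_op,
    Matrix.col_apply] at h1
  nlinarith

/-- If `D` is positive definite on the vectors supported in `A`, then the lasso loss has a
minimizer among them. -/
theorem exists_restricted_minimizer {D : Matrix ι ι ℝ} {q : ι → ℝ} {lam : ℝ}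
    (hl : 0 ≤ lam) {A : Finset ι} {c : ℝ} (hc : 0 < c)
    (hD : ∀ v : ι → ℝ, (∀ j, j ∉ A → v j = 0) → c * l2norm v ^ 2 ≤ v ⬝ᵥ D *ᵥ v) :
    ∃ β : ι → ℝ, (∀ j, j ∉ A → β j = 0) ∧
      ∀ β' : ι → ℝ, (∀ j, j ∉ A → β' j = 0) →
        lassoLoss D q lam β ≤ lassoLoss D q lam β' := by
  set R := 2 * l2norm q / c with hR
  have hR0 : 0 ≤ R := div_nonneg (by linarith [l2norm_nonneg q]) hc.le
  set S : Set (ι → ℝ) := {v | ∀ j, j ∉ A → v j = 0} with hS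
  have hSc : IsClosed S := by
    simp only [hS, Set.ofPred_forall]
    exact isClosed_iInter fun j => isClosed_iInter fun _ =>
      isClosed_eq (continuous_apply j) continuous_const
  have hcomp : IsCompact (Metric.closedBall (0 : ι → ℝ) R ∩ S) :=
    (isCompact_closedBall 0 R).inter_right hSc
  have hcont : Continuous (lassoLoss D q lam) := by
    unfold lassoLoss l1norm dotProduct mulVec dotProduct; fun_prop
  obtain ⟨β, hβ, hmin⟩ := hcomp.exists_isMinOn
    ⟨0, by simp [hR0], by simp [hS]⟩ hcont.continuousOn
  have h0 : lassoLoss D q lam 0 = 0 := by simp [lassoLoss, l1norm]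
  refine ⟨β, hβ.2, fun β' hβ' => ?_⟩
  by_cases hle : l2norm β' ≤ R
  · refine hmin ⟨?_, hβ'⟩
    rw [mem_closedBall_zero_iff, pi_norm_le_iff_of_nonneg hR0]
    exact fun j => (abs_le_l2norm β' j).trans hle
  · push Not at hle
    have h1 : lassoLoss D q lam β ≤ lassoLoss D q lam 0 :=
      hmin ⟨by simp [hR0], by simp [hS]⟩
    have h2 : 0 ≤ lassoLoss D q lam β' := by
      have h3 := hD β' hβ'
      have h4 := (abs_le.1 (abs_dotProduct_le_l2norm β' q)).2
      have h5 : 0 ≤ lam * l1norm β' :=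
        mul_nonneg hl (Finset.sum_nonneg fun _ _ => abs_nonneg _)
      have h6 : 2 * l2norm q ≤ c * l2norm β' := by
        rw [hR, div_lt_iff₀ hc] at hle; linarith
      have h7 := mul_le_mul_of_nonneg_left h6 (l2norm_nonneg β')
      unfold lassoLoss
      nlinarith
    linarith

/-- A vector supported in `A` is multiplied with a matrix through the columns in `A`. -/
theorem mulVec_eq_sum_support {A : Finset ι} {v : ι → ℝ} (hv : ∀ j, j ∉ A → v j = 0)
    (B : Matrix ι ι ℝ) (i : ι) :
    (B *ᵥ v) i = ∑ k : {j // j ∈ A}, B i k * v k := by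
  rw [mulVec, dotProduct, ← Finset.sum_subset (Finset.subset_univ A)
    fun j _ hj => by rw [hv j hj, mul_zero], Finset.sum_coe_sort A fun k => B i k * v k]

end Lasso

/-! ### Support recovery by a primal-dual witness -/

section Witness

variable {ι : Type*} [Fintype ι] [DecidableEq ι]

theorem dotProduct_eq_zero_off {A : Finset ι} {v : ι → ℝ} (hv : ∀ j, j ∉ A → v j = 0)
    (w : ι → ℝ) : v ⬝ᵥ w = v ⬝ᵥ fun j => if j ∈ A then w j else 0 := by
  refine Finset.sum_congr rfl fun j _ => ?_
  by_cases hj : j ∈ A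
  · simp [hj]
  · simp [hj, hv j hj]

/-- The block of `J` with rows and columns in `A`. -/
abbrev diagBlock (J : Matrix ι ι ℝ) (A : Finset ι) : Matrix {j // j ∈ A} {j // j ∈ A} ℝ :=
  J.submatrix Subtype.val Subtype.val

/-- The block of `J` with rows outside and columns inside `A`. -/
abbrev offBlock (J : Matrix ι ι ℝ) (A : Finset ι) : Matrix {j // j ∉ A} {j // j ∈ A} ℝ :=
  J.submatrix Subtype.val Subtype.val

/-- The hypotheses on the population matrix `J` and on the perturbed matrix `D` for the support
recovery: `J` is positive definite and satisfies the irrepresentable condition for `A`, and the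
rows of `D - J` restricted to `A` have a small Euclidean norm. -/
structure CloseToIrrepresentable (J D : Matrix ι ι ℝ) (A : Finset ι) (lamMin α κ : ℝ) : Prop where
  symm : Dᵀ = D
  psd : ∀ v : ι → ℝ, 0 ≤ v ⬝ᵥ D *ᵥ v
  lamMin_pos : 0 < lamMin
  posDef : ∀ v : ι → ℝ, lamMin * l2norm v ^ 2 ≤ v ⬝ᵥ J *ᵥ v
  alpha_mem : α ∈ Set.Ioo (0 : ℝ) 1
  irrep : rowSumNorm (offBlock J A
    * (diagBlock J A)⁻¹) ≤ 1 - α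
  kappa_nonneg : 0 ≤ κ
  close : ∀ v : ι → ℝ, (∀ j, j ∉ A → v j = 0) → ∀ j, |((D - J) *ᵥ v) j| ≤ κ * l2norm v
  kappa_small : 16 * (Real.sqrt A.card * κ) ≤ α * lamMin

namespace CloseToIrrepresentable

variable {J D : Matrix ι ι ℝ} {A : Finset ι} {lamMin α κ : ℝ}

theorem isUnit_det_submatrix (H : CloseToIrrepresentable J D A lamMin α κ) :
    IsUnit (diagBlock J A).det := by
  rw [isUnit_iff_ne_zero]
  intro h0
  obtain ⟨v, hv0, hv⟩ := Matrix.exists_mulVec_eq_zero_iff.2 h0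
  set w : ι → ℝ := fun j => if h : j ∈ A then v ⟨j, h⟩ else 0 with hw
  have hwA : ∀ j, j ∉ A → w j = 0 := fun j hj => by simp [hw, hj]
  have h1 : w ⬝ᵥ J *ᵥ w = 0 := by
    refine Finset.sum_eq_zero fun j _ => ?_
    by_cases hj : j ∈ A
    · have : (J *ᵥ w) j = 0 := by
        rw [mulVec_eq_sum_support hwA]
        refine Eq.trans ?_ (congrFun hv ⟨j, hj⟩)
        exact Finset.sum_congr rfl fun k _ => by simp [hw, k.2]
      rw [this, mul_zero]
    · rw [hwA j hj, zero_mul]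
  have h2 := H.posDef w
  rw [h1] at h2
  have h3 : l2norm w ^ 2 ≤ 0 := by
    by_contra! h
    nlinarith [H.lamMin_pos]
  refine hv0 (funext fun k => ?_)
  have h4 : l2norm w = 0 := pow_eq_zero_iff (two_ne_zero) |>.1 (le_antisymm h3 (sq_nonneg _))
  have := abs_le_l2norm w k
  rw [h4] at this
  simpa [hw, k.2] using abs_nonpos_iff.1 this

theorem posDef_restricted (H : CloseToIrrepresentable J D A lamMin α κ) (v : ι → ℝ)
    (hv : ∀ j, j ∉ A → v j = 0) : lamMin / 2 * l2norm v ^ 2 ≤ v ⬝ᵥ D *ᵥ v := by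
  have h1 : v ⬝ᵥ D *ᵥ v = v ⬝ᵥ J *ᵥ v + v ⬝ᵥ (D - J) *ᵥ v := by
    rw [← dotProduct_add, ← add_mulVec]; congr 2; abel
  have h2 : |v ⬝ᵥ (D - J) *ᵥ v| ≤ l2norm v * (Real.sqrt A.card * (κ * l2norm v)) := by
    rw [dotProduct_eq_zero_off hv]
    refine (abs_dotProduct_le_l2norm _ _).trans
      (mul_le_mul_of_nonneg_left ?_ (l2norm_nonneg _))
    exact l2norm_le_of_support (mul_nonneg H.kappa_nonneg (l2norm_nonneg _))
      (fun j hj => by simp [hj]) fun j hj => by simpa [hj] using H.close v hv j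
  have h3 := H.posDef v
  have h4 : Real.sqrt A.card * κ ≤ lamMin / 2 := by
    nlinarith [H.kappa_small, H.alpha_mem.2, H.alpha_mem.1, H.lamMin_pos]
  have h5 := mul_le_mul_of_nonneg_right h4 (sq_nonneg (l2norm v))
  have h6 := (abs_le.1 h2).1
  rw [h1]
  nlinarith

/-- If `D δ` is at most `Λ` in absolute value on `A`, where `δ` is supported in `A`, then `δ` and
the other coordinates of `D δ` are controlled as if `D` were `J`. -/
theorem bound_of_abs_le (H : CloseToIrrepresentable J D A lamMin α κ) {δ : ι → ℝ}
    (hδ : ∀ j, j ∉ A → δ j = 0) {Λ : ℝ} (hΛ : 0 ≤ Λ) (hy : ∀ j ∈ A, |(D *ᵥ δ) j| ≤ Λ) :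
    (∀ j ∈ A, |δ j| ≤ rowSumNorm (diagBlock J A)⁻¹
      * ((1 + α / 8) * Λ)) ∧
    ∀ j, j ∉ A → |(D *ᵥ δ) j| ≤ (1 - α) * ((1 + α / 8) * Λ) + α / 8 * Λ := by
  obtain ⟨hα0, hα1⟩ := H.alpha_mem
  have hlam := H.lamMin_pos
  have hsum : ∀ j, (D *ᵥ δ) j = (J *ᵥ δ) j + ((D - J) *ᵥ δ) j := fun j => by
    rw [sub_mulVec]; simp
  have hn := l2norm_nonneg δ
  -- the restricted positive definiteness bounds the Euclidean norm of `δ`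
  have hnorm : lamMin / 2 * l2norm δ ≤ Real.sqrt A.card * Λ := by
    have h1 := H.posDef_restricted δ hδ
    have h2 : |δ ⬝ᵥ D *ᵥ δ| ≤ l2norm δ * (Real.sqrt A.card * Λ) := by
      rw [dotProduct_eq_zero_off hδ]
      exact (abs_dotProduct_le_l2norm _ _).trans (mul_le_mul_of_nonneg_left
        (l2norm_le_of_support hΛ (fun j hj => by simp [hj])
          fun j hj => by simpa [hj] using hy j hj) hn)
    have h3 := (abs_le.1 h2).2
    rcases hn.eq_or_lt with h0 | hpos
    · rw [← h0]; simp only [mul_zero]; positivity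
    · have : l2norm δ * (lamMin / 2 * l2norm δ) ≤ l2norm δ * (Real.sqrt A.card * Λ) := by
        nlinarith
      exact le_of_mul_le_mul_left this hpos
  have hE : ∀ j, |((D - J) *ᵥ δ) j| ≤ α / 8 * Λ := by
    intro j
    refine (H.close δ hδ j).trans ?_
    have h1 := mul_le_mul_of_nonneg_left hnorm H.kappa_nonneg
    have h2 := mul_le_mul_of_nonneg_right H.kappa_small hΛ
    have : lamMin * (κ * l2norm δ) ≤ lamMin * (α / 8 * Λ) := by nlinarith
    exact le_of_mul_le_mul_left this hlam
  set JA := diagBlock J A with hJA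
  set δA : {j // j ∈ A} → ℝ := fun k => δ k with hδA
  have hJδ : ∀ k, |(JA *ᵥ δA) k| ≤ (1 + α / 8) * Λ := by
    intro k
    have h1 : (JA *ᵥ δA) k = (D *ᵥ δ) k - ((D - J) *ᵥ δ) k := by
      rw [hsum, add_sub_cancel_right, mulVec_eq_sum_support hδ]; rfl
    rw [h1]
    have := abs_sub ((D *ᵥ δ) k) (((D - J) *ᵥ δ) k)
    linarith [hy k k.2, hE k]
  have hinv : JA⁻¹ *ᵥ (JA *ᵥ δA) = δA := by
    rw [mulVec_mulVec, nonsing_inv_mul _ H.isUnit_det_submatrix, one_mulVec]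
  constructor
  · intro j hj
    have := abs_mulVec_le_rowSumNorm JA⁻¹ _ hJδ ⟨j, hj⟩
    rwa [hinv] at this
  · intro j hj
    have h1 : (J *ᵥ δ) j = ((offBlock J A * JA⁻¹) *ᵥ (JA *ᵥ δA)) ⟨j, hj⟩ := by
      rw [← mulVec_mulVec, hinv, mulVec_eq_sum_support hδ]; rfl
    have h2 := abs_mulVec_le_rowSumNorm (offBlock J A * JA⁻¹) _ hJδ ⟨j, hj⟩
    rw [← h1] at h2
    have h3 : 0 ≤ (1 + α / 8) * Λ := by positivity
    have h4 := mul_le_mul_of_nonneg_right H.irrep h3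
    rw [hsum]
    have := abs_add_le ((J *ᵥ δ) j) (((D - J) *ᵥ δ) j)
    linarith [hE j]

/-- The primal-dual witness: if the gradient `D β* - q` of the quadratic loss at `β*` is small
compared to `λ`, then the lasso has a minimizer, and every minimizer is supported in `A` and close
to `β*` in the maximum norm. -/
theorem lasso_support_recovery (H : CloseToIrrepresentable J D A lamMin α κ) {q βs : ι → ℝ}
    {lam : ℝ} (hlam : 0 < lam) (hβs : ∀ j, j ∉ A → βs j = 0)
    (hw : ∀ j, |(D *ᵥ βs - q) j| ≤ α / 8 * lam) :
    (∃ β, ∀ β', lassoLoss D q lam β ≤ lassoLoss D q lam β') ∧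
    ∀ β, (∀ β', lassoLoss D q lam β ≤ lassoLoss D q lam β') →
      (∀ j, j ∉ A → β j = 0) ∧
      ∀ j ∈ A, |β j - βs j| ≤
        rowSumNorm (diagBlock J A)⁻¹ * (2 * lam) := by
  obtain ⟨hα0, hα1⟩ := H.alpha_mem
  have hαl : 0 ≤ α / 8 * lam := by positivity
  -- properties of a minimizer among the vectors supported in `A`
  have key : ∀ β : ι → ℝ, (∀ j, j ∉ A → β j = 0) →
      (∀ β' : ι → ℝ, (∀ j, j ∉ A → β' j = 0) → lassoLoss D q lam β ≤ lassoLoss D q lam β') →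
      (∀ j ∈ A, |β j - βs j| ≤
        rowSumNorm (diagBlock J A)⁻¹ * (2 * lam)) ∧
      ∀ j, j ∉ A → |(D *ᵥ β - q) j| < lam := by
    intro β hβ hmin
    have hdec : ∀ j, (D *ᵥ (β - βs)) j = (D *ᵥ β - q) j - (D *ᵥ βs - q) j := fun j => by
      rw [mulVec_sub]; simp
    have hΛ : 0 ≤ lam + α / 8 * lam := by positivity
    obtain ⟨h1, h2⟩ := H.bound_of_abs_le (δ := β - βs) (Λ := lam + α / 8 * lam)
      (fun j hj => by simp [hβ j hj, hβs j hj]) hΛ fun j hj => by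
        rw [hdec]
        have := abs_sub ((D *ᵥ β - q) j) ((D *ᵥ βs - q) j)
        linarith [(lassoLoss_foc H.symm hlam.le hβ hmin hj).1, hw j]
    constructor
    · intro j hj
      refine (h1 j hj).trans (mul_le_mul_of_nonneg_left ?_ (rowSumNorm_nonneg _))
      nlinarith [mul_pos hα0 hlam, mul_pos (mul_pos hα0 hα0) hlam, mul_pos hlam (sub_pos.2 hα1),
        mul_pos (mul_pos hα0 hlam) (sub_pos.2 hα1)]
    · intro j hj
      have h3 := h2 j hj
      have h4 : (D *ᵥ β - q) j = (D *ᵥ (β - βs)) j + (D *ᵥ βs - q) j := by rw [hdec]; ring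
      rw [h4]
      have h5 := abs_add_le ((D *ᵥ (β - βs)) j) ((D *ᵥ βs - q) j)
      have h6 := hw j
      nlinarith [mul_pos hα0 hlam, mul_pos (mul_pos hα0 hα0) hlam, mul_pos hlam (sub_pos.2 hα1),
        mul_pos (mul_pos hα0 hlam) (sub_pos.2 hα1), mul_pos (mul_pos (mul_pos hα0 hα0) hα0) hlam]
  obtain ⟨β₀, hβ₀, hmin₀⟩ := exists_restricted_minimizer (q := q) hlam.le
    (half_pos H.lamMin_pos) H.posDef_restricted
  obtain ⟨-, hdual⟩ := key β₀ hβ₀ hmin₀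
  -- the loss exceeds its value at the witness coordinate by coordinate
  have hgap : ∀ β : ι → ℝ, lassoLoss D q lam β₀
      + ∑ j, ((D *ᵥ β₀ - q) j * β j + lam * |β j|) ≤ lassoLoss D q lam β := by
    intro β
    have h1 := lassoLoss_add H.symm q lam β₀ (β - β₀)
    rw [add_sub_cancel] at h1
    have h2 := H.psd (β - β₀)
    have h3 : (β - β₀) ⬝ᵥ (D *ᵥ β₀ - q) + lam * (l1norm β - l1norm β₀)
        = ∑ j, ((D *ᵥ β₀ - q) j * β j + lam * |β j|) := by
      rw [dotProduct, l1norm, l1norm, ← Finset.sum_sub_distrib, Finset.mul_sum,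
        ← Finset.sum_add_distrib]
      refine Finset.sum_congr rfl fun j _ => ?_
      by_cases hj : j ∈ A
      · have := (lassoLoss_foc H.symm hlam.le hβ₀ hmin₀ hj).2
        simp only [Pi.sub_apply] at this ⊢
        linarith
      · simp [hβ₀ j hj]; ring
    linarith
  have hterm : ∀ β : ι → ℝ, ∀ j, 0 ≤ (D *ᵥ β₀ - q) j * β j + lam * |β j| := by
    intro β j
    have h1 : |(D *ᵥ β₀ - q) j| ≤ lam := by
      by_cases hj : j ∈ A
      · exact (lassoLoss_foc H.symm hlam.le hβ₀ hmin₀ hj).1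
      · exact (hdual j hj).le
    have h2 := neg_abs_le ((D *ᵥ β₀ - q) j * β j)
    rw [abs_mul] at h2
    nlinarith [abs_nonneg (β j)]
  refine ⟨⟨β₀, fun β' => ?_⟩, fun β hβ => ?_⟩
  · linarith [hgap β', Finset.sum_nonneg fun j (_ : j ∈ Finset.univ) => hterm β' j]
  · have hzero : ∑ j, ((D *ᵥ β₀ - q) j * β j + lam * |β j|) = 0 :=
      le_antisymm (by linarith [hgap β, hβ β₀]) (Finset.sum_nonneg fun j _ => hterm β j)
    have hA : ∀ j, j ∉ A → β j = 0 := by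
      intro j hj
      have h1 := (Finset.sum_eq_zero_iff_of_nonneg fun j _ => hterm β j).1 hzero j
        (Finset.mem_univ j)
      by_contra hne
      have h2 := neg_abs_le ((D *ᵥ β₀ - q) j * β j)
      rw [abs_mul] at h2
      nlinarith [abs_pos.2 hne, hdual j hj]
    exact ⟨hA, (key β hA fun β' _ => hβ β').1⟩

end CloseToIrrepresentable

end Witness

/-! ### A Bernstein inequality for averages of i.i.d. variables -/

section SampleMean

variable {S Ω ι : Type*}

/-- The average of `φ` over the sample points with index in `T`. -/
def sampleMean (T : Finset ι) (ξ : ι → Ω → S) (φ : S → ℝ) (ω : Ω) : ℝ :=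
  (1 / (T.card : ℝ)) * ∑ q ∈ T, φ (ξ q ω)

theorem sampleMean_mono {T : Finset ι} {ξ : ι → Ω → S} {φ ψ : S → ℝ} {ω : Ω}
    (h : ∀ q ∈ T, φ (ξ q ω) ≤ ψ (ξ q ω)) : sampleMean T ξ φ ω ≤ sampleMean T ξ ψ ω :=
  mul_le_mul_of_nonneg_left (Finset.sum_le_sum h) (by positivity)

theorem sampleMean_sub (T : Finset ι) (ξ : ι → Ω → S) (φ ψ : S → ℝ) (ω : Ω) :
    sampleMean T ξ (fun z => φ z - ψ z) ω = sampleMean T ξ φ ω - sampleMean T ξ ψ ω := by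
  simp only [sampleMean, Finset.sum_sub_distrib, mul_sub]

theorem abs_sampleMean_le (T : Finset ι) (ξ : ι → Ω → S) (φ : S → ℝ) (ω : Ω) :
    |sampleMean T ξ φ ω| ≤ sampleMean T ξ (fun z => |φ z|) ω := by
  rw [sampleMean, abs_mul, abs_of_nonneg (by positivity : (0:ℝ) ≤ 1 / (T.card : ℝ))]
  exact mul_le_mul_of_nonneg_left (Finset.abs_sum_le_sum_abs _ _) (by positivity)

theorem sampleMean_le_of_le {T : Finset ι} {ξ : ι → Ω → S} {φ : S → ℝ} {ω : Ω} {x : ℝ}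
    (hx : 0 ≤ x) (h : ∀ q ∈ T, φ (ξ q ω) ≤ x) : sampleMean T ξ φ ω ≤ x := by
  rcases T.eq_empty_or_nonempty with rfl | hT
  · simpa [sampleMean] using hx
  have hc : (0 : ℝ) < T.card := by exact_mod_cast hT.card_pos
  have := Finset.sum_le_card_nsmul T _ x h
  rw [nsmul_eq_mul] at this
  rw [sampleMean, one_div, inv_mul_le_iff₀ hc]
  exact this

end SampleMean

section Bernstein

/-- The second-order Taylor bound behind Bernstein's inequality. -/
theorem exp_le_one_add_add_sq_mul (x : ℝ) :
    Real.exp x ≤ 1 + x + x ^ 2 * Real.exp |x| := by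
  have h := Complex.norm_exp_sub_sum_le_norm_mul_exp (x : ℂ) 2
  have h1 : Complex.exp x - ∑ m ∈ Finset.range 2, (x : ℂ) ^ m / (m.factorial : ℂ)
      = ((Real.exp x - (1 + x) : ℝ) : ℂ) := by
    simp [Finset.sum_range_succ]
  rw [h1, Complex.norm_real, Complex.norm_real, Real.norm_eq_abs, Real.norm_eq_abs, sq_abs] at h
  linarith [le_abs_self (Real.exp x - (1 + x))]

variable {S : Type*} [MeasurableSpace S] {μ : Measure S} [IsProbabilityMeasure μ]

theorem abs_le_one_add_sq_mul_exp (y : ℝ) {θ : ℝ} (hθ : 0 ≤ θ) :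
    |y| ≤ 1 + y ^ 2 * Real.exp (θ * |y|) := by
  have h1 : 1 ≤ Real.exp (θ * |y|) := Real.one_le_exp (by positivity)
  have h2 : |y| ≤ 1 + y ^ 2 := by rw [← sq_abs]; nlinarith [sq_nonneg (|y| - 1)]
  nlinarith [sq_nonneg y]

theorem exp_mul_le (y : ℝ) {θ : ℝ} (hθ : 0 ≤ θ) :
    Real.exp (θ * |y|) ≤ Real.exp θ + y ^ 2 * Real.exp (θ * |y|) := by
  rcases le_or_gt |y| 1 with h | h
  · have : Real.exp (θ * |y|) ≤ Real.exp θ := Real.exp_le_exp.2 (by nlinarith)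
    have := mul_nonneg (sq_nonneg y) (Real.exp_pos (θ * |y|)).le
    linarith
  · have : 1 ≤ y ^ 2 := by rw [← sq_abs]; nlinarith
    nlinarith [Real.exp_pos (θ * |y|), Real.exp_pos θ]

theorem integrable_of_sq_mul_exp {φ : S → ℝ} (hφ : Measurable φ) {θ : ℝ} (hθ : 0 ≤ θ)
    (hint : Integrable (fun z => φ z ^ 2 * Real.exp (θ * |φ z|)) μ) : Integrable φ μ :=
  ((integrable_const (1 : ℝ)).add hint).mono' hφ.aestronglyMeasurable
    (ae_of_all _ fun z => abs_le_one_add_sq_mul_exp (φ z) hθ)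

theorem integrable_exp_of_sq_mul_exp {φ : S → ℝ} (hφ : Measurable φ) {θ : ℝ} (hθ : 0 ≤ θ)
    (hint : Integrable (fun z => φ z ^ 2 * Real.exp (θ * |φ z|)) μ) :
    Integrable (fun z => Real.exp (θ * φ z)) μ := by
  refine ((integrable_const (Real.exp θ)).add hint).mono' (by fun_prop) (ae_of_all _ fun z => ?_)
  rw [Real.norm_eq_abs, Real.abs_exp]
  refine le_trans (Real.exp_le_exp.2 ?_) (exp_mul_le (φ z) hθ)
  exact mul_le_mul_of_nonneg_left (le_abs_self _) hθ

/-- The moment generating function of a centred variable, bounded through the second moment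
weighted by an exponential. -/
theorem mgf_sub_integral_le {φ : S → ℝ} (hφ : Measurable φ) {θ V : ℝ} (hθ : 0 ≤ θ)
    (hint : Integrable (fun z => φ z ^ 2 * Real.exp (θ * |φ z|)) μ)
    (hV : ∫ z, φ z ^ 2 * Real.exp (θ * |φ z|) ∂μ ≤ V) :
    mgf (fun z => φ z - ∫ z, φ z ∂μ) μ θ ≤ Real.exp (θ ^ 2 * V) := by
  set E := ∫ z, φ z ∂μ with hE
  have h1 : mgf (fun z => φ z - E) μ θ = Real.exp (-(θ * E)) * ∫ z, Real.exp (θ * φ z) ∂μ := by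
    rw [mgf, ← integral_const_mul]
    refine integral_congr_ae (ae_of_all _ fun z => ?_)
    dsimp only
    rw [← Real.exp_add]; congr 1; ring
  have hi := integrable_of_sq_mul_exp hφ hθ hint
  have h2 : ∫ z, Real.exp (θ * φ z) ∂μ ≤ 1 + θ * E + θ ^ 2 * V := by
    calc ∫ z, Real.exp (θ * φ z) ∂μ
        ≤ ∫ z, (1 + θ * φ z + θ ^ 2 * (φ z ^ 2 * Real.exp (θ * |φ z|))) ∂μ := by
          refine integral_mono (integrable_exp_of_sq_mul_exp hφ hθ hint)
            (((integrable_const _).add (hi.const_mul _)).add (hint.const_mul _)) fun z => ?_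
          have := exp_le_one_add_add_sq_mul (θ * φ z)
          rw [abs_mul, abs_of_nonneg hθ] at this
          refine this.trans_eq ?_
          ring
      _ = 1 + θ * E + θ ^ 2 * ∫ z, φ z ^ 2 * Real.exp (θ * |φ z|) ∂μ := by
          have e1 : Integrable (fun z => 1 + θ * φ z) μ := (integrable_const _).add (hi.const_mul _)
          rw [integral_add e1 (hint.const_mul _), integral_add (integrable_const _)
            (hi.const_mul _), integral_const_mul, integral_const_mul]
          simp [hE]
      _ ≤ _ := by gcongr
  rw [h1]
  calc _ ≤ Real.exp (-(θ * E)) * (1 + θ * E + θ ^ 2 * V) := by gcongr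
    _ ≤ Real.exp (-(θ * E)) * Real.exp (θ * E + θ ^ 2 * V) := by
        gcongr; linarith [Real.add_one_le_exp (θ * E + θ ^ 2 * V)]
    _ = _ := by rw [← Real.exp_add]; congr 1; ring

variable {Ω ι : Type*} [MeasurableSpace Ω]

/-- The family `ξ` is an i.i.d. sample from the law `μ`. -/
structure IsIIDSample (P : Measure Ω) (ξ : ι → Ω → S) (μ : Measure S) : Prop where
  measurable : ∀ q, Measurable (ξ q)
  law : ∀ q, P.map (ξ q) = μ
  indep : iIndepFun ξ P

/-- The Chernoff bound with a fixed exponent `θ`; `bernstein` optimizes over `θ`. -/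
theorem bernstein_upper {P : Measure Ω} [IsProbabilityMeasure P] {ξ : ι → Ω → S}
    (hξ : IsIIDSample P ξ μ) (T : Finset ι) {φ : S → ℝ} (hφ : Measurable φ) {θ V t : ℝ}
    (hθ : 0 ≤ θ) (hint : Integrable (fun z => φ z ^ 2 * Real.exp (θ * |φ z|)) μ)
    (hV : ∫ z, φ z ^ 2 * Real.exp (θ * |φ z|) ∂μ ≤ V) :
    P.real {ω | T.card * t ≤ ∑ q ∈ T, (φ (ξ q ω) - ∫ z, φ z ∂μ)}
      ≤ Real.exp (T.card * (θ ^ 2 * V - θ * t)) := by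
  set E := ∫ z, φ z ∂μ with hE
  have hmeas : ∀ q, Measurable (fun ω => φ (ξ q ω) - E) := fun q =>
    (hφ.comp (hξ.measurable q)).sub_const _
  have hind : iIndepFun (fun q ω => φ (ξ q ω) - E) P :=
    hξ.indep.comp (fun _ z => φ z - E) fun _ => hφ.sub_const _
  have hint' : ∀ q, Integrable (fun ω => Real.exp (θ * (φ (ξ q ω) - E))) P := by
    intro q
    have h1 : Integrable (fun z => Real.exp (θ * (φ z - E))) μ := by
      have : (fun z => Real.exp (θ * (φ z - E)))
          = fun z => Real.exp (-(θ * E)) * Real.exp (θ * φ z) := by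
        ext z; rw [← Real.exp_add]; congr 1; ring
      rw [this]
      exact (integrable_exp_of_sq_mul_exp hφ hθ hint).const_mul _
    rw [← hξ.law q] at h1
    exact h1.comp_measurable (hξ.measurable q)
  have hmgf : ∀ q, mgf (fun ω => φ (ξ q ω) - E) P θ ≤ Real.exp (θ ^ 2 * V) := by
    intro q
    have h1 := mgf_sub_integral_le hφ hθ hint hV
    rw [mgf, ← hξ.law q, integral_map (hξ.measurable q).aemeasurable] at h1
    · rwa [hξ.law q] at h1
    · have : Measurable fun z => Real.exp (θ * (φ z - ∫ z, φ z ∂P.map (ξ q))) := by fun_prop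
      exact this.aestronglyMeasurable
  have h1 := measure_ge_le_exp_mul_mgf (μ := P) (X := ∑ q ∈ T, fun ω => φ (ξ q ω) - E)
    (T.card * t) hθ (hind.integrable_exp_mul_sum hmeas fun q _ => hint' q)
  rw [hind.mgf_sum hmeas] at h1
  simp only [Finset.sum_apply] at h1
  refine h1.trans ?_
  have h2 : ∏ q ∈ T, mgf (fun ω => φ (ξ q ω) - E) P θ ≤ Real.exp (θ ^ 2 * V) ^ T.card :=
    (Finset.prod_le_prod (fun _ _ => mgf_nonneg) fun q _ => hmgf q).trans_eq
      (Finset.prod_const _)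
  calc _ ≤ Real.exp (-θ * (T.card * t)) * Real.exp (θ ^ 2 * V) ^ T.card := by gcongr
    _ = _ := by rw [← Real.exp_nat_mul, ← Real.exp_add]; congr 1; ring

/-- **Bernstein's inequality** for the average of i.i.d. variables, where `V` bounds the second
moment weighted by an exponential of rate `θ₀`. -/
theorem bernstein {P : Measure Ω} [IsProbabilityMeasure P] {ξ : ι → Ω → S}
    (hξ : IsIIDSample P ξ μ) (T : Finset ι) {φ : S → ℝ} (hφ : Measurable φ) {θ₀ V t : ℝ}
    (hint : Integrable (fun z => φ z ^ 2 * Real.exp (θ₀ * |φ z|)) μ)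
    (hV : ∫ z, φ z ^ 2 * Real.exp (θ₀ * |φ z|) ∂μ ≤ V) (hVpos : 0 < V) (ht : 0 ≤ t)
    (hθ₀ : t ≤ 2 * V * θ₀) :
    P.real {ω | t < |sampleMean T ξ φ ω - ∫ z, φ z ∂μ|}
      ≤ 2 * Real.exp (-(T.card * t ^ 2 / (4 * V))) := by
  rcases T.eq_empty_or_nonempty with rfl | hT
  · simp only [Finset.card_empty, Nat.cast_zero, zero_mul, zero_div, neg_zero, Real.exp_zero]
    linarith [measureReal_le_one (μ := P) (s := {ω | t < |sampleMean ∅ ξ φ ω - ∫ z, φ z ∂μ|})]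
  have hc : (0 : ℝ) < T.card := by exact_mod_cast hT.card_pos
  set θ := t / (2 * V) with hθ
  have hθ0 : 0 ≤ θ := by positivity
  have hle : θ ≤ θ₀ := by rw [hθ, div_le_iff₀ (by positivity)]; linarith
  have hpt : ∀ z, φ z ^ 2 * Real.exp (θ * |φ z|) ≤ φ z ^ 2 * Real.exp (θ₀ * |φ z|) :=
    fun z => by gcongr
  have hint' : Integrable (fun z => φ z ^ 2 * Real.exp (θ * |φ z|)) μ :=
    hint.mono' (by fun_prop) (ae_of_all _ fun z => by
      rw [Real.norm_eq_abs, abs_of_nonneg (by positivity)]; exact hpt z)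
  have hV' : ∫ z, φ z ^ 2 * Real.exp (θ * |φ z|) ∂μ ≤ V :=
    (integral_mono hint' hint hpt).trans hV
  have h1 := bernstein_upper hξ T hφ (t := t) hθ0 hint' hV'
  have h2 := bernstein_upper hξ T hφ.neg (t := t) hθ0
    (by simpa using hint') (by simpa using hV')
  have hexp : (T.card : ℝ) * (θ ^ 2 * V - θ * t) = -(T.card * t ^ 2 / (4 * V)) := by
    rw [hθ]; field_simp; ring
  rw [hexp] at h1 h2
  refine le_trans (measureReal_mono (s₂ := {ω | T.card * t ≤ ∑ q ∈ T, (φ (ξ q ω) - ∫ z, φ z ∂μ)} ∪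
    {ω | T.card * t ≤ ∑ q ∈ T, ((-φ) (ξ q ω) - ∫ z, (-φ) z ∂μ)}) ?_)
    ((measureReal_union_le _ _).trans (by linarith))
  intro ω hω
  have h3 : ∑ q ∈ T, (φ (ξ q ω) - ∫ z, φ z ∂μ)
      = T.card * (sampleMean T ξ φ ω - ∫ z, φ z ∂μ) := by
    rw [Finset.sum_sub_distrib, sampleMean, Finset.sum_const, nsmul_eq_mul]; field_simp
  have h4 : ∑ q ∈ T, ((-φ) (ξ q ω) - ∫ z, (-φ) z ∂μ)
      = -∑ q ∈ T, (φ (ξ q ω) - ∫ z, φ z ∂μ) := by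
    rw [← Finset.sum_neg_distrib]
    refine Finset.sum_congr rfl fun q _ => ?_
    simp only [Pi.neg_apply, integral_neg]; ring
  rcases lt_abs.1 (show t < |_| from hω) with h | h
  · left
    simp only [Set.mem_ofPred_eq]
    rw [h3]; gcongr
  · right
    simp only [Set.mem_ofPred_eq]
    rw [h4, h3, ← mul_neg]; gcongr

end Bernstein

/-! ### Finite grids in the unit ball -/

/-- A grid of mesh `1 / R` approximates the vectors of the unit ball with support in `A`, from
below in norm. -/
theorem exists_grid {ι : Type*} [Fintype ι] [DecidableEq ι] (A : Finset ι) {R : ℕ} (hR : 0 < R) :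
    ∃ G : Finset (ι → ℝ), G.card ≤ (2 * R + 1) ^ A.card ∧
      (∀ v ∈ G, (∀ j, j ∉ A → v j = 0) ∧ l2norm v ≤ 1) ∧
      ∀ v : ι → ℝ, (∀ j, j ∉ A → v j = 0) → l2norm v ≤ 1 →
        ∃ w ∈ G, ∀ j, |v j - w j| ≤ 1 / R := by
  have hR' : (0 : ℝ) < R := by exact_mod_cast hR
  set f : ((j : ι) → ℤ) → ι → ℝ := fun k j => (k j : ℝ) / R with hf
  set B : ι → Finset ℤ := fun j => if j ∈ A then Finset.Icc (-(R : ℤ)) R else {0} with hB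
  refine ⟨((Fintype.piFinset B).image f).filter fun v => l2norm v ≤ 1, ?_, ?_, ?_⟩
  · refine (Finset.card_filter_le _ _).trans (Finset.card_image_le.trans ?_)
    rw [Fintype.card_piFinset]
    have h1 : ∀ j, (B j).card = if j ∈ A then 2 * R + 1 else 1 := by
      intro j
      by_cases hj : j ∈ A
      · simp only [hB, hj, if_true, Int.card_Icc]; omega
      · simp [hB, hj]
    rw [Finset.prod_congr rfl fun j _ => h1 j]
    simp
  · intro v hv
    rw [Finset.mem_filter, Finset.mem_image] at hv
    obtain ⟨⟨k, hk, rfl⟩, hn⟩ := hv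
    refine ⟨fun j hj => ?_, hn⟩
    have := Fintype.mem_piFinset.1 hk j
    simp only [hB, hj, if_false, Finset.mem_singleton] at this
    simp [hf, this]
  · intro v hv hn
    -- round every coordinate towards zero
    set k : ι → ℤ := fun j => if 0 ≤ v j then ⌊v j * R⌋ else ⌈v j * R⌉ with hk
    have hround : ∀ j, |(k j : ℝ)| ≤ |v j| * R ∧ |v j * R - k j| ≤ 1 := by
      intro j
      by_cases h0 : 0 ≤ v j
      · have h1 : (0 : ℝ) ≤ (k j : ℝ) := by
          simp only [hk, h0, if_true]; exact_mod_cast Int.floor_nonneg.2 (by positivity)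
        have h2 : (k j : ℝ) ≤ v j * R := by
          simp only [hk, h0, if_true]; exact Int.floor_le _
        have h3 : v j * R < k j + 1 := by
          simp only [hk, h0, if_true]; exact Int.lt_floor_add_one _
        rw [abs_of_nonneg h1, abs_of_nonneg h0, abs_of_nonneg (by linarith)]
        exact ⟨h2, by linarith⟩
      · have h0' : v j < 0 := not_le.1 h0
        have h1 : (k j : ℝ) ≤ 0 := by
          simp only [hk, h0, if_false]
          exact_mod_cast Int.ceil_nonpos.2 (by nlinarith)
        have h2 : v j * R ≤ (k j : ℝ) := by
          simp only [hk, h0, if_false]; exact Int.le_ceil _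
        have h3 : (k j : ℝ) < v j * R + 1 := by
          simp only [hk, h0, if_false]; exact Int.ceil_lt_add_one _
        rw [abs_of_nonpos h1, abs_of_neg h0', abs_of_nonpos (by linarith)]
        exact ⟨by linarith, by linarith⟩
    have habs : ∀ j, |f k j| ≤ |v j| := fun j => by
      simp only [hf, abs_div, abs_of_pos hR']
      rw [div_le_iff₀ hR']; exact (hround j).1
    refine ⟨f k, ?_, fun j => ?_⟩
    · rw [Finset.mem_filter, Finset.mem_image]
      refine ⟨⟨k, Fintype.mem_piFinset.2 fun j => ?_, rfl⟩, ?_⟩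
      · by_cases hj : j ∈ A
        · simp only [hB, hj, if_true, Finset.mem_Icc]
          have h1 : |(k j : ℝ)| ≤ R := by
            have := (abs_le_l2norm v j).trans hn
            have h2 := (hround j).1
            nlinarith
          have := abs_le.1 h1
          exact ⟨by exact_mod_cast this.1, by exact_mod_cast this.2⟩
        · simp [hB, hj, hk, hv j hj]
      · refine le_trans (Real.sqrt_le_sqrt (Finset.sum_le_sum fun j _ => ?_)) hn
        exact sq_le_sq.2 (habs j)
    · have : v j - f k j = (v j * R - k j) / R := by simp only [hf]; field_simp
      rw [this, abs_div, abs_of_pos hR']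
      gcongr
      exact (hround j).2

/-! ### Distributions on the line with a Lipschitz density -/

/-- The measure `ν` is a distribution on the line with a Lipschitz density `f`, at most `f₂` at the
origin. -/
structure HasLipschitzDensity (ν : Measure ℝ) (f : ℝ → ℝ) (f₂ L : ℝ) : Prop where
  eq : ν = volume.withDensity fun u => ENNReal.ofReal (f u)
  prob : IsProbabilityMeasure ν
  nonneg : ∀ u, 0 ≤ f u
  le_zero : f 0 ≤ f₂
  lip_nonneg : 0 ≤ L
  lip : ∀ u v, |f u - f v| ≤ L * |u - v|

namespace HasLipschitzDensity

variable {ν : Measure ℝ} {f : ℝ → ℝ} {f₂ L : ℝ}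

theorem continuous (H : HasLipschitzDensity ν f f₂ L) : Continuous f := by
  have : LipschitzWith (Real.toNNReal L) f := LipschitzWith.of_dist_le_mul fun u v => by
    rw [Real.dist_eq, Real.dist_eq, Real.coe_toNNReal _ H.lip_nonneg]; exact H.lip u v
  exact this.continuous

theorem le_add (H : HasLipschitzDensity ν f f₂ L) (u : ℝ) : f u ≤ f₂ + L * |u| := by
  have := (abs_le.1 (H.lip u 0)).2
  rw [sub_zero] at this
  linarith [H.le_zero]

theorem integral_eq (H : HasLipschitzDensity ν f f₂ L) (φ : ℝ → ℝ) :
    ∫ u, φ u ∂ν = ∫ u, f u * φ u := by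
  rw [H.eq, integral_withDensity_eq_integral_toReal_smul
    (H.continuous.measurable.ennreal_ofReal) (ae_of_all _ fun u => ENNReal.ofReal_lt_top)]
  refine integral_congr_ae (ae_of_all _ fun u => ?_)
  simp [ENNReal.toReal_ofReal (H.nonneg u)]

theorem nullSingletonClass (H : HasLipschitzDensity ν f f₂ L) : NullSingletonClass ν := by
  rw [H.eq]; infer_instance

/-- The increment of the distribution function, linearized at the origin. -/
theorem abs_integral_indicator_sub_le (H : HasLipschitzDensity ν f f₂ L) (t : ℝ) :
    |∫ u, ((if u ≤ t then (1 : ℝ) else 0) - if u ≤ 0 then 1 else 0) ∂ν - f 0 * t|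
      ≤ L * t ^ 2 := by
  have h1 : ∫ u, ((if u ≤ t then (1 : ℝ) else 0) - if u ≤ 0 then 1 else 0) ∂ν
      = ∫ u in (0 : ℝ)..t, f u := by
    rw [H.integral_eq]
    rcases le_total 0 t with ht | ht
    · rw [intervalIntegral.integral_of_le ht, ← integral_indicator measurableSet_Ioc]
      congr 1; ext u
      by_cases h1 : u ≤ 0
      · simp [h1, h1.trans ht]
      · by_cases h2 : u ≤ t <;> simp [h1, h2, Set.indicator, not_le.1 h1]
    · rw [intervalIntegral.integral_of_ge ht, ← integral_indicator measurableSet_Ioc,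
        ← integral_neg]
      congr 1; ext u
      by_cases h1 : u ≤ t
      · simp [h1, h1.trans ht]
      · by_cases h2 : u ≤ 0 <;> simp [h1, h2, Set.indicator, not_le.1 h1]
  have h2 : ∫ u in (0 : ℝ)..t, f u - f 0 = (∫ u in (0 : ℝ)..t, f u) - f 0 * t := by
    rw [intervalIntegral.integral_sub (H.continuous.intervalIntegrable _ _)
      intervalIntegrable_const]
    simp [mul_comm]
  rw [h1, ← h2]
  have h3 := intervalIntegral.norm_integral_le_of_norm_le_const (a := 0) (b := t)
    (f := fun u => f u - f 0) (C := L * |t|) fun u hu => by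
      rw [Real.norm_eq_abs]
      refine (H.lip u 0).trans (mul_le_mul_of_nonneg_left ?_ H.lip_nonneg)
      rw [sub_zero]
      rcases le_total 0 t with ht | ht
      · rw [Set.uIoc_of_le ht] at hu
        rw [abs_of_pos hu.1, abs_of_nonneg ht]; exact hu.2
      · rw [Set.uIoc_of_ge ht] at hu
        rw [abs_of_nonpos hu.2, abs_of_nonpos ht]; linarith [hu.1]
  rw [Real.norm_eq_abs, sub_zero] at h3
  calc _ ≤ _ := h3
    _ = L * t ^ 2 := by rw [← sq_abs t]; ring

/-- The mass between the origin and `t`. -/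
theorem integral_abs_indicator_sub_le (H : HasLipschitzDensity ν f f₂ L) (t : ℝ) :
    ∫ u, |(if u ≤ t then (1 : ℝ) else 0) - if u ≤ 0 then 1 else 0| ∂ν
      ≤ (f₂ + L * |t|) * |t| := by
  have h0 := H.abs_integral_indicator_sub_le t
  have hf : |f 0 * t| ≤ f₂ * |t| := by
    rw [abs_mul, abs_of_nonneg (H.nonneg 0)]
    exact mul_le_mul_of_nonneg_right H.le_zero (abs_nonneg _)
  have h1 : |∫ u, ((if u ≤ t then (1 : ℝ) else 0) - if u ≤ 0 then 1 else 0) ∂ν|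
      ≤ (f₂ + L * |t|) * |t| := by
    have := abs_add_le (∫ u, ((if u ≤ t then (1 : ℝ) else 0) - if u ≤ 0 then 1 else 0) ∂ν
      - f 0 * t) (f 0 * t)
    rw [sub_add_cancel] at this
    rw [← sq_abs t] at h0
    linarith
  refine le_trans (le_of_eq ?_) h1
  rcases le_total 0 t with ht | ht
  · have : ∀ u : ℝ, |(if u ≤ t then (1 : ℝ) else 0) - if u ≤ 0 then 1 else 0|
        = (if u ≤ t then (1 : ℝ) else 0) - if u ≤ 0 then 1 else 0 := by
      intro u
      apply abs_of_nonneg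
      by_cases h1 : u ≤ 0
      · simp [h1, h1.trans ht]
      · by_cases h2 : u ≤ t <;> simp [h1, h2]
    simp only [this]
    rw [abs_of_nonneg]
    exact integral_nonneg fun u => by dsimp only; rw [← this]; exact abs_nonneg _
  · have : ∀ u : ℝ, |(if u ≤ t then (1 : ℝ) else 0) - if u ≤ 0 then 1 else 0|
        = -((if u ≤ t then (1 : ℝ) else 0) - if u ≤ 0 then 1 else 0) := by
      intro u
      apply abs_of_nonpos
      by_cases h1 : u ≤ t
      · simp [h1, h1.trans ht]
      · by_cases h2 : u ≤ 0 <;> simp [h1, h2]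
    simp only [this]
    rw [integral_neg, abs_of_nonpos]
    have h2 : 0 ≤ ∫ u, -((if u ≤ t then (1 : ℝ) else 0) - if u ≤ 0 then 1 else 0) ∂ν :=
      integral_nonneg fun u => by dsimp only; rw [← this]; exact abs_nonneg _
    rw [integral_neg] at h2
    linarith

/-- The mass of a short interval. -/
theorem integral_indicator_abs_sub_le (H : HasLipschitzDensity ν f f₂ L) (t : ℝ) {δ : ℝ}
    (hδ : 0 ≤ δ) :
    ∫ u, (if |u - t| ≤ δ then (1 : ℝ) else 0) ∂ν ≤ 2 * δ * (f₂ + L * (|t| + δ)) := by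
  have hset : ∀ u : ℝ, (|u - t| ≤ δ) ↔ u ∈ Set.Icc (t - δ) (t + δ) := fun u => by
    rw [abs_le, Set.mem_Icc]; constructor <;> rintro ⟨h1, h2⟩ <;> constructor <;> linarith
  have h1 : ∫ u, (if |u - t| ≤ δ then (1 : ℝ) else 0) ∂ν
      = ∫ u in Set.Icc (t - δ) (t + δ), f u := by
    rw [H.integral_eq, ← integral_indicator measurableSet_Icc]
    congr 1; ext u
    simp only [hset, Set.indicator]
    split_ifs <;> simp
  rw [h1]
  have h2 := norm_setIntegral_le_of_norm_le_const (μ := volume) (s := Set.Icc (t - δ) (t + δ))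
    (f := f) (C := f₂ + L * (|t| + δ)) (by simp) fun u hu => by
      rw [Real.norm_eq_abs, abs_of_nonneg (H.nonneg u)]
      refine (H.le_add u).trans ?_
      have : |u| ≤ |t| + δ := by
        have h3 := abs_add_le (u - t) t
        rw [sub_add_cancel] at h3
        linarith [(hset u).2 hu]
      have := mul_le_mul_of_nonneg_left this H.lip_nonneg
      linarith
  rw [Real.norm_eq_abs] at h2
  refine (le_abs_self _).trans (h2.trans (le_of_eq ?_))
  rw [Measure.real, Real.volume_Icc, ENNReal.toReal_ofReal (by linarith)]
  ring

end HasLipschitzDensity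

/-! ### Smoothing with the kernel -/

namespace IsSmoothingKernel

variable {K : ℝ → ℝ}

theorem exists_bounds (hK : IsSmoothingKernel K) :
    ∃ B > 0, (∀ u, K u ≤ B) ∧ ∀ u v, |K u - K v| ≤ B * |u - v| := by
  obtain ⟨B₁, h1⟩ := hK.bounded
  obtain ⟨B₂, h2⟩ := hK.deriv_bounded
  refine ⟨max 1 (max B₁ B₂), by positivity, fun u => (h1 u).trans (by simp), fun u v => ?_⟩
  have := Convex.norm_image_sub_le_of_norm_deriv_le (f := K) (s := Set.univ) (x := v) (y := u)
    (C := B₂) (fun x _ => hK.differentiable x) (fun x _ => h2 x) convex_univ trivial trivial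
  rw [Real.norm_eq_abs, Real.norm_eq_abs] at this
  exact this.trans (mul_le_mul_of_nonneg_right (by simp) (abs_nonneg _))

theorem integrable_abs_mul (hK : IsSmoothingKernel K) : Integrable fun u => |u| * K u := by
  refine (hK.integrable.add hK.second_moment).mono' ?_ (ae_of_all _ fun u => ?_)
  · exact (continuous_abs.mul hK.differentiable.continuous).aestronglyMeasurable
  · rw [Real.norm_eq_abs, abs_of_nonneg (mul_nonneg (abs_nonneg _) (hK.nonneg u))]
    have : |u| ≤ 1 + u ^ 2 := by rw [← sq_abs]; nlinarith [sq_nonneg (|u| - 1)]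
    calc |u| * K u ≤ (1 + u ^ 2) * K u := mul_le_mul_of_nonneg_right this (hK.nonneg u)
      _ = _ := by simp; ring

theorem scaledKernel_nonneg (hK : IsSmoothingKernel K) {b : ℝ} (hb : 0 < b) (u : ℝ) :
    0 ≤ scaledKernel K b u := div_nonneg (hK.nonneg _) hb.le

theorem scaledKernel_le {B b : ℝ} (hB : ∀ u, K u ≤ B) (hb : 0 < b) (u : ℝ) :
    scaledKernel K b u ≤ B / b := div_le_div_of_nonneg_right (hB _) hb.le

theorem abs_scaledKernel_sub_le {B b : ℝ} (hB : ∀ u v, |K u - K v| ≤ B * |u - v|) (hb : 0 < b)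
    (u v : ℝ) : |scaledKernel K b u - scaledKernel K b v| ≤ B / b ^ 2 * |u - v| := by
  unfold scaledKernel
  rw [← sub_div, abs_div, abs_of_pos hb, div_le_iff₀ hb]
  refine (hB _ _).trans (le_of_eq ?_)
  rw [← sub_div, abs_div, abs_of_pos hb]
  field_simp

theorem continuous_scaledKernel (hK : IsSmoothingKernel K) (b : ℝ) :
    Continuous (scaledKernel K b) :=
  (hK.differentiable.continuous.comp (continuous_id.div_const b)).div_const b

variable {ν : Measure ℝ} {f : ℝ → ℝ} {f₂ L : ℝ}

/-- Smoothing a Lipschitz density at scale `b` near the point `t` recovers its value at the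
origin up to `O(|t| + b)`. -/
theorem abs_integral_scaledKernel_sub_le (hK : IsSmoothingKernel K)
    (H : HasLipschitzDensity ν f f₂ L) {b : ℝ} (hb : 0 < b) (t : ℝ) :
    |∫ u, scaledKernel K b (u - t) ∂ν - f 0| ≤ L * (|t| + b * ∫ u, |u| * K u) := by
  have h1 : ∫ u, scaledKernel K b (u - t) ∂ν = ∫ w, K w * f (t + b * w) := by
    rw [H.integral_eq]
    have e1 : ∀ u, f u * scaledKernel K b (u - t)
        = (fun y => b⁻¹ * (K (y / b) * f (t + b * (y / b)))) (u - t) := by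
      intro u
      simp only [scaledKernel]
      rw [show t + b * ((u - t) / b) = u by field_simp; ring]
      field_simp
    simp only [e1]
    rw [integral_sub_right_eq_self (fun y => b⁻¹ * (K (y / b) * f (t + b * (y / b)))) t,
      integral_const_mul, Measure.integral_comp_div (fun w => K w * f (t + b * w)) b,
      abs_of_pos hb, smul_eq_mul, ← mul_assoc, inv_mul_cancel₀ hb.ne', one_mul]
  have hpt : ∀ w, |K w * (f (t + b * w) - f 0)| ≤ L * |t| * K w + L * b * (|w| * K w) := by
    intro w
    rw [abs_mul, abs_of_nonneg (hK.nonneg w)]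
    have h2 : |f (t + b * w) - f 0| ≤ L * (|t| + b * |w|) := by
      refine (H.lip _ _).trans (mul_le_mul_of_nonneg_left ?_ H.lip_nonneg)
      rw [sub_zero]
      refine (abs_add_le _ _).trans ?_
      rw [abs_mul, abs_of_pos hb]
    calc _ ≤ K w * (L * (|t| + b * |w|)) := mul_le_mul_of_nonneg_left h2 (hK.nonneg w)
      _ = _ := by ring
  have hdom : Integrable fun w => L * |t| * K w + L * b * (|w| * K w) :=
    (hK.integrable.const_mul _).add (hK.integrable_abs_mul.const_mul _)
  have hcont := H.continuous
  have hKc := hK.differentiable.continuous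
  have hint : Integrable fun w => K w * (f (t + b * w) - f 0) :=
    hdom.mono' (by fun_prop) (ae_of_all _ fun w => hpt w)
  have h3 : ∫ w, K w * f (t + b * w) = (∫ w, K w * (f (t + b * w) - f 0)) + f 0 := by
    have : ∀ w, K w * f (t + b * w) = K w * (f (t + b * w) - f 0) + K w * f 0 := fun w => by ring
    simp only [this]
    rw [integral_add hint (hK.integrable.mul_const _), integral_mul_const, hK.integral_eq_one,
      one_mul]
  rw [h1, h3, add_sub_cancel_right]
  calc |∫ w, K w * (f (t + b * w) - f 0)| ≤ ∫ w, |K w * (f (t + b * w) - f 0)| :=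
        abs_integral_le_integral_abs
    _ ≤ ∫ w, (L * |t| * K w + L * b * (|w| * K w)) :=
        integral_mono hint.abs hdom hpt
    _ = _ := by
        rw [integral_add (hK.integrable.const_mul _) (hK.integrable_abs_mul.const_mul _),
          integral_const_mul, integral_const_mul, hK.integral_eq_one]
        ring

/-- The square of the rescaled kernel has integral of order `1 / b`, not `1 / b²`, since one of the
two factors is bounded by `B / b` and the other one integrates to a bounded quantity. -/
theorem integral_scaledKernel_sq_le (hK : IsSmoothingKernel K)
    (H : HasLipschitzDensity ν f f₂ L) {B b : ℝ} (hB : ∀ u, K u ≤ B) (hb : 0 < b) (t : ℝ) :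
    ∫ u, scaledKernel K b (u - t) ^ 2 ∂ν
      ≤ B / b * (f₂ + L * (|t| + b * ∫ u, |u| * K u)) := by
  have := H.prob
  have hc := hK.continuous_scaledKernel b
  have hbd : ∀ u, |scaledKernel K b (u - t)| ≤ B / b := fun u => by
    rw [abs_of_nonneg (hK.scaledKernel_nonneg hb _)]; exact scaledKernel_le hB hb _
  have hB0 : 0 ≤ B / b := (abs_nonneg _).trans (hbd 0)
  have hint : Integrable (fun u => scaledKernel K b (u - t)) ν :=
    (integrable_const (B / b)).mono' (by fun_prop) (ae_of_all _ hbd)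
  have h1 : ∫ u, scaledKernel K b (u - t) ^ 2 ∂ν
      ≤ ∫ u, B / b * scaledKernel K b (u - t) ∂ν := by
    refine integral_mono_of_nonneg (ae_of_all _ fun u => sq_nonneg _) (hint.const_mul _)
      (ae_of_all _ fun u => ?_)
    dsimp only
    rw [sq]
    exact mul_le_mul_of_nonneg_right (scaledKernel_le hB hb _) (hK.scaledKernel_nonneg hb _)
  refine h1.trans ?_
  rw [integral_const_mul]
  refine mul_le_mul_of_nonneg_left ?_ hB0
  have := (abs_le.1 (hK.abs_integral_scaledKernel_sub_le H hb t)).2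
  linarith [H.le_zero]

end IsSmoothingKernel

/-! ### Quantiles of a continuous distribution -/

/-- For a law without atoms the `τ`-quantile has mass exactly `τ` to its left; the law is translated
so that its quantile is the origin. -/
theorem measure_Iic_zero_of_quantile {ρ : Measure ℝ} [IsProbabilityMeasure ρ] [NullSingletonClass ρ]
    {τ c : ℝ} (hτ : τ ∈ Set.Ioo (0 : ℝ) 1) (h : quantile (ρ.map fun u => u + c) τ = c) :
    ρ (Set.Iic 0) = ENNReal.ofReal τ := by
  have hmap : ∀ y, (ρ.map fun u => u + c) (Set.Iic y) = ρ (Set.Iic (y - c)) := fun y => by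
    rw [Measure.map_apply (measurable_add_const c) measurableSet_Iic]
    congr 1; ext u; simp [le_sub_iff_add_le]
  set S : Set ℝ := {y | ENNReal.ofReal τ ≤ ρ (Set.Iic (y - c))} with hS
  have hSinf : sInf S = c := by rw [← h, quantile]; simp only [hmap, hS]
  have hτ1 : ENNReal.ofReal τ < 1 := by
    rw [← ENNReal.ofReal_one]; exact (ENNReal.ofReal_lt_ofReal_iff one_pos).2 hτ.2
  have hne : S.Nonempty := by
    have h1 := tendsto_measure_Iic_atTop ρ
    rw [measure_univ] at h1
    obtain ⟨y, hy⟩ := (h1.eventually (lt_mem_nhds hτ1)).exists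
    exact ⟨y + c, by simpa [hS] using hy.le⟩
  have hbdd : BddBelow S := by
    obtain ⟨y, hy⟩ := ((tendsto_cdf_atBot ρ).eventually (gt_mem_nhds hτ.1)).exists
    replace hy := (ENNReal.ofReal_lt_ofReal_iff hτ.1).2 hy
    rw [ofReal_cdf] at hy
    refine ⟨y + c, fun x hx => ?_⟩
    by_contra! hlt
    have : ρ (Set.Iic (x - c)) ≤ ρ (Set.Iic y) :=
      measure_mono (Set.Iic_subset_Iic.2 (by linarith))
    exact absurd (le_trans hx this) (not_le.2 hy)
  apply le_antisymm
  · have h1 : ρ (Set.Iic 0) = ρ (Set.Iio 0) := (measure_congr Iio_ae_eq_Iic).symm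
    have h2 : Set.Iio (0 : ℝ) = ⋃ n : ℕ, Set.Iic (-(1 / ((n : ℝ) + 1))) := by
      ext u
      simp only [Set.mem_Iio, Set.mem_iUnion, Set.mem_Iic]
      constructor
      · intro hu
        obtain ⟨n, hn⟩ := exists_nat_one_div_lt (neg_pos.2 hu)
        exact ⟨n, by linarith⟩
      · rintro ⟨n, hn⟩
        have : (0 : ℝ) < 1 / ((n : ℝ) + 1) := by positivity
        linarith
    rw [h1, h2, Monotone.measure_iUnion]
    · refine iSup_le fun n => ?_
      by_contra! hlt
      have h3 : c - 1 / ((n : ℝ) + 1) ∈ S := by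
        simp only [hS, Set.mem_ofPred_eq]
        rw [show c - 1 / ((n : ℝ) + 1) - c = -(1 / ((n : ℝ) + 1)) by ring]
        exact hlt.le
      have h4 := csInf_le hbdd h3
      rw [hSinf] at h4
      have : (0 : ℝ) < 1 / ((n : ℝ) + 1) := by positivity
      linarith
    · intro m n hmn
      refine Set.Iic_subset_Iic.2 (neg_le_neg (one_div_le_one_div_of_le (by positivity) ?_))
      have : (m : ℝ) ≤ n := by exact_mod_cast hmn
      linarith
  · have h2 : Set.Iic (0 : ℝ) = ⋂ n : ℕ, Set.Iic (1 / ((n : ℝ) + 1)) := by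
      ext u
      simp only [Set.mem_Iic, Set.mem_iInter]
      constructor
      · intro hu n
        have : (0 : ℝ) < 1 / ((n : ℝ) + 1) := by positivity
        linarith
      · intro hu
        by_contra! hpos
        obtain ⟨n, hn⟩ := exists_nat_one_div_lt hpos
        linarith [hu n]
    have hanti : Antitone fun n : ℕ => Set.Iic (1 / ((n : ℝ) + 1)) := by
      intro m n hmn
      refine Set.Iic_subset_Iic.2 (one_div_le_one_div_of_le (by positivity) ?_)
      have : (m : ℝ) ≤ n := by exact_mod_cast hmn
      linarith
    rw [h2, hanti.measure_iInter (fun n => measurableSet_Iic.nullMeasurableSet)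
      ⟨0, measure_ne_top _ _⟩]
    refine le_iInf fun n => ?_
    have : (0 : ℝ) < 1 / ((n : ℝ) + 1) := by positivity
    obtain ⟨y, hy, hlt⟩ := exists_lt_of_csInf_lt hne
      (show sInf S < c + 1 / ((n : ℝ) + 1) by linarith)
    exact le_trans hy (measure_mono (Set.Iic_subset_Iic.2 (by linarith)))

/-! ### Exponential moments of sub-Gaussian variables -/

/-- The layer-cake formula turns sub-Gaussian tails into an exponential moment of the square. -/
theorem lintegral_exp_sq_le {S : Type*} [MeasurableSpace S] {μ : Measure S}
    [IsProbabilityMeasure μ] {φ : S → ℝ} (hφ : Measurable φ) {σ : ℝ} (hσ : 0 < σ)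
    (h : ∀ t, 0 < t → μ {z | σ * t ≤ |φ z|} ≤ ENNReal.ofReal (2 * Real.exp (-t ^ 2 / 2))) :
    ∫⁻ z, ENNReal.ofReal (Real.exp (1 / (4 * σ ^ 2) * φ z ^ 2)) ∂μ ≤ 3 := by
  rw [lintegral_eq_lintegral_meas_le μ (ae_of_all _ fun z => (Real.exp_pos _).le)
    (by fun_prop), ← Set.Ioc_union_Ioi_eq_Ioi zero_le_one]
  refine (lintegral_union_le _ _ _).trans ?_
  have h1 : ∫⁻ y in Set.Ioc (0 : ℝ) 1, μ {z | y ≤ Real.exp (1 / (4 * σ ^ 2) * φ z ^ 2)} ≤ 1 := by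
    refine (lintegral_mono fun y => prob_le_one).trans ?_
    simp
  have h2 : ∫⁻ y in Set.Ioi (1 : ℝ), μ {z | y ≤ Real.exp (1 / (4 * σ ^ 2) * φ z ^ 2)} ≤ 2 := by
    have hle : ∀ y ∈ Set.Ioi (1 : ℝ), μ {z | y ≤ Real.exp (1 / (4 * σ ^ 2) * φ z ^ 2)}
        ≤ ENNReal.ofReal (2 * y ^ (-2 : ℝ)) := by
      intro y hy
      have hy1 : (1 : ℝ) < y := hy
      have hlog : 0 < Real.log y := Real.log_pos hy1
      have h3 := h (2 * Real.sqrt (Real.log y)) (by positivity)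
      have h4 : 2 * Real.exp (-(2 * Real.sqrt (Real.log y)) ^ 2 / 2) = 2 * y ^ (-2 : ℝ) := by
        rw [mul_pow, Real.sq_sqrt hlog.le, Real.rpow_def_of_pos (by linarith)]
        congr 2; ring
      rw [h4] at h3
      refine le_trans (measure_mono fun z hz => ?_) h3
      have h5 : Real.log y ≤ 1 / (4 * σ ^ 2) * φ z ^ 2 :=
        (Real.log_le_iff_le_exp (by linarith)).2 hz
      simp only [Set.mem_ofPred_eq]
      apply le_of_sq_le_sq _ (abs_nonneg _)
      rw [sq_abs, mul_pow, mul_pow, Real.sq_sqrt hlog.le]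
      calc σ ^ 2 * (2 ^ 2 * Real.log y) ≤ σ ^ 2 * (2 ^ 2 * (1 / (4 * σ ^ 2) * φ z ^ 2)) := by
            gcongr
        _ = φ z ^ 2 := by field_simp; ring
    refine (setLIntegral_mono' measurableSet_Ioi hle).trans ?_
    rw [← ofReal_integral_eq_lintegral_ofReal]
    · rw [integral_const_mul, integral_Ioi_rpow_of_lt (by norm_num) one_pos]
      norm_num
    · exact (integrableOn_Ioi_rpow_of_lt (by norm_num) one_pos).const_mul 2
    · refine (ae_restrict_iff' measurableSet_Ioi).2 (ae_of_all _ fun y hy => ?_)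
      have : (0 : ℝ) < y := lt_trans one_pos hy
      simp only [Pi.zero_apply]
      positivity
  calc _ ≤ (1 : ENNReal) + 2 := add_le_add h1 h2
    _ = 3 := by norm_num

theorem integrable_exp_sq {S : Type*} [MeasurableSpace S] {μ : Measure S}
    [IsProbabilityMeasure μ] {φ : S → ℝ} (hφ : Measurable φ) {σ : ℝ} (hσ : 0 < σ)
    (h : ∀ t, 0 < t → μ {z | σ * t ≤ |φ z|} ≤ ENNReal.ofReal (2 * Real.exp (-t ^ 2 / 2))) :
    Integrable (fun z => Real.exp (1 / (4 * σ ^ 2) * φ z ^ 2)) μ ∧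
      ∫ z, Real.exp (1 / (4 * σ ^ 2) * φ z ^ 2) ∂μ ≤ 3 := by
  have h1 := lintegral_exp_sq_le hφ hσ h
  have h0 : ∀ᵐ z ∂μ, 0 ≤ Real.exp (1 / (4 * σ ^ 2) * φ z ^ 2) :=
    ae_of_all _ fun z => (Real.exp_pos _).le
  have hm : AEStronglyMeasurable (fun z => Real.exp (1 / (4 * σ ^ 2) * φ z ^ 2)) μ := by fun_prop
  constructor
  · refine ⟨hm, ?_⟩
    rw [hasFiniteIntegral_iff_ofReal h0]
    exact lt_of_le_of_lt h1 (by simp)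
  · rw [integral_eq_lintegral_of_nonneg_ae h0 hm]
    exact ENNReal.toReal_le_of_le_ofReal (by norm_num) (by simpa using h1)

/-! ### Eigenvalues and quadratic forms -/

theorem quadForm_nonneg_of_hasEigenvalue {d : ℕ} {B : Matrix (Fin d) (Fin d) ℝ}
    (hB : B.IsHermitian)
    (h : ∀ μ : ℝ, ∀ v : Fin d → ℝ, v ≠ 0 → B *ᵥ v = μ • v → 0 ≤ μ) (v : Fin d → ℝ) :
    0 ≤ v ⬝ᵥ B *ᵥ v := by
  have h1 : B.PosSemidef := by
    rw [hB.posSemidef_iff_eigenvalues_nonneg]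
    intro i
    refine h _ _ ?_ (hB.mulVec_eigenvectorBasis i)
    intro h0
    have h2 := hB.eigenvectorBasis.orthonormal.ne_zero i
    exact h2 (by ext j; exact congrFun h0 j)
  simpa using h1.dotProduct_mulVec_nonneg v

theorem hasEigenvalue_of_mulVec_eq {d : ℕ} {B : Matrix (Fin d) (Fin d) ℝ} {μ : ℝ}
    {v : Fin d → ℝ} (hv : v ≠ 0) (h : B *ᵥ v = μ • v) :
    Module.End.HasEigenvalue (Matrix.toLin' B) μ :=
  Module.End.hasEigenvalue_of_hasEigenvector (x := v)
    ⟨Module.End.mem_eigenspace_iff.2 (by rw [toLin'_apply, h]), hv⟩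

/-- Bounds on the eigenvalues of a symmetric matrix are bounds on its quadratic form. -/
theorem quadForm_bounds {d : ℕ} {B : Matrix (Fin d) (Fin d) ℝ} (hB : B.IsHermitian) {lo hi : ℝ}
    (h : ∀ μ : ℝ, Module.End.HasEigenvalue (Matrix.toLin' B) μ → lo ≤ μ ∧ μ ≤ hi)
    (v : Fin d → ℝ) : lo * l2norm v ^ 2 ≤ v ⬝ᵥ B *ᵥ v ∧ v ⬝ᵥ B *ᵥ v ≤ hi * l2norm v ^ 2 := by
  have hone : ∀ c : ℝ, (c • (1 : Matrix (Fin d) (Fin d) ℝ)).IsHermitian := fun c => by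
    rw [Matrix.IsHermitian, conjTranspose_smul, conjTranspose_one]; simp
  constructor
  · have := quadForm_nonneg_of_hasEigenvalue (hB.sub (hone lo)) (fun μ w hw he => by
      have h1 : B *ᵥ w = (μ + lo) • w := by
        rw [sub_mulVec, smul_mulVec, one_mulVec] at he
        rw [add_smul, ← he]; abel
      have := (h _ (hasEigenvalue_of_mulVec_eq hw h1)).1
      linarith) v
    rw [sub_mulVec, smul_mulVec, one_mulVec, dotProduct_sub, dotProduct_smul,
      ← l2norm_sq_eq_dotProduct, smul_eq_mul] at this
    linarith
  · have := quadForm_nonneg_of_hasEigenvalue ((hone hi).sub hB) (fun μ w hw he => by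
      have h1 : B *ᵥ w = (hi - μ) • w := by
        rw [sub_mulVec, smul_mulVec, one_mulVec] at he
        rw [sub_smul, ← he]; abel
      have := (h _ (hasEigenvalue_of_mulVec_eq hw h1)).2
      linarith) v
    rw [sub_mulVec, smul_mulVec, one_mulVec, dotProduct_sub, dotProduct_smul,
      ← l2norm_sq_eq_dotProduct, smul_eq_mul] at this
    linarith

/-! ### The regularity of the population -/

namespace Population

variable {τ : ℝ} (Q : Population τ)

/-- The error `ε = Y - Xᵀ β*` as a function of the observation. -/
def err (z : (Fin (Q.p + 1) → ℝ) × ℝ) : ℝ := z.2 - z.1 ⬝ᵥ Q.betaStar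

/-- The conditional distribution of the error given the covariate. -/
def errKernel : Kernel (Fin (Q.p + 1) → ℝ) ℝ :=
  condDistrib (fun z : (Fin (Q.p + 1) → ℝ) × ℝ => z.2 - z.1 ⬝ᵥ Q.betaStar) Prod.fst Q.law

instance : IsMarkovKernel Q.errKernel := by unfold errKernel; infer_instance

theorem continuous_dotProduct_const {ι : Type*} [Fintype ι] (v : ι → ℝ) :
    Continuous fun x : ι → ℝ => x ⬝ᵥ v := by
  unfold dotProduct; fun_prop

theorem measurable_fst_dotProduct {ι : Type*} [Fintype ι] (v : ι → ℝ) :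
    Measurable fun z : (ι → ℝ) × ℝ => z.1 ⬝ᵥ v :=
  (continuous_dotProduct_const v).measurable.comp measurable_fst

theorem measurable_err : Measurable Q.err :=
  measurable_snd.sub (measurable_fst_dotProduct _)

/-- What the hypotheses on the covariate and on the error provide for the proof: a Lipschitz
conditional density of the error, with `P(ε ≤ 0 | X) = τ`, uniform exponential moments of the
squares of the linear forms `Xᵀ u`, and a lower bound on the quadratic form of the matrix `I`. -/
structure IsRegular (f₂ L g lamMin : ℝ) : Prop where
  hasDensity : ∀ᵐ z ∂Q.law, HasLipschitzDensity (Q.errKernel z.1) (Q.dens z.1) f₂ L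
  level : ∀ᵐ z ∂Q.law, (Q.errKernel z.1).real (Set.Iic 0) = τ
  g_pos : 0 < g
  expMoment : ∀ u, l2norm u ≤ 1 →
    Integrable (fun z => Real.exp (g * (z.1 ⬝ᵥ u) ^ 2)) Q.law ∧
      ∫ z, Real.exp (g * (z.1 ⬝ᵥ u) ^ 2) ∂Q.law ≤ 3
  info_lower : ∀ v, lamMin * l2norm v ^ 2 ≤ v ⬝ᵥ Q.Info *ᵥ v

section Regularity

variable {Q}

theorem hasLipschitzDensity_of_densityCondition {f₁ f₂ l₀ : ℝ}
    (h : Q.DensityCondition f₁ f₂ l₀) :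
    ∀ᵐ z ∂Q.law, HasLipschitzDensity (Q.errKernel z.1) (Q.dens z.1) f₂ |l₀| ∧
      f₁ ≤ Q.dens z.1 0 := by
  filter_upwards [ae_of_ae_map measurable_fst.aemeasurable Q.dens_eq,
    ae_of_ae_map measurable_fst.aemeasurable h] with z h1 h2
  exact ⟨⟨h1, inferInstance, Q.dens_nonneg z.1, h2.1.2, abs_nonneg _, fun u v =>
    (h2.2 u v).trans (mul_le_mul_of_nonneg_right (le_abs_self _) (abs_nonneg _))⟩, h2.1.1⟩

/-- The conditional distribution of `Y` is that of the error, translated by `Xᵀ β*`. -/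
theorem condDistrib_snd_eq_map : ∀ᵐ x ∂(Q.law.map Prod.fst),
    condDistrib Prod.snd Prod.fst Q.law x
      = (Q.errKernel x).map fun u => u + x ⬝ᵥ Q.betaStar := by
  have hm : Measurable fun q : (Fin (Q.p + 1) → ℝ) × ℝ => q.2 + q.1 ⬝ᵥ Q.betaStar :=
    measurable_snd.add (measurable_fst_dotProduct _)
  set κ : Kernel (Fin (Q.p + 1) → ℝ) ℝ :=
    (Kernel.deterministic id measurable_id ×ₖ Q.errKernel).map
      fun q => q.2 + q.1 ⬝ᵥ Q.betaStar with hκ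
  have hκx : ∀ x, κ x = (Q.errKernel x).map fun u => u + x ⬝ᵥ Q.betaStar := by
    intro x
    rw [hκ, Kernel.map_apply _ hm, Kernel.prod_apply, Kernel.deterministic_apply,
      Measure.dirac_prod, Measure.map_map hm measurable_prodMk_left]
    rfl
  have hmark : IsMarkovKernel κ := by rw [hκ]; exact Kernel.IsMarkovKernel.map _ hm
  have hkey := condDistrib_ae_eq_of_measure_eq_compProd (μ := Q.law) (Y := Prod.snd) Prod.fst
    measurable_snd.aemeasurable (κ := κ) ?_
  · filter_upwards [hkey] with x hx
    rw [hx, hκx]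
  · ext s hs
    have hshift : Measurable fun q : (Fin (Q.p + 1) → ℝ) × ℝ => (q.1, q.2 + q.1 ⬝ᵥ Q.betaStar) :=
      measurable_fst.prodMk hm
    have hpair : Measurable fun z : (Fin (Q.p + 1) → ℝ) × ℝ =>
        (z.1, z.2 - z.1 ⬝ᵥ Q.betaStar) :=
      measurable_fst.prodMk (measurable_snd.sub (measurable_fst_dotProduct _))
    have h1 := compProd_map_condDistrib (mβ := MeasurableSpace.pi) (μ := Q.law) (X := Prod.fst)
      (Y := fun z : (Fin (Q.p + 1) → ℝ) × ℝ => z.2 - z.1 ⬝ᵥ Q.betaStar)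
      (measurable_snd.sub (measurable_fst_dotProduct _)).aemeasurable
    have h2 := congrArg (fun ρ => ρ ((fun q : (Fin (Q.p + 1) → ℝ) × ℝ =>
      (q.1, q.2 + q.1 ⬝ᵥ Q.betaStar)) ⁻¹' s)) h1
    rw [Measure.compProd_apply (hshift hs), Measure.map_apply hpair (hshift hs)] at h2
    rw [Measure.compProd_apply hs, Measure.map_apply (measurable_fst.prodMk measurable_snd) hs]
    have h3 : ∀ x, κ x (Prod.mk x ⁻¹' s) = condDistrib (fun z : (Fin (Q.p + 1) → ℝ) × ℝ =>
        z.2 - z.1 ⬝ᵥ Q.betaStar) Prod.fst Q.law x (Prod.mk x ⁻¹' ((fun q :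
          (Fin (Q.p + 1) → ℝ) × ℝ => (q.1, q.2 + q.1 ⬝ᵥ Q.betaStar)) ⁻¹' s)) := by
      intro x
      rw [hκx, Measure.map_apply (measurable_add_const _) (measurable_prodMk_left hs)]
      rfl
    simp only [h3]
    rw [h2]
    congr 1
    ext z
    simp

/-- The quantile assumption, restated for the error: `P(ε ≤ 0 | X) = τ`. -/
theorem errKernel_Iic_zero {f₁ f₂ l₀ : ℝ} (hτ : τ ∈ Set.Ioo (0 : ℝ) 1)
    (h : Q.DensityCondition f₁ f₂ l₀) :
    ∀ᵐ z ∂Q.law, (Q.errKernel z.1).real (Set.Iic 0) = τ := by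
  filter_upwards [hasLipschitzDensity_of_densityCondition h,
    ae_of_ae_map measurable_fst.aemeasurable Q.quantile_eq,
    ae_of_ae_map measurable_fst.aemeasurable Q.condDistrib_snd_eq_map] with z h1 h2 h3
  have := h1.1.nullSingletonClass
  rw [h3] at h2
  rw [Measure.real, measure_Iic_zero_of_quantile hτ h2, ENNReal.toReal_ofReal hτ.1.le]

theorem mul_dotProduct_eq_sum {ι : Type*} [Fintype ι] (c : ℝ) (x u v : ι → ℝ) :
    c * ((x ⬝ᵥ u) * (x ⬝ᵥ v)) = ∑ j, ∑ k, u j * (c * (x j * x k) * v k) := by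
  rw [dotProduct, dotProduct, Finset.sum_mul_sum, Finset.mul_sum]
  refine Finset.sum_congr rfl fun j _ => ?_
  rw [Finset.mul_sum]
  exact Finset.sum_congr rfl fun k _ => by ring

/-- The bilinear form of a weighted matrix of second moments. -/
theorem dotProduct_moment_mulVec {w : (Fin (Q.p + 1) → ℝ) × ℝ → ℝ}
    (hint : ∀ j k, Integrable (fun z => w z * (z.1 j * z.1 k)) Q.law)
    (u v : Fin (Q.p + 1) → ℝ) :
    u ⬝ᵥ (Matrix.of fun j k => ∫ z, w z * (z.1 j * z.1 k) ∂Q.law) *ᵥ v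
      = ∫ z, w z * ((z.1 ⬝ᵥ u) * (z.1 ⬝ᵥ v)) ∂Q.law := by
  simp only [mul_dotProduct_eq_sum]
  rw [integral_finsetSum _ fun j _ => integrable_finsetSum _ fun k _ =>
    ((hint j k).mul_const _).const_mul _]
  refine Finset.sum_congr rfl fun j _ => ?_
  rw [integral_finsetSum _ fun k _ => ((hint j k).mul_const _).const_mul _, mulVec, dotProduct,
    Finset.mul_sum]
  refine Finset.sum_congr rfl fun k _ => ?_
  rw [integral_const_mul, integral_mul_const, of_apply]

/-- The sub-Gaussian tail of an arbitrary linear form `Xᵀ u`, at the scale `ρ = (uᵀ Σ u)^{1/2}`. The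
hypothesis forces `Σ` to be invertible, since otherwise `Σ⁻¹` would be the zero matrix. -/
theorem subGaussian_tail {c₁ : ℝ} (h : Q.SubGaussian c₁) :
    ∀ u, ∃ ρ, 0 ≤ ρ ∧ ρ ^ 2 = u ⬝ᵥ Q.Sigma *ᵥ u ∧ (u ≠ 0 → 0 < ρ) ∧
      ∀ t, 0 < t → u ≠ 0 →
        Q.law {z | c₁ * ρ * t ≤ |z.1 ⬝ᵥ u|} ≤ ENNReal.ofReal (2 * Real.exp (-t ^ 2 / 2)) := by
  obtain ⟨R, hR, hRR, htail⟩ := h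
  have hRu : IsUnit R.det := (isUnit_iff_isUnit_det _).1 hR.isUnit
  have hSu : IsUnit Q.Sigma.det := by
    by_contra hn
    rw [nonsing_inv_apply_not_isUnit _ hn] at hRR
    have h1 := congrArg Matrix.det hRR
    rw [det_mul, det_zero] at h1
    exact hRu.ne_zero (mul_self_eq_zero.1 h1)
  have hRT : R⁻¹ᵀ = R⁻¹ := by
    rw [transpose_nonsing_inv]
    congr 1
    simpa using hR.isHermitian.eq
  have hSig : R⁻¹ * R⁻¹ = Q.Sigma := by
    rw [← Matrix.mul_inv_rev, hRR, nonsing_inv_nonsing_inv _ hSu]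
  intro u
  have hpos : u ≠ 0 → 0 < l2norm (R⁻¹ *ᵥ u) := by
    intro hu
    refine lt_of_le_of_ne (l2norm_nonneg _) fun h0 => hu ?_
    have h1 : R⁻¹ *ᵥ u = 0 := by
      ext j
      have := abs_le_l2norm (R⁻¹ *ᵥ u) j
      rw [← h0] at this
      simpa using this
    have h2 := congrArg (fun v => R *ᵥ v) h1
    simpa [mulVec_mulVec, mul_nonsing_inv _ hRu] using h2
  refine ⟨l2norm (R⁻¹ *ᵥ u), l2norm_nonneg _, ?_, hpos, fun t ht hu => ?_⟩
  · have e1 : R⁻¹ *ᵥ u = u ᵥ* R⁻¹ := by rw [← vecMul_transpose, hRT]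
    rw [l2norm_sq_eq_dotProduct]
    nth_rewrite 1 [e1]
    rw [← dotProduct_mulVec, mulVec_mulVec, hSig]
  · set ρ := l2norm (R⁻¹ *ᵥ u) with hρ
    have hρ0 := hpos hu
    have h1 := htail (ρ⁻¹ • (R⁻¹ *ᵥ u))
      (by rw [l2norm_smul, abs_of_pos (inv_pos.2 hρ0), ← hρ, inv_mul_cancel₀ hρ0.ne']) t ht
    refine le_trans (measure_mono fun z hz => ?_) h1
    simp only [Set.mem_ofPred_eq] at hz ⊢
    rw [mulVec_smul, mulVec_mulVec, mul_nonsing_inv _ hRu, one_mulVec, dotProduct_smul,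
      smul_eq_mul, abs_mul, abs_of_pos (inv_pos.2 hρ0), ← div_eq_inv_mul, le_div_iff₀ hρ0]
    linarith

theorem integrable_dotProduct_sq {c₁ : ℝ} (hc₁ : 0 < c₁) (h : Q.SubGaussian c₁)
    (u : Fin (Q.p + 1) → ℝ) : Integrable (fun z => (z.1 ⬝ᵥ u) ^ 2) Q.law := by
  rcases eq_or_ne u 0 with rfl | hu
  · simp
  obtain ⟨ρ, -, -, hpos, htail⟩ := subGaussian_tail h u
  have hσ : 0 < c₁ * ρ := mul_pos hc₁ (hpos hu)
  have h1 := (integrable_exp_sq (μ := Q.law) (measurable_fst_dotProduct u) hσ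
    fun t ht => htail t ht hu).1
  refine (h1.const_mul (4 * (c₁ * ρ) ^ 2)).mono'
    ((measurable_fst_dotProduct u).pow_const 2).aestronglyMeasurable (ae_of_all _ fun z => ?_)
  rw [Real.norm_eq_abs, abs_of_nonneg (sq_nonneg _)]
  have h2 := Real.add_one_le_exp (1 / (4 * (c₁ * ρ) ^ 2) * (z.1 ⬝ᵥ u) ^ 2)
  have hne := hσ.ne'
  have h3 : (z.1 ⬝ᵥ u) ^ 2
      = 4 * (c₁ * ρ) ^ 2 * (1 / (4 * (c₁ * ρ) ^ 2) * (z.1 ⬝ᵥ u) ^ 2) := by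
    rw [← mul_assoc, mul_one_div_cancel (by positivity), one_mul]
  rw [h3]
  refine mul_le_mul_of_nonneg_left ?_ (by positivity)
  rw [← h3]
  linarith

theorem integrable_mul_apply {c₁ : ℝ} (hc₁ : 0 < c₁) (h : Q.SubGaussian c₁)
    (j k : Fin (Q.p + 1)) : Integrable (fun z => z.1 j * z.1 k) Q.law := by
  have hs : ∀ j, Integrable (fun z => z.1 j ^ 2) Q.law := fun j => by
    simpa using integrable_dotProduct_sq hc₁ h (Pi.single j 1)
  refine ((hs j).add (hs k)).mono'
    (((measurable_pi_apply j).comp measurable_fst).mul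
      ((measurable_pi_apply k).comp measurable_fst)).aestronglyMeasurable (ae_of_all _ fun z => ?_)
  rw [Real.norm_eq_abs, abs_mul]
  simp only [Pi.add_apply]
  rw [← sq_abs (z.1 j), ← sq_abs (z.1 k)]
  nlinarith [sq_nonneg (|z.1 j| - |z.1 k|), abs_nonneg (z.1 j), abs_nonneg (z.1 k)]

theorem measurable_dens_zero : Measurable fun z : (Fin (Q.p + 1) → ℝ) × ℝ => Q.dens z.1 0 :=
  Q.measurable_dens.comp (measurable_fst.prodMk measurable_const)

theorem Info_isHermitian : Q.Info.IsHermitian := by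
  ext j k
  simp only [conjTranspose_apply, Info, star_trivial]
  congr 1; ext z; ring

/-- The largest eigenvalue of `Σ` is at most `lamMax / f₁`, as `f₁ Σ ≤ I`; this makes the linear
forms with unit coefficients sub-Gaussian with a constant that does not depend on the dimension. -/
theorem isRegular {f₁ f₂ l₀ c₁ α lamMin lamMax : ℝ} (hf₁ : 0 < f₁) (hc₁ : 0 < c₁)
    (hlamMax : 0 < lamMax) (hτ : τ ∈ Set.Ioo (0 : ℝ) 1) (hd : Q.DensityCondition f₁ f₂ l₀)
    (hs : Q.SubGaussian c₁) (hI : Q.Irrepresentable α lamMin lamMax) :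
    Q.IsRegular f₂ |l₀| (1 / (4 * (c₁ ^ 2 * (lamMax / f₁)))) lamMin := by
  have hdens := hasLipschitzDensity_of_densityCondition hd
  have hquad := quadForm_bounds Q.Info_isHermitian hI.2
  have hintw : ∀ j k, Integrable (fun z => Q.dens z.1 0 * (z.1 j * z.1 k)) Q.law := fun j k =>
    (integrable_mul_apply hc₁ hs j k).bdd_mul (c := f₂)
      measurable_dens_zero.aestronglyMeasurable (by
        filter_upwards [hdens] with z hz
        rw [Real.norm_eq_abs, abs_of_nonneg (hz.1.nonneg 0)]; exact hz.1.le_zero)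
  -- the second moments of linear forms are bounded through `I`
  have hSig : ∀ u, u ⬝ᵥ Q.Sigma *ᵥ u ≤ lamMax / f₁ * l2norm u ^ 2 := by
    intro u
    have e1 : u ⬝ᵥ Q.Sigma *ᵥ u = ∫ z, (z.1 ⬝ᵥ u) ^ 2 ∂Q.law := by
      have := dotProduct_moment_mulVec (Q := Q) (w := fun _ => 1)
        (fun j k => by simpa using integrable_mul_apply hc₁ hs j k) u u
      simp only [one_mul, ← sq] at this
      exact this
    have e2 : u ⬝ᵥ Q.Info *ᵥ u = ∫ z, Q.dens z.1 0 * ((z.1 ⬝ᵥ u) * (z.1 ⬝ᵥ u)) ∂Q.law :=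
      dotProduct_moment_mulVec hintw u u
    have h1 : f₁ * ∫ z, (z.1 ⬝ᵥ u) ^ 2 ∂Q.law ≤ u ⬝ᵥ Q.Info *ᵥ u := by
      rw [e2, ← integral_const_mul]
      have hi := integrable_dotProduct_sq hc₁ hs u
      refine integral_mono_ae (hi.const_mul _) ?_ ?_
      · refine (show Integrable (fun z => (z.1 ⬝ᵥ u) * (z.1 ⬝ᵥ u)) Q.law by
          simpa only [← sq] using hi).bdd_mul (c := f₂) measurable_dens_zero.aestronglyMeasurable ?_
        filter_upwards [hdens] with z hz
        rw [Real.norm_eq_abs, abs_of_nonneg (hz.1.nonneg 0)]; exact hz.1.le_zero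
      · filter_upwards [hdens] with z hz
        rw [sq]
        exact mul_le_mul_of_nonneg_right hz.2 (mul_self_nonneg _)
    rw [e1, div_mul_eq_mul_div, le_div_iff₀ hf₁]
    linarith [(hquad u).2]
  refine ⟨hdens.mono fun z hz => hz.1, errKernel_Iic_zero hτ hd, by positivity, ?_,
    fun v => (hquad v).1⟩
  intro u hu
  set σ := c₁ * Real.sqrt (lamMax / f₁) with hσ
  have hσ0 : 0 < σ := by positivity
  have hσ2 : σ ^ 2 = c₁ ^ 2 * (lamMax / f₁) := by
    rw [hσ, mul_pow, Real.sq_sqrt (by positivity)]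
  rw [← hσ2]
  refine integrable_exp_sq (measurable_fst_dotProduct u) hσ0 fun t ht => ?_
  rcases eq_or_ne u 0 with rfl | hne
  · have : {z : (Fin (Q.p + 1) → ℝ) × ℝ | σ * t ≤ |z.1 ⬝ᵥ (0 : Fin (Q.p + 1) → ℝ)|} = ∅ := by
      ext z; simpa using mul_pos hσ0 ht
    rw [this]; simp
  · obtain ⟨ρ, hρ0, hρ2, -, htail⟩ := subGaussian_tail hs u
    refine le_trans (measure_mono fun z hz => ?_) (htail t ht hne)
    have hρ : ρ ≤ Real.sqrt (lamMax / f₁) := by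
      apply Real.le_sqrt_of_sq_le
      rw [hρ2]
      refine (hSig u).trans ?_
      have : l2norm u ^ 2 ≤ 1 := by nlinarith [l2norm_nonneg u]
      have h3 : 0 ≤ lamMax / f₁ := by positivity
      nlinarith
    have : c₁ * ρ * t ≤ σ * t := by rw [hσ]; gcongr
    exact this.trans hz

end Regularity

end Population

/-! ### Moment bounds for the summands -/

/-- The growth function `(1 + |y|)³ e^{|y|}`, which dominates every power of `y` that is
needed. -/
def growth (y : ℝ) : ℝ := (1 + |y|) ^ 3 * Real.exp |y|

/-- The constant in `growth y ≤ growthConst g * exp (g y² / 6)`. -/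
def growthConst (g : ℝ) : ℝ := 6 * Real.exp (1 + 6 / g)

theorem growthConst_pos (g : ℝ) : 0 < growthConst g := by unfold growthConst; positivity

theorem growth_le {g : ℝ} (hg : 0 < g) (y : ℝ) :
    growth y ≤ growthConst g * Real.exp (g / 6 * y ^ 2) := by
  have h1 : (1 + |y|) ^ 3 ≤ 6 * Real.exp (1 + |y|) := by
    have := Real.pow_div_factorial_le_exp (1 + |y|) (by positivity) 3
    rw [div_le_iff₀ (by positivity)] at this
    norm_num [Nat.factorial] at this
    linarith
  have h2 : 2 * |y| ≤ g / 6 * y ^ 2 + 6 / g := by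
    rw [← sq_abs y]
    have : 0 ≤ g / 6 * (|y| - 6 / g) ^ 2 := by positivity
    have e : g / 6 * (|y| - 6 / g) ^ 2 = g / 6 * |y| ^ 2 - 2 * |y| + 6 / g := by
      field_simp; ring
    linarith
  calc growth y ≤ 6 * Real.exp (1 + |y|) * Real.exp |y| :=
        mul_le_mul_of_nonneg_right h1 (Real.exp_pos _).le
    _ = 6 * Real.exp (1 + 2 * |y|) := by rw [mul_assoc, ← Real.exp_add]; ring_nf
    _ ≤ 6 * Real.exp (1 + 6 / g + g / 6 * y ^ 2) := by
        have : 1 + 2 * |y| ≤ 1 + 6 / g + g / 6 * y ^ 2 := by linarith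
        gcongr
    _ = _ := by rw [growthConst, Real.exp_add (1 + 6 / g)]; ring

theorem one_le_growth (y : ℝ) : 1 ≤ growth y :=
  one_le_mul_of_one_le_of_one_le (one_le_pow₀ (by linarith [abs_nonneg y]))
    (Real.one_le_exp (abs_nonneg y))

theorem growth_pos (y : ℝ) : 0 < growth y := one_pos.trans_le (one_le_growth y)

theorem sq_mul_exp_le_growth (y : ℝ) : (1 + |y|) ^ 2 * Real.exp |y| ≤ growth y := by
  unfold growth
  gcongr
  · linarith [abs_nonneg y]
  · norm_num

theorem one_add_abs_sq_le_growth (y : ℝ) : (1 + |y|) ^ 2 ≤ growth y :=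
  le_trans (le_mul_of_one_le_right (by positivity) (Real.one_le_exp (abs_nonneg y)))
    (sq_mul_exp_le_growth y)

/-- The difference `1(u ≤ t) - 1(u ≤ 0)`. -/
def stepDiff (t u : ℝ) : ℝ := (if u ≤ t then (1 : ℝ) else 0) - if u ≤ 0 then 1 else 0

theorem abs_stepDiff_le (t u : ℝ) : |stepDiff t u| ≤ 1 := by
  unfold stepDiff; split_ifs <;> simp

theorem stepDiff_sq (t u : ℝ) : stepDiff t u ^ 2 = |stepDiff t u| := by
  unfold stepDiff; split_ifs <;> simp

theorem measurable_stepDiff : Measurable fun q : ℝ × ℝ => stepDiff q.1 q.2 :=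
  (Measurable.ite (measurableSet_le measurable_snd measurable_fst) measurable_const
    measurable_const).sub (Measurable.ite (measurableSet_le measurable_snd measurable_const)
      measurable_const measurable_const)

/-- The indicator of `|u - t| ≤ δ`. -/
def nearInd (δ t u : ℝ) : ℝ := if |u - t| ≤ δ then 1 else 0

theorem nearInd_nonneg (δ t u : ℝ) : 0 ≤ nearInd δ t u := by unfold nearInd; split_ifs <;> simp

theorem nearInd_le (δ t u : ℝ) : nearInd δ t u ≤ 1 := by unfold nearInd; split_ifs <;> simp

theorem nearInd_sq (δ t u : ℝ) : nearInd δ t u ^ 2 = nearInd δ t u := by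
  unfold nearInd; split_ifs <;> simp

theorem measurable_nearInd (δ : ℝ) : Measurable fun q : ℝ × ℝ => nearInd δ q.1 q.2 :=
  Measurable.ite (measurableSet_le (by fun_prop) measurable_const) measurable_const
    measurable_const

namespace Population

variable {τ : ℝ} (Q : Population τ)

/-- The weight that dominates the conditional means of all summands. -/
def weight (g : ℝ) (u v w : Fin (Q.p + 1) → ℝ) (z : (Fin (Q.p + 1) → ℝ) × ℝ) : ℝ :=
  growthConst g ^ 3 *
    Real.exp (g / 3 * ((z.1 ⬝ᵥ u) ^ 2 + (z.1 ⬝ᵥ v) ^ 2 + (z.1 ⬝ᵥ w) ^ 2))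

/-- A bound on the mean of `weight`. -/
def _root_.DHSQR.momentConst (g : ℝ) : ℝ := 3 * growthConst g ^ 3

theorem _root_.DHSQR.momentConst_pos (g : ℝ) : 0 < momentConst g :=
  mul_pos (by norm_num) (pow_pos (growthConst_pos g) 3)

namespace IsRegular

variable {Q} {f₂ L g lamMin : ℝ}

theorem weight_le (u v w : Fin (Q.p + 1) → ℝ) (z : (Fin (Q.p + 1) → ℝ) × ℝ) :
    Q.weight g u v w z ≤ growthConst g ^ 3 / 3 * (Real.exp (g * (z.1 ⬝ᵥ u) ^ 2)
      + Real.exp (g * (z.1 ⬝ᵥ v) ^ 2) + Real.exp (g * (z.1 ⬝ᵥ w) ^ 2)) := by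
  have key : ∀ a b c : ℝ, 0 ≤ a → 0 ≤ b → 0 ≤ c → a * b * c ≤ (a ^ 3 + b ^ 3 + c ^ 3) / 3 := by
    intro a b c ha hb hc
    nlinarith [mul_nonneg (add_nonneg (add_nonneg ha hb) hc)
      (add_nonneg (add_nonneg (sq_nonneg (a - b)) (sq_nonneg (b - c))) (sq_nonneg (a - c)))]
  have h := key (Real.exp (g / 3 * (z.1 ⬝ᵥ u) ^ 2)) (Real.exp (g / 3 * (z.1 ⬝ᵥ v) ^ 2))
    (Real.exp (g / 3 * (z.1 ⬝ᵥ w) ^ 2)) (Real.exp_pos _).le (Real.exp_pos _).le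
    (Real.exp_pos _).le
  simp only [← Real.exp_add, ← Real.exp_nat_mul] at h
  have e : ∀ y : ℝ, ((3 : ℕ) : ℝ) * (g / 3 * y) = g * y := fun y => by push_cast; ring
  rw [e, e, e] at h
  unfold weight
  rw [mul_add (g / 3), mul_add (g / 3), div_mul_eq_mul_div (growthConst g ^ 3), mul_div_assoc]
  exact mul_le_mul_of_nonneg_left h (pow_pos (growthConst_pos g) 3).le

theorem measurable_weight (u v w : Fin (Q.p + 1) → ℝ) : Measurable (Q.weight g u v w) := by
  have := measurable_fst_dotProduct u
  have := measurable_fst_dotProduct v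
  have := measurable_fst_dotProduct w
  unfold weight
  fun_prop

theorem weight_pos (u v w : Fin (Q.p + 1) → ℝ) (z : (Fin (Q.p + 1) → ℝ) × ℝ) :
    0 < Q.weight g u v w z :=
  mul_pos (pow_pos (growthConst_pos g) 3) (Real.exp_pos _)

theorem integrable_weight (H : Q.IsRegular f₂ L g lamMin) {u v w : Fin (Q.p + 1) → ℝ}
    (hu : l2norm u ≤ 1) (hv : l2norm v ≤ 1) (hw : l2norm w ≤ 1) :
    Integrable (Q.weight g u v w) Q.law :=
  ((((H.expMoment u hu).1.add (H.expMoment v hv).1).add (H.expMoment w hw).1).const_mul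
    (growthConst g ^ 3 / 3)).mono' (measurable_weight u v w).aestronglyMeasurable
    (ae_of_all _ fun z => by
      rw [Real.norm_eq_abs, abs_of_pos (weight_pos u v w z)]; exact weight_le u v w z)

theorem integral_weight_le (H : Q.IsRegular f₂ L g lamMin) {u v w : Fin (Q.p + 1) → ℝ}
    (hu : l2norm u ≤ 1) (hv : l2norm v ≤ 1) (hw : l2norm w ≤ 1) :
    ∫ z, Q.weight g u v w z ∂Q.law ≤ momentConst g := by
  obtain ⟨iu, bu⟩ := H.expMoment u hu
  obtain ⟨iv, bv⟩ := H.expMoment v hv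
  obtain ⟨iw, bw⟩ := H.expMoment w hw
  refine (integral_mono (H.integrable_weight hu hv hw) (((iu.add iv).add iw).const_mul
    (growthConst g ^ 3 / 3)) (weight_le u v w)).trans ?_
  rw [integral_const_mul]
  have e := (integral_add (iu.add iv) iw).le
  have e' := (integral_add iu iv).le
  have e'' := e.trans (add_le_add (e'.trans (add_le_add bu bv)) bw)
  calc _ ≤ growthConst g ^ 3 / 3 * (3 + 3 + 3) :=
        mul_le_mul_of_nonneg_left e'' (div_pos (pow_pos (growthConst_pos g) 3) (by norm_num)).le
    _ = momentConst g := by unfold momentConst; ring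

theorem growth_mul_le_weight (hg : 0 < g) (u v w : Fin (Q.p + 1) → ℝ)
    (z : (Fin (Q.p + 1) → ℝ) × ℝ) :
    growth (z.1 ⬝ᵥ u) * growth (z.1 ⬝ᵥ v) * growth (z.1 ⬝ᵥ w)
      * Real.exp (g / 6 * ((z.1 ⬝ᵥ u) ^ 2 + (z.1 ⬝ᵥ v) ^ 2)) ≤ Q.weight g u v w z := by
  have hu := growth_le hg (z.1 ⬝ᵥ u)
  have hv := growth_le hg (z.1 ⬝ᵥ v)
  have hw := growth_le hg (z.1 ⬝ᵥ w)
  have h1 := mul_le_mul (mul_le_mul hu hv (growth_pos _).le (by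
    have := growthConst_pos g; positivity)) hw (growth_pos _).le (by
    have := growthConst_pos g; positivity)
  have hw' : Real.exp (g / 6 * (z.1 ⬝ᵥ w) ^ 2) ≤ Real.exp (g / 3 * (z.1 ⬝ᵥ w) ^ 2) := by
    have := sq_nonneg (z.1 ⬝ᵥ w)
    gcongr; norm_num
  have hc := growthConst_pos g
  calc _ ≤ growthConst g * Real.exp (g / 6 * (z.1 ⬝ᵥ u) ^ 2)
          * (growthConst g * Real.exp (g / 6 * (z.1 ⬝ᵥ v) ^ 2))
          * (growthConst g * Real.exp (g / 6 * (z.1 ⬝ᵥ w) ^ 2))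
          * Real.exp (g / 6 * ((z.1 ⬝ᵥ u) ^ 2 + (z.1 ⬝ᵥ v) ^ 2)) :=
        mul_le_mul_of_nonneg_right h1 (Real.exp_pos _).le
    _ ≤ growthConst g * Real.exp (g / 6 * (z.1 ⬝ᵥ u) ^ 2)
          * (growthConst g * Real.exp (g / 6 * (z.1 ⬝ᵥ v) ^ 2))
          * (growthConst g * Real.exp (g / 3 * (z.1 ⬝ᵥ w) ^ 2))
          * Real.exp (g / 6 * ((z.1 ⬝ᵥ u) ^ 2 + (z.1 ⬝ᵥ v) ^ 2)) := by gcongr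
    _ = growthConst g ^ 3 * (Real.exp (g / 6 * (z.1 ⬝ᵥ u) ^ 2)
          * Real.exp (g / 6 * (z.1 ⬝ᵥ v) ^ 2) * Real.exp (g / 3 * (z.1 ⬝ᵥ w) ^ 2)
          * Real.exp (g / 6 * ((z.1 ⬝ᵥ u) ^ 2 + (z.1 ⬝ᵥ v) ^ 2))) := by ring
    _ = _ := by
        rw [weight, ← Real.exp_add, ← Real.exp_add, ← Real.exp_add]
        congr 2; ring

theorem growth_mul_growth_le_weight (hg : 0 < g) (u v w : Fin (Q.p + 1) → ℝ)
    (z : (Fin (Q.p + 1) → ℝ) × ℝ) :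
    growth (z.1 ⬝ᵥ u) * growth (z.1 ⬝ᵥ v) * growth (z.1 ⬝ᵥ w) ≤ Q.weight g u v w z := by
  refine le_trans (le_mul_of_one_le_right ?_ (Real.one_le_exp (by positivity)))
    (growth_mul_le_weight hg u v w z)
  exact (mul_pos (mul_pos (growth_pos _) (growth_pos _)) (growth_pos _)).le

/-- The mean of a function of the covariate and the error, compared with the mean of a function
of the covariate through the conditional means given the covariate. -/
theorem abs_integral_sub_le (H : Q.IsRegular f₂ L g lamMin) {u v w : Fin (Q.p + 1) → ℝ}
    (hu : l2norm u ≤ 1) (hv : l2norm v ≤ 1) (hw : l2norm w ≤ 1)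
    {φ : (Fin (Q.p + 1) → ℝ) × ℝ → ℝ} (hφ : Measurable φ)
    (hint : Integrable (fun z => φ (z.1, Q.err z)) Q.law)
    {ψ : (Fin (Q.p + 1) → ℝ) × ℝ → ℝ} (hψ : Integrable ψ Q.law) {c : ℝ} (hc : 0 ≤ c)
    (h : ∀ᵐ z ∂Q.law, |∫ y, φ (z.1, y) ∂Q.errKernel z.1 - ψ z| ≤ c * Q.weight g u v w z) :
    |∫ z, φ (z.1, Q.err z) ∂Q.law - ∫ z, ψ z ∂Q.law| ≤ c * momentConst g := by
  have hpair : Measurable fun z : (Fin (Q.p + 1) → ℝ) × ℝ => (z.1, Q.err z) :=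
    measurable_fst.prodMk Q.measurable_err
  have hcp := compProd_map_condDistrib (mβ := MeasurableSpace.pi) (μ := Q.law) (X := Prod.fst)
    (Y := Q.err) Q.measurable_err.aemeasurable
  have hmap : Integrable φ (Q.law.map fun z => (z.1, Q.err z)) := by
    rw [integrable_map_measure hφ.aestronglyMeasurable hpair.aemeasurable]; exact hint
  have hκ : Integrable (fun z => ∫ y, φ (z.1, y) ∂Q.errKernel z.1) Q.law :=
    hmap.integral_condDistrib (X := Prod.fst) (Y := Q.err)
      measurable_fst.aemeasurable Q.measurable_err.aemeasurable
  have e1 : ∫ z, φ (z.1, Q.err z) ∂Q.law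
      = ∫ z, (∫ y, φ (z.1, y) ∂Q.errKernel z.1) ∂Q.law := by
    rw [← integral_map (f := φ) hpair.aemeasurable hφ.aestronglyMeasurable]
    rw [← hcp] at hmap ⊢
    rw [Measure.integral_compProd hmap]
    refine integral_map (φ := Prod.fst) measurable_fst.aemeasurable ?_
    exact (hφ.stronglyMeasurable.integral_condDistrib (X := Prod.fst) (Y := Q.err)
      (μ := Q.law)).aestronglyMeasurable
  rw [e1, ← integral_sub hκ hψ]
  refine abs_integral_le_integral_abs.trans ?_
  refine (integral_mono_ae (hκ.sub hψ).abs ((H.integrable_weight hu hv hw).const_mul c) h).trans ?_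
  rw [integral_const_mul]
  exact mul_le_mul_of_nonneg_left (H.integral_weight_le hu hv hw) hc

/-- The one-sided version of `abs_integral_sub_le` for a nonnegative function. -/
theorem integral_le (H : Q.IsRegular f₂ L g lamMin) {u v w : Fin (Q.p + 1) → ℝ}
    (hu : l2norm u ≤ 1) (hv : l2norm v ≤ 1) (hw : l2norm w ≤ 1)
    {φ : (Fin (Q.p + 1) → ℝ) × ℝ → ℝ} (hφ : Measurable φ) (h0 : ∀ q, 0 ≤ φ q)
    (hint : Integrable (fun z => φ (z.1, Q.err z)) Q.law) {c : ℝ} (hc : 0 ≤ c)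
    (h : ∀ᵐ z ∂Q.law, ∫ y, φ (z.1, y) ∂Q.errKernel z.1 ≤ c * Q.weight g u v w z) :
    ∫ z, φ (z.1, Q.err z) ∂Q.law ≤ c * momentConst g := by
  have := H.abs_integral_sub_le hu hv hw hφ hint (integrable_const (0 : ℝ)) hc (by
    filter_upwards [h] with z hz
    rw [sub_zero, abs_of_nonneg (integral_nonneg fun y => h0 _)]; exact hz)
  rw [integral_zero, sub_zero] at this
  exact (le_abs_self _).trans this

theorem integrable_of_abs_le (H : Q.IsRegular f₂ L g lamMin) {u v w : Fin (Q.p + 1) → ℝ}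
    (hu : l2norm u ≤ 1) (hv : l2norm v ≤ 1) (hw : l2norm w ≤ 1)
    {φ : (Fin (Q.p + 1) → ℝ) × ℝ → ℝ} (hφ : Measurable φ) {c : ℝ}
    (h : ∀ᵐ z ∂Q.law, |φ z| ≤ c * Q.weight g u v w z) : Integrable φ Q.law :=
  ((H.integrable_weight hu hv hw).const_mul c).mono' hφ.aestronglyMeasurable h

theorem dens_zero_bound (H : Q.IsRegular f₂ L g lamMin) : 0 ≤ f₂ ∧ 0 ≤ L := by
  obtain ⟨z, hz⟩ := H.hasDensity.exists
  exact ⟨(hz.nonneg 0).trans hz.le_zero, hz.lip_nonneg⟩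

theorem _root_.DHSQR.l2norm_single_le {d : ℕ} (j : Fin d) : l2norm (Pi.single j (1 : ℝ)) ≤ 1 :=
  (l2norm_single j).le

theorem _root_.DHSQR.l2norm_zero_le {d : ℕ} : l2norm (0 : Fin d → ℝ) ≤ 1 := by
  simp [l2norm]

theorem _root_.DHSQR.abs_le_one_add_sq (y : ℝ) : |y| ≤ (1 + |y|) ^ 2 := by
  nlinarith [abs_nonneg y, sq_nonneg |y|]

theorem abs_mul_abs_le_weight (hg : 0 < g) (j : Fin (Q.p + 1)) (w v : Fin (Q.p + 1) → ℝ)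
    (z : (Fin (Q.p + 1) → ℝ) × ℝ) :
    |z.1 j| * |z.1 ⬝ᵥ w| ≤ Q.weight g (Pi.single j 1) w v z := by
  have h := growth_mul_growth_le_weight hg (Pi.single j 1) w v z
  rw [dotProduct_single_one] at h
  have h1 := (abs_le_one_add_sq (z.1 j)).trans (one_add_abs_sq_le_growth _)
  have h2 := (abs_le_one_add_sq (z.1 ⬝ᵥ w)).trans (one_add_abs_sq_le_growth _)
  have h3 := mul_le_mul h1 h2 (abs_nonneg _) (growth_pos _).le
  refine h3.trans (le_trans (le_mul_of_one_le_right ?_ (one_le_growth (z.1 ⬝ᵥ v))) h)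
  exact (mul_pos (growth_pos _) (growth_pos _)).le

theorem measurable_coord (j : Fin (Q.p + 1)) :
    Measurable fun z : (Fin (Q.p + 1) → ℝ) × ℝ => z.1 j :=
  (measurable_pi_apply j).comp measurable_fst

theorem integrable_dens_mul (H : Q.IsRegular f₂ L g lamMin) (j : Fin (Q.p + 1))
    {w : Fin (Q.p + 1) → ℝ} (hw : l2norm w ≤ 1) :
    Integrable (fun z => Q.dens z.1 0 * (z.1 j * (z.1 ⬝ᵥ w))) Q.law := by
  refine H.integrable_of_abs_le (c := f₂) (l2norm_single_le j) hw (l2norm_zero_le)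
    (measurable_dens_zero.mul ((measurable_coord j).mul (measurable_fst_dotProduct w))) ?_
  filter_upwards [H.hasDensity] with z hz
  rw [abs_mul, abs_mul, abs_of_nonneg (hz.nonneg 0)]
  exact mul_le_mul hz.le_zero (abs_mul_abs_le_weight H.g_pos j w 0 z) (by positivity)
    H.dens_zero_bound.1

theorem info_mulVec_apply (H : Q.IsRegular f₂ L g lamMin) (j : Fin (Q.p + 1))
    (w : Fin (Q.p + 1) → ℝ) :
    (Q.Info *ᵥ w) j = ∫ z, Q.dens z.1 0 * (z.1 j * (z.1 ⬝ᵥ w)) ∂Q.law := by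
  have h := dotProduct_moment_mulVec (Q := Q) (w := fun z => Q.dens z.1 0) (fun j k => by
    simpa using H.integrable_dens_mul j (l2norm_single_le k)) (Pi.single j 1) w
  rw [single_one_dotProduct] at h
  simp only [dotProduct_single_one] at h
  exact h

theorem abs_info_mulVec_le_of_unit (H : Q.IsRegular f₂ L g lamMin) (j : Fin (Q.p + 1))
    {w : Fin (Q.p + 1) → ℝ} (hw : l2norm w ≤ 1) :
    |(Q.Info *ᵥ w) j| ≤ f₂ * momentConst g := by
  rw [H.info_mulVec_apply]
  refine abs_integral_le_integral_abs.trans ?_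
  refine (integral_mono_ae (H.integrable_dens_mul j hw).abs
    ((H.integrable_weight (l2norm_single_le j) hw l2norm_zero_le).const_mul f₂) ?_).trans ?_
  · filter_upwards [H.hasDensity] with z hz
    rw [abs_mul, abs_mul, abs_of_nonneg (hz.nonneg 0)]
    exact mul_le_mul hz.le_zero (abs_mul_abs_le_weight H.g_pos j w 0 z) (by positivity)
      H.dens_zero_bound.1
  · rw [integral_const_mul]
    exact mul_le_mul_of_nonneg_left
      (H.integral_weight_le (l2norm_single_le j) hw l2norm_zero_le) H.dens_zero_bound.1

theorem abs_info_mulVec_le (H : Q.IsRegular f₂ L g lamMin) (j : Fin (Q.p + 1))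
    (w : Fin (Q.p + 1) → ℝ) : |(Q.Info *ᵥ w) j| ≤ f₂ * momentConst g * l2norm w := by
  rcases (l2norm_nonneg w).eq_or_lt with h0 | hpos
  · have : w = 0 := by
      ext k
      have := abs_le_l2norm w k
      rw [← h0] at this
      simpa using this
    simp [this, l2norm]
  · have h1 := H.abs_info_mulVec_le_of_unit j (w := (l2norm w)⁻¹ • w) (by
      rw [l2norm_smul, abs_of_pos (inv_pos.2 hpos), inv_mul_cancel₀ hpos.ne'])
    rw [mulVec_smul, Pi.smul_apply, smul_eq_mul, abs_mul, abs_of_pos (inv_pos.2 hpos),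
      inv_mul_le_iff₀ hpos] at h1
    linarith

end IsRegular

end Population

namespace Population

variable {τ : ℝ} (Q : Population τ)

/-! ### The four families of summands -/

/-- A coordinate of the quantile score at `β*`. -/
def scoreFn (j : Fin (Q.p + 1)) (z : (Fin (Q.p + 1) → ℝ) × ℝ) : ℝ :=
  z.1 j * ((if Q.err z ≤ 0 then 1 else 0) - τ)

/-- A coordinate of the increment of the quantile score from `β*` to `β* + v`. -/
def scoreDiff (j : Fin (Q.p + 1)) (v : Fin (Q.p + 1) → ℝ)
    (z : (Fin (Q.p + 1) → ℝ) × ℝ) : ℝ :=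
  z.1 j * stepDiff (z.1 ⬝ᵥ v) (Q.err z)

/-- The size of a coordinate of `X` where the residual at `β* + v` is at most `δ`. -/
def nearFn (δ : ℝ) (j : Fin (Q.p + 1)) (v : Fin (Q.p + 1) → ℝ)
    (z : (Fin (Q.p + 1) → ℝ) × ℝ) : ℝ :=
  |z.1 j| * nearInd δ (z.1 ⬝ᵥ v) (Q.err z)

/-- The summand of the smoothed Hessian at `β* + v`, row `j`, applied to `u`. -/
def kernFn (K : ℝ → ℝ) (b : ℝ) (j : Fin (Q.p + 1)) (u v : Fin (Q.p + 1) → ℝ)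
    (z : (Fin (Q.p + 1) → ℝ) × ℝ) : ℝ :=
  scaledKernel K b (Q.err z - z.1 ⬝ᵥ v) * (z.1 j * (z.1 ⬝ᵥ u))

theorem measurable_scoreFn (j : Fin (Q.p + 1)) : Measurable (Q.scoreFn j) :=
  (IsRegular.measurable_coord j).mul ((Measurable.ite (measurableSet_le Q.measurable_err
    measurable_const) measurable_const measurable_const).sub_const _)

theorem measurable_scoreDiff (j : Fin (Q.p + 1)) (v : Fin (Q.p + 1) → ℝ) :
    Measurable (Q.scoreDiff j v) :=
  (IsRegular.measurable_coord j).mul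
    (measurable_stepDiff.comp ((measurable_fst_dotProduct v).prodMk Q.measurable_err))

theorem measurable_nearFn (δ : ℝ) (j : Fin (Q.p + 1)) (v : Fin (Q.p + 1) → ℝ) :
    Measurable (Q.nearFn δ j v) :=
  (IsRegular.measurable_coord j).abs.mul
    ((measurable_nearInd δ).comp ((measurable_fst_dotProduct v).prodMk Q.measurable_err))

theorem measurable_kernFn {K : ℝ → ℝ} (hK : IsSmoothingKernel K) (b : ℝ) (j : Fin (Q.p + 1))
    (u v : Fin (Q.p + 1) → ℝ) : Measurable (Q.kernFn K b j u v) :=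
  ((hK.continuous_scaledKernel b).measurable.comp
    (Q.measurable_err.sub (measurable_fst_dotProduct v))).mul
    ((IsRegular.measurable_coord j).mul (measurable_fst_dotProduct u))

theorem _root_.DHSQR.sq_mul_exp_le {x y : ℝ} (h : |y| ≤ |x|) :
    y ^ 2 * Real.exp (1 * |y|) ≤ (1 + |x|) ^ 2 * Real.exp |x| := by
  rw [← sq_abs y, one_mul]
  gcongr
  linarith [abs_nonneg x]

namespace IsRegular

variable {Q} {f₂ L g lamMin : ℝ}

theorem growth_coord_le_weight (hg : 0 < g) (j : Fin (Q.p + 1)) (w : Fin (Q.p + 1) → ℝ)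
    (z : (Fin (Q.p + 1) → ℝ) × ℝ) :
    growth (z.1 j) * growth (z.1 ⬝ᵥ w) ≤ Q.weight g (Pi.single j 1) w 0 z := by
  have h := growth_mul_growth_le_weight hg (Pi.single j 1) w 0 z
  rw [dotProduct_single_one] at h
  exact le_trans (le_mul_of_one_le_right (mul_pos (growth_pos _) (growth_pos _)).le
    (one_le_growth _)) h

theorem growth_le_weight (hg : 0 < g) (j : Fin (Q.p + 1)) (w : Fin (Q.p + 1) → ℝ)
    (z : (Fin (Q.p + 1) → ℝ) × ℝ) :
    growth (z.1 j) ≤ Q.weight g (Pi.single j 1) w 0 z :=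
  le_trans (le_mul_of_one_le_right (growth_pos _).le (one_le_growth _))
    (growth_coord_le_weight hg j w z)

/-- A function with values at most `|X_j|` satisfies the moment condition of Bernstein's
inequality. -/
theorem integrable_sq_mul_exp (H : Q.IsRegular f₂ L g lamMin) (j : Fin (Q.p + 1))
    {φ : (Fin (Q.p + 1) → ℝ) × ℝ → ℝ} (hφ : Measurable φ) (h : ∀ z, |φ z| ≤ |z.1 j|) :
    Integrable (fun z => φ z ^ 2 * Real.exp (1 * |φ z|)) Q.law ∧
      ∫ z, φ z ^ 2 * Real.exp (1 * |φ z|) ∂Q.law ≤ momentConst g := by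
  have hpt : ∀ z, φ z ^ 2 * Real.exp (1 * |φ z|) ≤ Q.weight g (Pi.single j 1) 0 0 z := fun z =>
    (sq_mul_exp_le (h z)).trans ((sq_mul_exp_le_growth _).trans
      (growth_le_weight H.g_pos j 0 z))
  have hW := H.integrable_weight (l2norm_single_le j) l2norm_zero_le l2norm_zero_le
  have hint : Integrable (fun z => φ z ^ 2 * Real.exp (1 * |φ z|)) Q.law :=
    hW.mono' (by fun_prop) (ae_of_all _ fun z => by
      rw [Real.norm_eq_abs, abs_of_nonneg (by positivity)]; exact hpt z)
  exact ⟨hint, (integral_mono hint hW hpt).trans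
    (H.integral_weight_le (l2norm_single_le j) l2norm_zero_le l2norm_zero_le)⟩

theorem abs_scoreFn_le (hτ : τ ∈ Set.Ioo (0 : ℝ) 1) (j : Fin (Q.p + 1))
    (z : (Fin (Q.p + 1) → ℝ) × ℝ) : |Q.scoreFn j z| ≤ |z.1 j| := by
  rw [scoreFn, abs_mul]
  refine mul_le_of_le_one_right (abs_nonneg _) ?_
  split_ifs
  · rw [abs_of_pos (by linarith [hτ.2])]; linarith [hτ.1]
  · rw [abs_of_neg (by linarith [hτ.1])]; linarith [hτ.2]

/-- The quantile score at `β*` is centred. -/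
theorem integral_scoreFn (H : Q.IsRegular f₂ L g lamMin) (hτ : τ ∈ Set.Ioo (0 : ℝ) 1)
    (j : Fin (Q.p + 1)) : ∫ z, Q.scoreFn j z ∂Q.law = 0 := by
  have hm : Measurable fun q : (Fin (Q.p + 1) → ℝ) × ℝ =>
      q.1 j * ((if q.2 ≤ 0 then (1 : ℝ) else 0) - τ) :=
    (measurable_coord j).mul ((Measurable.ite (measurableSet_le measurable_snd
      measurable_const) measurable_const measurable_const).sub_const _)
  have hint : Integrable (fun z => Q.scoreFn j z) Q.law :=
    integrable_of_sq_mul_exp (Q.measurable_scoreFn j) zero_le_one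
      (H.integrable_sq_mul_exp j (Q.measurable_scoreFn j) (abs_scoreFn_le hτ j)).1
  have h := H.abs_integral_sub_le (l2norm_single_le j) l2norm_zero_le l2norm_zero_le hm hint
    (integrable_const (0 : ℝ)) le_rfl (by
      filter_upwards [H.level] with z hz
      have e : ∫ y, (if y ≤ 0 then (1 : ℝ) else 0) ∂Q.errKernel z.1 = τ := by
        refine Eq.trans ?_ hz
        rw [← integral_indicator_one measurableSet_Iic]
        rfl
      have hi : Integrable (fun y : ℝ => if y ≤ 0 then (1 : ℝ) else 0) (Q.errKernel z.1) :=
        (integrable_const (1 : ℝ)).indicator measurableSet_Iic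
      rw [integral_const_mul, integral_sub hi (integrable_const _), e]
      simp)
  rw [zero_mul, integral_const, smul_zero, sub_zero] at h
  exact abs_nonpos_iff.1 h

theorem abs_scoreDiff_le (j : Fin (Q.p + 1)) (v : Fin (Q.p + 1) → ℝ)
    (z : (Fin (Q.p + 1) → ℝ) × ℝ) : |Q.scoreDiff j v z| ≤ |z.1 j| := by
  rw [scoreDiff, abs_mul]
  exact mul_le_of_le_one_right (abs_nonneg _) (abs_stepDiff_le _ _)

theorem abs_smul_dotProduct {x w : Fin (Q.p + 1) → ℝ} {ρ : ℝ} (hρ : 0 ≤ ρ) :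
    |x ⬝ᵥ (ρ • w)| = ρ * |x ⬝ᵥ w| := by
  rw [dotProduct_smul, smul_eq_mul, abs_mul, abs_of_nonneg hρ]

/-- The variance of the score increment over `ρ w` is of order `ρ`. -/
theorem scoreDiff_moment (H : Q.IsRegular f₂ L g lamMin) (j : Fin (Q.p + 1))
    {w : Fin (Q.p + 1) → ℝ} (hw : l2norm w ≤ 1) {ρ : ℝ} (hρ : 0 ≤ ρ) (hρ1 : ρ ≤ 1) :
    ∫ z, Q.scoreDiff j (ρ • w) z ^ 2 * Real.exp (1 * |Q.scoreDiff j (ρ • w) z|) ∂Q.law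
      ≤ (f₂ + L) * ρ * momentConst g := by
  obtain ⟨hf, hL⟩ := H.dens_zero_bound
  set φ : (Fin (Q.p + 1) → ℝ) × ℝ → ℝ := fun q =>
    (q.1 j * stepDiff (q.1 ⬝ᵥ (ρ • w)) q.2) ^ 2
      * Real.exp (1 * |q.1 j * stepDiff (q.1 ⬝ᵥ (ρ • w)) q.2|) with hφ
  have hm1 : Measurable fun q : (Fin (Q.p + 1) → ℝ) × ℝ =>
      q.1 j * stepDiff (q.1 ⬝ᵥ (ρ • w)) q.2 :=
    (measurable_coord j).mul
      (measurable_stepDiff.comp ((measurable_fst_dotProduct _).prodMk measurable_snd))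
  have hm : Measurable φ := by rw [hφ]; fun_prop
  refine H.integral_le (φ := φ) (l2norm_single_le j) hw l2norm_zero_le hm
    (fun q => by simp only [hφ]; positivity)
    (H.integrable_sq_mul_exp j (Q.measurable_scoreDiff j _) (abs_scoreDiff_le j _)).1
    (by positivity) ?_
  filter_upwards [H.hasDensity] with z hz
  set x := z.1 with hx
  set t := x ⬝ᵥ (ρ • w) with ht
  have hpt : ∀ y, φ (x, y) ≤ (1 + |x j|) ^ 2 * Real.exp |x j| * |stepDiff t y| := by
    intro y
    have e1 : (x j * stepDiff t y) ^ 2 = x j ^ 2 * |stepDiff t y| := by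
      rw [mul_pow, stepDiff_sq]
    have e2 : |x j * stepDiff t y| ≤ |x j| := by
      rw [abs_mul]; exact mul_le_of_le_one_right (abs_nonneg _) (abs_stepDiff_le _ _)
    have e3 : x j ^ 2 ≤ (1 + |x j|) ^ 2 := by
      rw [← sq_abs]; gcongr; linarith [abs_nonneg (x j)]
    simp only [hφ]
    rw [← ht, e1, one_mul]
    calc x j ^ 2 * |stepDiff t y| * Real.exp |x j * stepDiff t y|
        ≤ (1 + |x j|) ^ 2 * |stepDiff t y| * Real.exp |x j| := by gcongr
      _ = _ := by ring
  have hi : Integrable (fun y => |stepDiff t y|) (Q.errKernel x) :=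
    (integrable_const (1 : ℝ)).mono'
      (measurable_stepDiff.comp (measurable_prodMk_left (x := t))).abs.aestronglyMeasurable
      (ae_of_all _ fun y => by
        rw [Real.norm_eq_abs, abs_abs]; exact abs_stepDiff_le t y)
  have h1 : ∫ y, φ (x, y) ∂Q.errKernel x
      ≤ (1 + |x j|) ^ 2 * Real.exp |x j| * ((f₂ + L * |t|) * |t|) := by
    refine (integral_mono_of_nonneg (ae_of_all _ fun y => by
      simp only [hφ, Pi.zero_apply]; positivity) (hi.const_mul _) (ae_of_all _ hpt)).trans ?_
    rw [integral_const_mul]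
    exact mul_le_mul_of_nonneg_left (hz.integral_abs_indicator_sub_le t) (by positivity)
  refine h1.trans ?_
  have ht' : |t| = ρ * |x ⬝ᵥ w| := abs_smul_dotProduct hρ
  have h2 : (f₂ + L * |t|) * |t| ≤ (f₂ + L) * ρ * growth (x ⬝ᵥ w) := by
    rw [ht']
    set a := |x ⬝ᵥ w| with ha
    have ha0 : 0 ≤ a := abs_nonneg _
    have h3 : f₂ + L * (ρ * a) ≤ (f₂ + L) * (1 + a) := by
      have h4 : ρ * a ≤ a := mul_le_of_le_one_left ha0 hρ1
      have h5 := mul_le_mul_of_nonneg_left h4 hL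
      have h6 := mul_nonneg hf ha0
      linarith
    have h7 : (1 + a) * a ≤ growth (x ⬝ᵥ w) := by
      refine le_trans ?_ (one_add_abs_sq_le_growth _)
      rw [← ha]; nlinarith
    calc (f₂ + L * (ρ * a)) * (ρ * a) ≤ (f₂ + L) * (1 + a) * (ρ * a) := by gcongr
      _ = (f₂ + L) * ρ * ((1 + a) * a) := by ring
      _ ≤ _ := by gcongr
  have h8 := growth_coord_le_weight H.g_pos j w z
  calc _ ≤ growth (x j) * ((f₂ + L) * ρ * growth (x ⬝ᵥ w)) := by
        refine mul_le_mul (sq_mul_exp_le_growth _) h2 ?_ (growth_pos _).le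
        positivity
    _ = (f₂ + L) * ρ * (growth (x j) * growth (x ⬝ᵥ w)) := by ring
    _ ≤ _ := by gcongr

/-- The mean of the score increment, linearized. -/
theorem scoreDiff_mean (H : Q.IsRegular f₂ L g lamMin) (j : Fin (Q.p + 1))
    {w : Fin (Q.p + 1) → ℝ} (hw : l2norm w ≤ 1) (ρ : ℝ) :
    |∫ z, Q.scoreDiff j (ρ • w) z ∂Q.law - (Q.Info *ᵥ (ρ • w)) j|
      ≤ L * ρ ^ 2 * momentConst g := by
  obtain ⟨hf, hL⟩ := H.dens_zero_bound
  have hm1 : Measurable fun q : (Fin (Q.p + 1) → ℝ) × ℝ =>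
      q.1 j * stepDiff (q.1 ⬝ᵥ (ρ • w)) q.2 :=
    (measurable_coord j).mul
      (measurable_stepDiff.comp ((measurable_fst_dotProduct _).prodMk measurable_snd))
  rw [mulVec_smul, Pi.smul_apply, smul_eq_mul, H.info_mulVec_apply, ← integral_const_mul]
  refine H.abs_integral_sub_le (φ := fun q => q.1 j * stepDiff (q.1 ⬝ᵥ (ρ • w)) q.2)
    (l2norm_single_le j) hw l2norm_zero_le hm1
    (integrable_of_sq_mul_exp (Q.measurable_scoreDiff j _) zero_le_one
      (H.integrable_sq_mul_exp j (Q.measurable_scoreDiff j _) (abs_scoreDiff_le j _)).1)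
    ((H.integrable_dens_mul j hw).const_mul ρ) (by positivity) ?_
  filter_upwards [H.hasDensity] with z hz
  set x := z.1 with hx
  have h1 := hz.abs_integral_indicator_sub_le (x ⬝ᵥ (ρ • w))
  rw [integral_const_mul]
  have e : x j * ∫ y, stepDiff (x ⬝ᵥ (ρ • w)) y ∂Q.errKernel x
      - ρ * (Q.dens x 0 * (x j * (x ⬝ᵥ w)))
      = x j * (∫ y, stepDiff (x ⬝ᵥ (ρ • w)) y ∂Q.errKernel x
        - Q.dens x 0 * (x ⬝ᵥ (ρ • w))) := by
    rw [dotProduct_smul, smul_eq_mul]; ring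
  rw [e, abs_mul]
  have h2 : (x ⬝ᵥ (ρ • w)) ^ 2 ≤ ρ ^ 2 * growth (x ⬝ᵥ w) := by
    rw [dotProduct_smul, smul_eq_mul, mul_pow]
    gcongr
    refine le_trans ?_ (one_add_abs_sq_le_growth _)
    rw [← sq_abs]; gcongr; linarith [abs_nonneg (x ⬝ᵥ w)]
  have h3 : |x j| ≤ growth (x j) := (abs_le_one_add_sq _).trans (one_add_abs_sq_le_growth _)
  calc _ ≤ growth (x j) * (L * (ρ ^ 2 * growth (x ⬝ᵥ w))) := by
        refine mul_le_mul h3 (h1.trans ?_) (abs_nonneg _) (growth_pos _).le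
        gcongr
    _ = L * ρ ^ 2 * (growth (x j) * growth (x ⬝ᵥ w)) := by ring
    _ ≤ _ := by
        have := growth_coord_le_weight H.g_pos j w z
        gcongr

theorem abs_nearFn_le (δ : ℝ) (j : Fin (Q.p + 1)) (v : Fin (Q.p + 1) → ℝ)
    (z : (Fin (Q.p + 1) → ℝ) × ℝ) : |Q.nearFn δ j v z| ≤ |z.1 j| := by
  rw [nearFn, abs_mul, abs_abs, abs_of_nonneg (nearInd_nonneg _ _ _)]
  exact mul_le_of_le_one_right (abs_nonneg _) (nearInd_le _ _ _)

/-- A function that vanishes unless the residual at `β* + ρ w` is at most `δ` has mean of order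
`δ`. -/
theorem near_bound (H : Q.IsRegular f₂ L g lamMin) (j : Fin (Q.p + 1))
    {w : Fin (Q.p + 1) → ℝ} (hw : l2norm w ≤ 1) {ρ δ : ℝ} (hρ : 0 ≤ ρ) (hρ1 : ρ ≤ 1)
    (hδ : 0 ≤ δ) (hδ1 : δ ≤ 1) {φ : (Fin (Q.p + 1) → ℝ) × ℝ → ℝ} (hφ : Measurable φ)
    (h0 : ∀ q, 0 ≤ φ q) (hint : Integrable (fun z => φ (z.1, Q.err z)) Q.law)
    (hpt : ∀ x y, φ (x, y) ≤ growth (x j) * nearInd δ (x ⬝ᵥ (ρ • w)) y) :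
    ∫ z, φ (z.1, Q.err z) ∂Q.law ≤ 2 * δ * (f₂ + L) * momentConst g := by
  obtain ⟨hf, hL⟩ := H.dens_zero_bound
  refine H.integral_le (φ := φ) (l2norm_single_le j) hw l2norm_zero_le hφ h0 hint
    (by positivity) ?_
  filter_upwards [H.hasDensity] with z hz
  set x := z.1 with hx
  set t := x ⬝ᵥ (ρ • w) with ht
  have hi : Integrable (fun y => nearInd δ t y) (Q.errKernel x) :=
    (integrable_const (1 : ℝ)).mono'
      ((measurable_nearInd δ).comp (measurable_prodMk_left (x := t))).aestronglyMeasurable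
      (ae_of_all _ fun y => by
        rw [Real.norm_eq_abs, abs_of_nonneg (nearInd_nonneg _ _ _)]; exact nearInd_le _ _ _)
  have h1 : ∫ y, φ (x, y) ∂Q.errKernel x
      ≤ growth (x j) * (2 * δ * (f₂ + L * (|t| + δ))) := by
    refine (integral_mono_of_nonneg (ae_of_all _ fun y => h0 _) (hi.const_mul _)
      (ae_of_all _ (hpt x))).trans ?_
    rw [integral_const_mul]
    exact mul_le_mul_of_nonneg_left (hz.integral_indicator_abs_sub_le t hδ) (growth_pos _).le
  refine h1.trans ?_
  have ht' : |t| = ρ * |x ⬝ᵥ w| := abs_smul_dotProduct hρ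
  have h2 : f₂ + L * (|t| + δ) ≤ (f₂ + L) * growth (x ⬝ᵥ w) := by
    have h3 := one_add_abs_sq_le_growth (x ⬝ᵥ w)
    have ha0 : 0 ≤ |x ⬝ᵥ w| := abs_nonneg _
    have h4 : |t| + δ ≤ growth (x ⬝ᵥ w) := by
      rw [ht']
      have h5 : ρ * |x ⬝ᵥ w| ≤ |x ⬝ᵥ w| := mul_le_of_le_one_left ha0 hρ1
      nlinarith
    have h6 := mul_le_mul_of_nonneg_left h4 hL
    have h7 := mul_le_mul_of_nonneg_left (one_le_growth (x ⬝ᵥ w)) hf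
    linarith
  have h8 := growth_coord_le_weight H.g_pos j w z
  have hg0 := growth_pos (x j)
  calc growth (x j) * (2 * δ * (f₂ + L * (|t| + δ)))
      ≤ growth (x j) * (2 * δ * ((f₂ + L) * growth (x ⬝ᵥ w))) := by gcongr
    _ = 2 * δ * (f₂ + L) * (growth (x j) * growth (x ⬝ᵥ w)) := by ring
    _ ≤ _ := by gcongr

/-- The second moment of `nearFn` is of order `δ`. -/
theorem nearFn_moment (H : Q.IsRegular f₂ L g lamMin) (j : Fin (Q.p + 1))
    {w : Fin (Q.p + 1) → ℝ} (hw : l2norm w ≤ 1) {ρ δ : ℝ} (hρ : 0 ≤ ρ) (hρ1 : ρ ≤ 1)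
    (hδ : 0 ≤ δ) (hδ1 : δ ≤ 1) :
    ∫ z, Q.nearFn δ j (ρ • w) z ^ 2 * Real.exp (1 * |Q.nearFn δ j (ρ • w) z|) ∂Q.law
      ≤ 2 * δ * (f₂ + L) * momentConst g := by
  have hm1 : Measurable fun q : (Fin (Q.p + 1) → ℝ) × ℝ =>
      |q.1 j| * nearInd δ (q.1 ⬝ᵥ (ρ • w)) q.2 :=
    (measurable_coord j).abs.mul
      ((measurable_nearInd δ).comp ((measurable_fst_dotProduct _).prodMk measurable_snd))
  refine H.near_bound (φ := fun q => (|q.1 j| * nearInd δ (q.1 ⬝ᵥ (ρ • w)) q.2) ^ 2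
      * Real.exp (1 * abs (|q.1 j| * nearInd δ (q.1 ⬝ᵥ (ρ • w)) q.2))) j hw hρ hρ1 hδ hδ1
    (by fun_prop) (fun q => by positivity)
    (H.integrable_sq_mul_exp j (Q.measurable_nearFn δ j _) (abs_nearFn_le δ j _)).1 ?_
  intro x y
  dsimp only
  rw [mul_pow, nearInd_sq, one_mul, abs_mul, abs_abs, abs_of_nonneg (nearInd_nonneg _ _ _)]
  have h0 := nearInd_nonneg δ (x ⬝ᵥ (ρ • w)) y
  have h1 : |x j| * nearInd δ (x ⬝ᵥ (ρ • w)) y ≤ |x j| :=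
    mul_le_of_le_one_right (abs_nonneg _) (nearInd_le _ _ _)
  calc |x j| ^ 2 * nearInd δ (x ⬝ᵥ (ρ • w)) y
        * Real.exp (|x j| * nearInd δ (x ⬝ᵥ (ρ • w)) y)
      ≤ (1 + |x j|) ^ 2 * nearInd δ (x ⬝ᵥ (ρ • w)) y * Real.exp |x j| := by
        gcongr; linarith [abs_nonneg (x j)]
    _ = ((1 + |x j|) ^ 2 * Real.exp |x j|) * nearInd δ (x ⬝ᵥ (ρ • w)) y := by ring
    _ ≤ _ := mul_le_mul_of_nonneg_right (sq_mul_exp_le_growth _) h0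

/-- The mean of `nearFn` is of order `δ`. -/
theorem nearFn_mean (H : Q.IsRegular f₂ L g lamMin) (j : Fin (Q.p + 1))
    {w : Fin (Q.p + 1) → ℝ} (hw : l2norm w ≤ 1) {ρ δ : ℝ} (hρ : 0 ≤ ρ) (hρ1 : ρ ≤ 1)
    (hδ : 0 ≤ δ) (hδ1 : δ ≤ 1) :
    ∫ z, Q.nearFn δ j (ρ • w) z ∂Q.law ≤ 2 * δ * (f₂ + L) * momentConst g := by
  have hm1 : Measurable fun q : (Fin (Q.p + 1) → ℝ) × ℝ =>
      |q.1 j| * nearInd δ (q.1 ⬝ᵥ (ρ • w)) q.2 :=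
    (measurable_coord j).abs.mul
      ((measurable_nearInd δ).comp ((measurable_fst_dotProduct _).prodMk measurable_snd))
  refine H.near_bound (φ := fun q => |q.1 j| * nearInd δ (q.1 ⬝ᵥ (ρ • w)) q.2)
    j hw hρ hρ1 hδ hδ1 hm1
    (fun q => mul_nonneg (abs_nonneg _) (nearInd_nonneg _ _ _))
    (integrable_of_sq_mul_exp (Q.measurable_nearFn δ j _) zero_le_one
      (H.integrable_sq_mul_exp j (Q.measurable_nearFn δ j _) (abs_nearFn_le δ j _)).1) ?_
  intro x y
  exact mul_le_mul_of_nonneg_right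
    ((abs_le_one_add_sq _).trans (one_add_abs_sq_le_growth _)) (nearInd_nonneg _ _ _)

section Kernel

variable {K : ℝ → ℝ} {B b : ℝ}

theorem kernFn_abs_le (hK : IsSmoothingKernel K) (hB : ∀ u, K u ≤ B) (hb : 0 < b)
    (x u : Fin (Q.p + 1) → ℝ) (j : Fin (Q.p + 1)) (y : ℝ) (hB0 : 0 < B) :
    g / (3 * B) * b * |scaledKernel K b y * (x j * (x ⬝ᵥ u))| ≤
      |g| / 6 * (x j ^ 2 + (x ⬝ᵥ u) ^ 2) := by
  rw [abs_mul, abs_mul, abs_of_nonneg (hK.scaledKernel_nonneg hb _)]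
  have h1 := IsSmoothingKernel.scaledKernel_le hB hb y
  have h2 : 2 * (|x j| * |x ⬝ᵥ u|) ≤ x j ^ 2 + (x ⬝ᵥ u) ^ 2 := by
    rw [← sq_abs (x j), ← sq_abs (x ⬝ᵥ u)]
    nlinarith [sq_nonneg (|x j| - |x ⬝ᵥ u|)]
  have h3 := hK.scaledKernel_nonneg hb y
  calc g / (3 * B) * b * (scaledKernel K b y * (|x j| * |x ⬝ᵥ u|))
      ≤ |g| / (3 * B) * b * (B / b * (|x j| * |x ⬝ᵥ u|)) := by
        gcongr; exact le_abs_self g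
    _ = |g| / 6 * (2 * (|x j| * |x ⬝ᵥ u|)) := by field_simp; ring
    _ ≤ _ := by gcongr

/-- Pointwise bound on the integrand of the moment condition for `kernFn`. -/
theorem kernFn_sq_mul_exp_le (hg : 0 < g) (hK : IsSmoothingKernel K) (hB : ∀ u, K u ≤ B)
    (hb : 0 < b) (hB0 : 0 < B) (x u : Fin (Q.p + 1) → ℝ) (j : Fin (Q.p + 1)) (y : ℝ) :
    (scaledKernel K b y * (x j * (x ⬝ᵥ u))) ^ 2
        * Real.exp (g / (3 * B) * b * |scaledKernel K b y * (x j * (x ⬝ᵥ u))|)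
      ≤ scaledKernel K b y ^ 2 * (growth (x j) * growth (x ⬝ᵥ u)
          * Real.exp (g / 6 * (x j ^ 2 + (x ⬝ᵥ u) ^ 2))) := by
  have h1 := kernFn_abs_le (g := g) hK hB hb x u j y hB0
  rw [abs_of_pos hg] at h1
  have h2 : ∀ a : ℝ, a ^ 2 ≤ growth a := fun a => by
    refine le_trans ?_ (one_add_abs_sq_le_growth _)
    rw [← sq_abs]; gcongr; linarith [abs_nonneg a]
  rw [mul_pow, mul_pow, mul_assoc]
  have h3 := h2 (x j)
  have h4 := h2 (x ⬝ᵥ u)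
  have h5 := growth_pos (x j)
  have h6 := mul_pos h5 (growth_pos (x ⬝ᵥ u))
  gcongr

/-- The second moment of the Hessian summand is of order `1 / b`; the exponent in Bernstein's
condition is of order `b`, because the summand is only bounded by `B / b` times a product of two
sub-Gaussian variables. -/
theorem kernFn_moment (H : Q.IsRegular f₂ L g lamMin) (hK : IsSmoothingKernel K)
    (hB : ∀ u, K u ≤ B) (hb : 0 < b) (hb1 : b ≤ 1) (hB0 : 0 < B) (j : Fin (Q.p + 1))
    {u w : Fin (Q.p + 1) → ℝ} (hu : l2norm u ≤ 1) (hw : l2norm w ≤ 1) {ρ : ℝ} (hρ : 0 ≤ ρ)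
    (hρ1 : ρ ≤ 1) :
    Integrable (fun z => Q.kernFn K b j u (ρ • w) z ^ 2
        * Real.exp (g / (3 * B) * b * |Q.kernFn K b j u (ρ • w) z|)) Q.law ∧
      ∫ z, Q.kernFn K b j u (ρ • w) z ^ 2
        * Real.exp (g / (3 * B) * b * |Q.kernFn K b j u (ρ • w) z|) ∂Q.law
      ≤ B / b * (f₂ + L * (1 + ∫ y, |y| * K y)) * momentConst g := by
  obtain ⟨hf, hL⟩ := H.dens_zero_bound
  have hm1 : 0 ≤ ∫ y, |y| * K y := integral_nonneg fun y => mul_nonneg (abs_nonneg _) (hK.nonneg y)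
  set φ : (Fin (Q.p + 1) → ℝ) × ℝ → ℝ := fun q =>
    (scaledKernel K b (q.2 - q.1 ⬝ᵥ (ρ • w)) * (q.1 j * (q.1 ⬝ᵥ u))) ^ 2
      * Real.exp (g / (3 * B) * b
        * |scaledKernel K b (q.2 - q.1 ⬝ᵥ (ρ • w)) * (q.1 j * (q.1 ⬝ᵥ u))|) with hφ
  have hmeas : Measurable fun q : (Fin (Q.p + 1) → ℝ) × ℝ =>
      scaledKernel K b (q.2 - q.1 ⬝ᵥ (ρ • w)) * (q.1 j * (q.1 ⬝ᵥ u)) :=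
    ((hK.continuous_scaledKernel b).measurable.comp
      (measurable_snd.sub (measurable_fst_dotProduct _))).mul
      ((measurable_coord j).mul (measurable_fst_dotProduct u))
  have hm : Measurable φ := by rw [hφ]; fun_prop
  have hφ0 : ∀ q, 0 ≤ φ q := fun q => by simp only [hφ]; positivity
  have hwt : ∀ z : (Fin (Q.p + 1) → ℝ) × ℝ, growth (z.1 j) * growth (z.1 ⬝ᵥ u)
      * Real.exp (g / 6 * (z.1 j ^ 2 + (z.1 ⬝ᵥ u) ^ 2)) * growth (z.1 ⬝ᵥ w)
      ≤ Q.weight g (Pi.single j 1) u w z := fun z => by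
    have := growth_mul_le_weight H.g_pos (Pi.single j 1) u w z
    rw [dotProduct_single_one] at this
    refine le_trans (le_of_eq ?_) this
    ring
  have hint : Integrable (fun z => φ (z.1, Q.err z)) Q.law := by
    refine H.integrable_of_abs_le (c := (B / b) ^ 2) (l2norm_single_le j) hu hw
      (hm.comp (measurable_fst.prodMk Q.measurable_err)) (ae_of_all _ fun z => ?_)
    rw [abs_of_nonneg (hφ0 _)]
    refine (kernFn_sq_mul_exp_le H.g_pos hK hB hb hB0 z.1 u j _).trans ?_
    have h1 := IsSmoothingKernel.scaledKernel_le hB hb (Q.err z - z.1 ⬝ᵥ (ρ • w))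
    have h2 := hK.scaledKernel_nonneg hb (Q.err z - z.1 ⬝ᵥ (ρ • w))
    refine mul_le_mul (pow_le_pow_left₀ h2 h1 2) ?_ ?_ (by positivity)
    · exact le_trans (le_mul_of_one_le_right (mul_pos (mul_pos (growth_pos _) (growth_pos _))
        (Real.exp_pos _)).le (one_le_growth (z.1 ⬝ᵥ w))) (hwt z)
    · exact (mul_pos (mul_pos (growth_pos _) (growth_pos _)) (Real.exp_pos _)).le
  refine ⟨hint, H.integral_le (φ := φ) (l2norm_single_le j) hu hw hm hφ0 hint (by positivity) ?_⟩
  filter_upwards [H.hasDensity] with z hz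
  set x := z.1 with hx
  set t := x ⬝ᵥ (ρ • w) with ht
  set G := growth (x j) * growth (x ⬝ᵥ u) * Real.exp (g / 6 * (x j ^ 2 + (x ⬝ᵥ u) ^ 2)) with hG
  have hG0 : 0 ≤ G := (mul_pos (mul_pos (growth_pos _) (growth_pos _)) (Real.exp_pos _)).le
  have hpt : ∀ y, φ (x, y) ≤ G * scaledKernel K b (y - t) ^ 2 := fun y => by
    rw [mul_comm G]
    exact kernFn_sq_mul_exp_le H.g_pos hK hB hb hB0 x u j (y - t)
  have hi : Integrable (fun y => scaledKernel K b (y - t) ^ 2) (Q.errKernel x) := by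
    have hc := hK.continuous_scaledKernel b
    refine (integrable_const ((B / b) ^ 2)).mono' (by fun_prop) (ae_of_all _ fun y => ?_)
    rw [Real.norm_eq_abs, abs_of_nonneg (sq_nonneg _)]
    exact pow_le_pow_left₀ (hK.scaledKernel_nonneg hb _)
      (IsSmoothingKernel.scaledKernel_le hB hb _) 2
  have h1 : ∫ y, φ (x, y) ∂Q.errKernel x
      ≤ G * (B / b * (f₂ + L * (|t| + b * ∫ y, |y| * K y))) := by
    refine (integral_mono_of_nonneg (ae_of_all _ fun y => hφ0 _) (hi.const_mul G)
      (ae_of_all _ hpt)).trans ?_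
    rw [integral_const_mul]
    exact mul_le_mul_of_nonneg_left (hK.integral_scaledKernel_sq_le hz hB hb t) hG0
  refine h1.trans ?_
  have ht' : |t| = ρ * |x ⬝ᵥ w| := abs_smul_dotProduct hρ
  set m := ∫ y, |y| * K y with hm'
  have h2 : f₂ + L * (|t| + b * m) ≤ (f₂ + L * (1 + m)) * growth (x ⬝ᵥ w) := by
    have h3 := one_add_abs_sq_le_growth (x ⬝ᵥ w)
    have ha0 : 0 ≤ |x ⬝ᵥ w| := abs_nonneg _
    have h4 : |t| ≤ growth (x ⬝ᵥ w) := by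
      rw [ht']
      have h5 : ρ * |x ⬝ᵥ w| ≤ |x ⬝ᵥ w| := mul_le_of_le_one_left ha0 hρ1
      nlinarith
    have h5 : b * m ≤ m * growth (x ⬝ᵥ w) := by
      rw [mul_comm]
      exact mul_le_mul_of_nonneg_left (hb1.trans (one_le_growth _)) hm1
    have h6 := mul_le_mul_of_nonneg_left (add_le_add h4 h5) hL
    have h7 := mul_le_mul_of_nonneg_left (one_le_growth (x ⬝ᵥ w)) hf
    linarith
  calc G * (B / b * (f₂ + L * (|t| + b * m)))
      ≤ G * (B / b * ((f₂ + L * (1 + m)) * growth (x ⬝ᵥ w))) := by gcongr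
    _ = B / b * (f₂ + L * (1 + m)) * (G * growth (x ⬝ᵥ w)) := by ring
    _ ≤ _ := by
        have := hwt z
        gcongr

/-- The mean of the Hessian summand is the entry of `I u`, up to an error of order `ρ + b`. -/
theorem kernFn_mean (H : Q.IsRegular f₂ L g lamMin) (hK : IsSmoothingKernel K)
    (hB : ∀ u, K u ≤ B) (hb : 0 < b) (hb1 : b ≤ 1) (hB0 : 0 < B) (j : Fin (Q.p + 1))
    {u w : Fin (Q.p + 1) → ℝ} (hu : l2norm u ≤ 1) (hw : l2norm w ≤ 1) {ρ : ℝ} (hρ : 0 ≤ ρ)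
    (hρ1 : ρ ≤ 1) :
    |∫ z, Q.kernFn K b j u (ρ • w) z ∂Q.law - (Q.Info *ᵥ u) j|
      ≤ L * (ρ + b * ∫ y, |y| * K y) * momentConst g := by
  obtain ⟨hf, hL⟩ := H.dens_zero_bound
  have hm1 : 0 ≤ ∫ y, |y| * K y := integral_nonneg fun y => mul_nonneg (abs_nonneg _) (hK.nonneg y)
  set m := ∫ y, |y| * K y with hm'
  have hmeas : Measurable fun q : (Fin (Q.p + 1) → ℝ) × ℝ =>
      scaledKernel K b (q.2 - q.1 ⬝ᵥ (ρ • w)) * (q.1 j * (q.1 ⬝ᵥ u)) :=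
    ((hK.continuous_scaledKernel b).measurable.comp
      (measurable_snd.sub (measurable_fst_dotProduct _))).mul
      ((measurable_coord j).mul (measurable_fst_dotProduct u))
  rw [H.info_mulVec_apply]
  have hg := H.g_pos
  refine H.abs_integral_sub_le (φ := fun q =>
      scaledKernel K b (q.2 - q.1 ⬝ᵥ (ρ • w)) * (q.1 j * (q.1 ⬝ᵥ u)))
    (l2norm_single_le j) hu hw hmeas
    (integrable_of_sq_mul_exp (Q.measurable_kernFn hK b j u _) (by positivity)
      (H.kernFn_moment hK hB hb hb1 hB0 j hu hw hρ hρ1).1)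
    (H.integrable_dens_mul j hu) (by positivity) ?_
  filter_upwards [H.hasDensity] with z hz
  set x := z.1 with hx
  have h1 := hK.abs_integral_scaledKernel_sub_le hz hb (x ⬝ᵥ (ρ • w))
  rw [integral_mul_const, ← sub_mul, abs_mul]
  rw [abs_smul_dotProduct hρ, ← hm'] at h1
  have h2 : ρ * |x ⬝ᵥ w| + b * m ≤ (ρ + b * m) * growth (x ⬝ᵥ w) := by
    have h3 : |x ⬝ᵥ w| ≤ growth (x ⬝ᵥ w) :=
      (abs_le_one_add_sq _).trans (one_add_abs_sq_le_growth _)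
    have h4 := mul_le_mul_of_nonneg_left h3 hρ
    have h5 := mul_le_mul_of_nonneg_left (one_le_growth (x ⬝ᵥ w)) (mul_nonneg hb.le hm1)
    linarith
  have h6 : |x j * (x ⬝ᵥ u)| ≤ growth (x j) * growth (x ⬝ᵥ u) := by
    rw [abs_mul]
    exact mul_le_mul ((abs_le_one_add_sq _).trans (one_add_abs_sq_le_growth _))
      ((abs_le_one_add_sq _).trans (one_add_abs_sq_le_growth _)) (abs_nonneg _) (growth_pos _).le
  have h7 := growth_mul_growth_le_weight H.g_pos (Pi.single j 1) u w z
  rw [dotProduct_single_one] at h7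
  calc _ ≤ L * ((ρ + b * m) * growth (x ⬝ᵥ w)) * (growth (x j) * growth (x ⬝ᵥ u)) := by
        refine mul_le_mul (h1.trans (mul_le_mul_of_nonneg_left h2 hL)) h6 (abs_nonneg _) ?_
        have := growth_pos (x ⬝ᵥ w)
        positivity
    _ = L * (ρ + b * m) * (growth (x j) * growth (x ⬝ᵥ u) * growth (x ⬝ᵥ w)) := by ring
    _ ≤ _ := by gcongr

end Kernel

end IsRegular

end Population

/-! ### The event on which all averages are close to their means -/

theorem measureReal_biUnion_le_card_mul {Ω ι : Type*} [MeasurableSpace Ω] (P : Measure Ω)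
    [IsFiniteMeasure P] (s : Finset ι) (A : ι → Set Ω) {x : ℝ} (h : ∀ i ∈ s, P.real (A i) ≤ x) :
    P.real (⋃ i ∈ s, A i) ≤ s.card * x := by
  refine (measureReal_biUnion_finset_le s A).trans ((Finset.sum_le_card_nsmul s _ x h).trans ?_)
  rw [nsmul_eq_mul]

namespace Experiment

variable {τ : ℝ} (E : Experiment.{u} τ)

/-- The sample, indexed by the pairs of a machine and an observation. -/
def obs (q : Fin E.m × Fin E.n) (ω : E.Ω) : (Fin (E.p + 1) → ℝ) × ℝ :=
  (E.X q.1 q.2 ω, E.Y q.1 q.2 ω)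

theorem isIIDSample_obs : IsIIDSample E.P E.obs E.law where
  measurable q := (E.measurable_X q.1 q.2).prodMk (E.measurable_Y q.1 q.2)
  law q := E.law_eq q.1 q.2
  indep := E.indep

/-- The observations on the central machine. -/
def centralObs : Finset (Fin E.m × Fin E.n) := {E.central} ×ˢ Finset.univ

theorem card_centralObs : E.centralObs.card = E.n := by simp [centralObs]

theorem card_univ_obs : (Finset.univ : Finset (Fin E.m × Fin E.n)).card = E.N := by
  simp [Experiment.N]

/-- The sample point `ω` is good: the covariates are bounded by `N`, and the averages of all
summands with parameters in the grid `G`, scaled by `ρ`, are within `t₁`, `t₂` and `t₃` of their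
means. -/
structure IsGood (K : ℝ → ℝ) (G : Finset (Fin (E.p + 1) → ℝ)) (b ρ δ t₁ t₂ t₃ : ℝ)
    (ω : E.Ω) : Prop where
  bounded : ∀ q j, |(E.obs q ω).1 j| ≤ E.N
  score : ∀ j, |sampleMean Finset.univ E.obs (E.scoreFn j) ω
    - ∫ z, E.scoreFn j z ∂E.law| ≤ t₁
  diff : ∀ j, ∀ w ∈ G, |sampleMean Finset.univ E.obs (E.scoreDiff j (ρ • w)) ω
    - ∫ z, E.scoreDiff j (ρ • w) z ∂E.law| ≤ t₂
  near : ∀ j, ∀ w ∈ G, |sampleMean Finset.univ E.obs (E.nearFn δ j (ρ • w)) ω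
    - ∫ z, E.nearFn δ j (ρ • w) z ∂E.law| ≤ t₂
  kern : ∀ j, ∀ u ∈ G, ∀ w ∈ G,
    |sampleMean E.centralObs E.obs (E.kernFn K b j u (ρ • w)) ω
      - ∫ z, E.kernFn K b j u (ρ • w) z ∂E.law| ≤ t₃

variable {E} {f₂ L g lamMin : ℝ}

theorem measure_coord_gt_le (H : E.IsRegular f₂ L g lamMin) (q : Fin E.m × Fin E.n)
    (j : Fin (E.p + 1)) :
    E.P.real {ω | (E.N : ℝ) < |(E.obs q ω).1 j|} ≤ 3 * Real.exp (-(g * (E.N : ℝ) ^ 2)) := by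
  obtain ⟨hint, hle⟩ := H.expMoment (Pi.single j 1) (l2norm_single_le j)
  simp only [dotProduct_single_one] at hint hle
  have h1 := mul_meas_ge_le_integral_of_nonneg (ae_of_all _ fun z => (Real.exp_pos _).le) hint
    (Real.exp (g * (E.N : ℝ) ^ 2))
  have hmeas : MeasurableSet {z : (Fin (E.p + 1) → ℝ) × ℝ | (E.N : ℝ) < |z.1 j|} :=
    measurableSet_lt measurable_const (Population.IsRegular.measurable_coord j).abs
  have h2 : E.P.real {ω | (E.N : ℝ) < |(E.obs q ω).1 j|}
      = E.law.real {z : (Fin (E.p + 1) → ℝ) × ℝ | (E.N : ℝ) < |z.1 j|} := by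
    rw [← E.isIIDSample_obs.law q, map_measureReal_apply (E.isIIDSample_obs.measurable q) hmeas]
    rfl
  have h3 : E.law.real {z : (Fin (E.p + 1) → ℝ) × ℝ | (E.N : ℝ) < |z.1 j|}
      ≤ E.law.real {z | Real.exp (g * (E.N : ℝ) ^ 2) ≤ Real.exp (g * z.1 j ^ 2)} := by
    refine measureReal_mono fun z hz => ?_
    have hz' : (E.N : ℝ) < |z.1 j| := hz
    simp only [Set.mem_ofPred_eq, Real.exp_le_exp]
    refine mul_le_mul_of_nonneg_left ?_ H.g_pos.le
    rw [← sq_abs (z.1 j)]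
    exact pow_le_pow_left₀ (Nat.cast_nonneg _) hz'.le 2
  rw [h2, Real.exp_neg, ← div_eq_mul_inv, le_div_iff₀ (Real.exp_pos _), mul_comm]
  exact (mul_le_mul_of_nonneg_left h3 (Real.exp_pos _).le).trans (h1.trans hle)

/-- The probability that a sample point is not good, by Bernstein's inequality and a union bound
over the coordinates and the grid. The number `y` bounds the exponentials that do not involve the
grid, the number `x` those that do. -/
theorem measure_not_isGood_le (H : E.IsRegular f₂ L g lamMin)
    (hτ : τ ∈ Set.Ioo (0 : ℝ) 1) {K : ℝ → ℝ} (hK : IsSmoothingKernel K) {B : ℝ} (hB0 : 0 < B)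
    (hB : ∀ u, K u ≤ B) {G : Finset (Fin (E.p + 1) → ℝ)} (hG : ∀ w ∈ G, l2norm w ≤ 1)
    {b ρ δ t₁ t₂ t₃ : ℝ} (hb : 0 < b) (hb1 : b ≤ 1) (hρ : 0 < ρ) (hρ1 : ρ ≤ 1) (hδ : 0 ≤ δ)
    (hδ1 : δ ≤ 1) (ht₁ : 0 ≤ t₁) (ht₂ : 0 ≤ t₂) (ht₃ : 0 ≤ t₃) {V₂ V₃ V₄ x y Γ : ℝ}
    (hV₂ : 0 < V₂) (hV₃ : 0 < V₃) (hV₄ : 0 < V₄)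
    (hV₂' : (f₂ + L) * ρ * momentConst g ≤ V₂)
    (hV₃' : 2 * δ * (f₂ + L) * momentConst g ≤ V₃)
    (hV₄' : B / b * (f₂ + L * (1 + ∫ y, |y| * K y)) * momentConst g ≤ V₄)
    (h₁ : t₁ ≤ 2 * momentConst g * 1) (h₂ : t₂ ≤ 2 * V₂ * 1) (h₃ : t₂ ≤ 2 * V₃ * 1)
    (h₄ : t₃ ≤ 2 * V₄ * (g / (3 * B) * b))
    (hy₀ : Real.exp (-(g * (E.N : ℝ) ^ 2)) ≤ y)
    (hy₁ : Real.exp (-(E.N * t₁ ^ 2 / (4 * momentConst g))) ≤ y)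
    (hx₂ : Real.exp (-(E.N * t₂ ^ 2 / (4 * V₂))) ≤ x)
    (hx₃ : Real.exp (-(E.N * t₂ ^ 2 / (4 * V₃))) ≤ x)
    (hx₄ : Real.exp (-(E.n * t₃ ^ 2 / (4 * V₄))) ≤ x)
    (hΓ : (G.card : ℝ) ≤ Γ) (hΓ1 : 1 ≤ Γ) (hN : 1 ≤ E.N) :
    E.P.real {ω | ¬ E.IsGood K G b ρ δ t₁ t₂ t₃ ω}
      ≤ 5 * (E.N * (E.p + 1) * y) + 6 * ((E.p + 1) * Γ ^ 2 * x) := by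
  have hiid := E.isIIDSample_obs
  have hmc := momentConst_pos g
  set A₀ := ⋃ i ∈ (Finset.univ : Finset ((Fin E.m × Fin E.n) × Fin (E.p + 1))),
    {ω | (E.N : ℝ) < |(E.obs i.1 ω).1 i.2|} with hA₀
  set A₁ := ⋃ j ∈ (Finset.univ : Finset (Fin (E.p + 1))),
    {ω | t₁ < |sampleMean Finset.univ E.obs (E.scoreFn j) ω - ∫ z, E.scoreFn j z ∂E.law|} with hA₁
  set A₂ := ⋃ i ∈ (Finset.univ : Finset (Fin (E.p + 1))) ×ˢ G,
    {ω | t₂ < |sampleMean Finset.univ E.obs (E.scoreDiff i.1 (ρ • i.2)) ω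
      - ∫ z, E.scoreDiff i.1 (ρ • i.2) z ∂E.law|} with hA₂
  set A₃ := ⋃ i ∈ (Finset.univ : Finset (Fin (E.p + 1))) ×ˢ G,
    {ω | t₂ < |sampleMean Finset.univ E.obs (E.nearFn δ i.1 (ρ • i.2)) ω
      - ∫ z, E.nearFn δ i.1 (ρ • i.2) z ∂E.law|} with hA₃
  set A₄ := ⋃ i ∈ (Finset.univ : Finset (Fin (E.p + 1))) ×ˢ (G ×ˢ G),
    {ω | t₃ < |sampleMean E.centralObs E.obs (E.kernFn K b i.1 i.2.1 (ρ • i.2.2)) ω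
      - ∫ z, E.kernFn K b i.1 i.2.1 (ρ • i.2.2) z ∂E.law|} with hA₄
  have hsub : {ω | ¬ E.IsGood K G b ρ δ t₁ t₂ t₃ ω} ⊆ A₀ ∪ (A₁ ∪ (A₂ ∪ (A₃ ∪ A₄))) := by
    intro ω hω
    by_contra hn
    simp only [Set.mem_union, not_or] at hn
    obtain ⟨n0, n1, n2, n3, n4⟩ := hn
    simp only [hA₀, hA₁, hA₂, hA₃, hA₄, Set.mem_iUnion, Set.mem_ofPred_eq, not_exists, not_lt,
      Finset.mem_univ, Finset.mem_product, true_and, forall_true_left] at n0 n1 n2 n3 n4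
    exact hω ⟨fun q j => n0 (q, j), n1, fun j w hw => n2 (j, w) hw,
      fun j w hw => n3 (j, w) hw, fun j u hu w hw => n4 (j, u, w) ⟨hu, hw⟩⟩
  have p0 : E.P.real A₀ ≤ (E.N * (E.p + 1)) * (3 * y) := by
    refine (measureReal_biUnion_le_card_mul E.P _ _ (x := 3 * y) fun i _ =>
      (measure_coord_gt_le H i.1 i.2).trans (by linarith)).trans (le_of_eq ?_)
    simp [Experiment.N]
  have p1 : E.P.real A₁ ≤ (E.p + 1) * (2 * y) := by
    refine (measureReal_biUnion_le_card_mul E.P _ _ (x := 2 * y) fun j _ => ?_).trans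
      (le_of_eq (by simp))
    have hm := H.integrable_sq_mul_exp j (E.measurable_scoreFn j)
      (Population.IsRegular.abs_scoreFn_le hτ j)
    refine (bernstein hiid _ (E.measurable_scoreFn j) hm.1 hm.2 hmc ht₁ h₁).trans ?_
    rw [card_univ_obs]; linarith
  have p2 : E.P.real A₂ ≤ ((E.p + 1) * Γ) * (2 * x) := by
    have hx0 : 0 ≤ 2 * x := by linarith [(Real.exp_pos _).le.trans hx₂]
    refine (measureReal_biUnion_le_card_mul E.P _ _ (x := 2 * x) fun i hi => ?_).trans ?_
    · have hw := hG _ (Finset.mem_product.1 hi).2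
      have hm := H.integrable_sq_mul_exp i.1 (E.measurable_scoreDiff i.1 (ρ • i.2))
        (Population.IsRegular.abs_scoreDiff_le i.1 _)
      refine (bernstein hiid _ (E.measurable_scoreDiff i.1 _) hm.1
        ((H.scoreDiff_moment i.1 hw hρ.le hρ1).trans hV₂') hV₂ ht₂ h₂).trans ?_
      rw [card_univ_obs]; linarith
    · rw [Finset.card_product]; push_cast
      rw [Finset.card_univ, Fintype.card_fin]; push_cast
      gcongr
  have p3 : E.P.real A₃ ≤ ((E.p + 1) * Γ) * (2 * x) := by
    have hx0 : 0 ≤ 2 * x := by linarith [(Real.exp_pos _).le.trans hx₂]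
    refine (measureReal_biUnion_le_card_mul E.P _ _ (x := 2 * x) fun i hi => ?_).trans ?_
    · have hw := hG _ (Finset.mem_product.1 hi).2
      have hm := H.integrable_sq_mul_exp i.1 (E.measurable_nearFn δ i.1 (ρ • i.2))
        (Population.IsRegular.abs_nearFn_le δ i.1 _)
      refine (bernstein hiid _ (E.measurable_nearFn δ i.1 _) hm.1
        ((H.nearFn_moment i.1 hw hρ.le hρ1 hδ hδ1).trans hV₃') hV₃ ht₂ h₃).trans ?_
      rw [card_univ_obs]; linarith
    · rw [Finset.card_product]; push_cast
      rw [Finset.card_univ, Fintype.card_fin]; push_cast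
      gcongr
  have p4 : E.P.real A₄ ≤ ((E.p + 1) * (Γ * Γ)) * (2 * x) := by
    have hx0 : 0 ≤ 2 * x := by linarith [(Real.exp_pos _).le.trans hx₂]
    refine (measureReal_biUnion_le_card_mul E.P _ _ (x := 2 * x) fun i hi => ?_).trans ?_
    · have hi' := Finset.mem_product.1 (Finset.mem_product.1 hi).2
      have hm := H.kernFn_moment hK hB hb hb1 hB0 i.1 (hG _ hi'.1) (hG _ hi'.2) hρ.le hρ1
      refine (bernstein hiid _ (E.measurable_kernFn hK b i.1 _ _) hm.1 (hm.2.trans hV₄') hV₄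
        ht₃ h₄).trans ?_
      rw [card_centralObs]; linarith
    · rw [Finset.card_product, Finset.card_product]; push_cast
      rw [Finset.card_univ, Fintype.card_fin]; push_cast
      gcongr
  have hx0 : 0 ≤ x := (Real.exp_pos _).le.trans hx₂
  have hy0 : 0 ≤ y := (Real.exp_pos _).le.trans hy₀
  have hN' : (1 : ℝ) ≤ E.N := by exact_mod_cast hN
  have hle : E.P.real {ω | ¬ E.IsGood K G b ρ δ t₁ t₂ t₃ ω}
      ≤ E.P.real A₀ + (E.P.real A₁ + (E.P.real A₂ + (E.P.real A₃ + E.P.real A₄))) := by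
    refine (measureReal_mono hsub).trans ((measureReal_union_le _ _).trans ?_)
    gcongr
    refine (measureReal_union_le _ _).trans ?_
    gcongr
    refine (measureReal_union_le _ _).trans ?_
    gcongr
    exact measureReal_union_le _ _
  have hΓ3 : Γ ≤ Γ ^ 2 := by nlinarith
  have a1 : (E.p + 1) * y ≤ E.N * ((E.p + 1) * y) :=
    le_mul_of_one_le_left (by positivity) hN'
  have a2 : (E.p + 1) * x * Γ ≤ (E.p + 1) * x * Γ ^ 2 := by gcongr
  have e4 : ((E.p + 1 : ℝ) * (Γ * Γ)) * (2 * x) = 2 * ((E.p + 1) * x * Γ ^ 2) := by ring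
  rw [e4] at p4
  linarith

end Experiment

namespace Experiment

variable {τ : ℝ} (E : Experiment.{u} τ) {K : ℝ → ℝ}

/-! ### The penalized shifted loss as a lasso -/

theorem Dlocal_mulVec (hK : IsSmoothingKernel K) (β₀ : Fin (E.p + 1) → ℝ) {h : ℝ} (hh : 0 ≤ h)
    (k : Fin E.m) (ω : E.Ω) (u : Fin (E.p + 1) → ℝ) (j : Fin (E.p + 1)) :
    (E.Dlocal K β₀ h k ω *ᵥ u) j = 1 / (E.n : ℝ) * ∑ i,
      scaledKernel K h (E.resid β₀ k i ω) * (E.X k i ω j * (E.X k i ω ⬝ᵥ u)) := by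
  rw [Dlocal, smul_mulVec, Pi.smul_apply, smul_eq_mul, sum_mulVec, Finset.sum_apply]
  congr 1
  refine Finset.sum_congr rfl fun i _ => ?_
  have hs : 0 ≤ scaledKernel K h (E.resid β₀ k i ω) := div_nonneg (hK.nonneg _) hh
  rw [vecMulVec_mulVec]
  simp only [Pi.smul_apply, MulOpposite.smul_eq_mul_unop, MulOpposite.unop_op, pseudoX,
    smul_dotProduct, smul_eq_mul]
  have := Real.mul_self_sqrt hs
  linear_combination (E.X k i ω j * (E.X k i ω ⬝ᵥ u)) * this

theorem resid_eq (β₀ : Fin (E.p + 1) → ℝ) (k : Fin E.m) (i : Fin E.n) (ω : E.Ω) :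
    E.resid β₀ k i ω
      = E.err (E.obs (k, i) ω) - (E.obs (k, i) ω).1 ⬝ᵥ (β₀ - E.betaStar) := by
  simp only [resid, Population.err, obs, dotProduct_sub]
  ring

theorem sum_centralObs (φ : Fin E.m × Fin E.n → ℝ) :
    ∑ q ∈ E.centralObs, φ q = ∑ i, φ (E.central, i) := by
  rw [centralObs, Finset.sum_product, Finset.sum_singleton]

theorem Dlocal_central_mulVec (hK : IsSmoothingKernel K) (β₀ : Fin (E.p + 1) → ℝ) {b : ℝ}
    (hb : 0 ≤ b) (ω : E.Ω) (u : Fin (E.p + 1) → ℝ) (j : Fin (E.p + 1)) :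
    (E.Dlocal K β₀ b E.central ω *ᵥ u) j
      = sampleMean E.centralObs E.obs (E.kernFn K b j u (β₀ - E.betaStar)) ω := by
  rw [Dlocal_mulVec E hK β₀ hb, sampleMean, sum_centralObs, card_centralObs]
  congr 1
  refine Finset.sum_congr rfl fun i _ => ?_
  rw [resid_eq]
  rfl

theorem Dlocal_transpose (β₀ : Fin (E.p + 1) → ℝ) (h : ℝ) (k : Fin E.m) (ω : E.Ω) :
    (E.Dlocal K β₀ h k ω)ᵀ = E.Dlocal K β₀ h k ω := by
  simp only [Dlocal, transpose_smul, transpose_sum, transpose_vecMulVec]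

theorem dotProduct_Dlocal_mulVec (β₀ : Fin (E.p + 1) → ℝ) (h : ℝ) (k : Fin E.m) (ω : E.Ω)
    (u : Fin (E.p + 1) → ℝ) :
    u ⬝ᵥ E.Dlocal K β₀ h k ω *ᵥ u
      = 1 / (E.n : ℝ) * ∑ i, (E.pseudoX K β₀ h k i ω ⬝ᵥ u) ^ 2 := by
  rw [Dlocal, smul_mulVec, dotProduct_smul, smul_eq_mul, sum_mulVec, dotProduct_sum]
  congr 1
  refine Finset.sum_congr rfl fun i _ => ?_
  rw [vecMulVec_mulVec, dotProduct_comm, sq]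
  simp [smul_dotProduct]

/-- The linear coefficient of the shifted loss. -/
def linCoef (K : ℝ → ℝ) (β₀ : Fin (E.p + 1) → ℝ) (h b : ℝ) (ω : E.Ω) : Fin (E.p + 1) → ℝ :=
  E.zN K β₀ h ω + (E.Dlocal K β₀ b E.central ω - E.Dglobal K β₀ h ω) *ᵥ β₀

/-- The penalized shifted loss is the lasso loss of the local Hessian. -/
theorem shiftedLoss_add_eq_lassoLoss (β₀ : Fin (E.p + 1) → ℝ) (h b lam : ℝ) (ω : E.Ω)
    (β : Fin (E.p + 1) → ℝ) :
    E.shiftedLoss K β₀ h b ω β + lam * l1norm β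
      = lassoLoss (E.Dlocal K β₀ b E.central ω) (E.linCoef K β₀ h b ω) lam β := by
  rw [shiftedLoss, lassoLoss, dotProduct_Dlocal_mulVec, linCoef]
  congr 2
  rw [← mul_assoc]
  congr 1
  rw [one_div_mul_one_div]

/-- The global matrix drops out of the linear coefficient: what remains is the gradient of the
quantile loss at the initial estimator. -/
theorem zN_sub_Dglobal_mulVec (β₀ : Fin (E.p + 1) → ℝ) (h : ℝ) (ω : E.Ω) (j : Fin (E.p + 1)) :
    (E.zN K β₀ h ω - E.Dglobal K β₀ h ω *ᵥ β₀) j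
      = -(sampleMean Finset.univ E.obs (E.scoreFn j) ω
        + sampleMean Finset.univ E.obs (E.scoreDiff j (β₀ - E.betaStar)) ω) := by
  have hD : (E.Dglobal K β₀ h ω *ᵥ β₀) j = 1 / (E.N : ℝ) * ∑ k, ∑ i,
      (E.pseudoX K β₀ h k i ω ⬝ᵥ β₀) * E.pseudoX K β₀ h k i ω j := by
    rw [Dglobal, smul_mulVec, Pi.smul_apply, smul_eq_mul, sum_mulVec, Finset.sum_apply,
      Experiment.N, Nat.cast_mul, ← one_div_mul_one_div, mul_assoc]
    congr 1
    rw [Finset.mul_sum]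
    refine Finset.sum_congr rfl fun k _ => ?_
    rw [Dlocal, smul_mulVec, Pi.smul_apply, smul_eq_mul, sum_mulVec, Finset.sum_apply]
    congr 1
    refine Finset.sum_congr rfl fun i _ => ?_
    rw [vecMulVec_mulVec]
    simp [mul_comm]
  rw [Pi.sub_apply, hD, zN, Pi.smul_apply, smul_eq_mul, ← mul_sub, sampleMean, sampleMean,
    ← mul_add, card_univ_obs, ← Finset.sum_add_distrib, Fintype.sum_prod_type, ← mul_neg]
  congr 1
  rw [Finset.sum_apply, ← Finset.sum_sub_distrib, ← Finset.sum_neg_distrib]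
  refine Finset.sum_congr rfl fun k _ => ?_
  rw [Finset.sum_apply, ← Finset.sum_sub_distrib, ← Finset.sum_neg_distrib]
  refine Finset.sum_congr rfl fun i _ => ?_
  have hind : E.indic β₀ k i ω = if E.err (E.obs (k, i) ω)
      ≤ (E.obs (k, i) ω).1 ⬝ᵥ (β₀ - E.betaStar) then 1 else 0 := by
    rw [indic, resid_eq]
    simp only [sub_nonpos]
  simp only [pseudoXY, Pi.sub_apply, Pi.smul_apply, smul_eq_mul]
  rw [hind, Population.scoreFn, Population.scoreDiff, stepDiff]
  simp only [obs]
  ring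

/-- The gradient at `β*` splits into the score, its increment between `β*` and the initial
estimator, and the local linearization of this increment. -/
theorem gradient_apply (hK : IsSmoothingKernel K) (β₀ : Fin (E.p + 1) → ℝ) (h : ℝ) {b : ℝ}
    (hb : 0 ≤ b) (ω : E.Ω) (j : Fin (E.p + 1)) :
    (E.Dlocal K β₀ b E.central ω *ᵥ E.betaStar - E.linCoef K β₀ h b ω) j
      = sampleMean Finset.univ E.obs (E.scoreFn j) ω
        + sampleMean Finset.univ E.obs (E.scoreDiff j (β₀ - E.betaStar)) ω
        - sampleMean E.centralObs E.obs
            (E.kernFn K b j (β₀ - E.betaStar) (β₀ - E.betaStar)) ω := by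
  rw [← Dlocal_central_mulVec E hK β₀ hb, mulVec_sub]
  have h1 := E.zN_sub_Dglobal_mulVec (K := K) β₀ h ω j
  simp only [linCoef, sub_mulVec, Pi.sub_apply, Pi.add_apply] at h1 ⊢
  linarith

/-! ### Discretization of the averages -/

variable {E} {f₂ L g lamMin : ℝ}

theorem abs_dotProduct_le_card_mul {ι : Type*} [Fintype ι] {A : Finset ι} {x y : ι → ℝ}
    {a c : ℝ} (ha : 0 ≤ a) (hx : ∀ j, |x j| ≤ a) (hy : ∀ j, j ∉ A → y j = 0)
    (hyc : ∀ j, |y j| ≤ c) : |x ⬝ᵥ y| ≤ A.card * (a * c) := by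
  rw [dotProduct, ← Finset.sum_subset (Finset.subset_univ A)
    fun j _ hj => by rw [hy j hj, mul_zero]]
  refine (Finset.abs_sum_le_sum_abs _ _).trans ((Finset.sum_le_card_nsmul _ _ (a * c)
    fun j _ => ?_).trans_eq (nsmul_eq_mul _ _))
  rw [abs_mul]
  exact mul_le_mul (hx j) (hyc j) (abs_nonneg _) ha

/-- Moving the threshold by `δ` changes the step only for arguments within `δ` of the threshold. -/
theorem abs_stepDiff_sub_le {t t' δ : ℝ} (h : |t - t'| ≤ δ) (y : ℝ) :
    |stepDiff t y - stepDiff t' y| ≤ nearInd δ t' y := by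
  have h1 := abs_le.1 h
  unfold stepDiff nearInd
  rw [sub_sub_sub_cancel_right]
  by_cases a : y ≤ t <;> by_cases a' : y ≤ t'
  · simp only [a, a', if_true, sub_self, abs_zero]; split_ifs <;> norm_num
  · have : |y - t'| ≤ δ := by rw [abs_le]; push Not at a'; constructor <;> linarith
    simp [a, a', this]
  · have : |y - t'| ≤ δ := by rw [abs_le]; push Not at a; constructor <;> linarith
    simp [a, a', this]
  · simp only [a, a', if_false, sub_self, abs_zero]; split_ifs <;> norm_num

end Experiment

/-- `G` is a grid of mesh `x` for the vectors of the unit ball with support in `A`. -/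
structure IsGrid {ι : Type*} [Fintype ι] (G : Finset (ι → ℝ)) (A : Finset ι) (x : ℝ) :
    Prop where
  supp : ∀ w ∈ G, ∀ j, j ∉ A → w j = 0
  norm_le : ∀ w ∈ G, l2norm w ≤ 1
  approx : ∀ v : ι → ℝ, (∀ j, j ∉ A → v j = 0) → l2norm v ≤ 1 → ∃ w ∈ G, ∀ j, |v j - w j| ≤ x

/-- A vector of norm at most `ρ` is approximated by `ρ` times a grid point. -/
theorem IsGrid.approx_smul {ι : Type*} [Fintype ι] {G : Finset (ι → ℝ)} {A : Finset ι} {x : ℝ}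
    (hG : IsGrid G A x) {ρ : ℝ} (hρ : 0 < ρ) (hρ1 : ρ ≤ 1) {v : ι → ℝ}
    (hv : ∀ j, j ∉ A → v j = 0) (hvn : l2norm v ≤ ρ) :
    ∃ w ∈ G, ∀ j, |(v - ρ • w) j| ≤ x := by
  obtain ⟨w, hw, hwx⟩ := hG.approx (ρ⁻¹ • v) (fun j hj => by simp [hv j hj]) (by
    rw [l2norm_smul, abs_of_pos (inv_pos.2 hρ), inv_mul_le_iff₀ hρ, mul_one]; exact hvn)
  refine ⟨w, hw, fun j => ?_⟩
  have e : (v - ρ • w) j = ρ * ((ρ⁻¹ • v) j - w j) := by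
    simp only [Pi.sub_apply, Pi.smul_apply, smul_eq_mul]
    field_simp
  rw [e, abs_mul, abs_of_pos hρ]
  exact (mul_le_of_le_one_left (abs_nonneg _) hρ1).trans (hwx j)

namespace Experiment

variable {τ : ℝ} {E : Experiment.{u} τ} {K : ℝ → ℝ} {f₂ L g lamMin : ℝ}

theorem abs_kernel_mul_sub_le (hK : IsSmoothingKernel K) {B b : ℝ}
    (hB : ∀ u, K u ≤ B)
    (hBL : ∀ u v, |K u - K v| ≤ B * |u - v|) (hb : 0 < b) (e t t' a c c' : ℝ) :
    |scaledKernel K b (e - t) * (a * c) - scaledKernel K b (e - t') * (a * c')|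
      ≤ B / b ^ 2 * |t - t'| * (|a| * |c|) + B / b * (|a| * |c - c'|) := by
  have e1 : scaledKernel K b (e - t) * (a * c) - scaledKernel K b (e - t') * (a * c')
      = (scaledKernel K b (e - t) - scaledKernel K b (e - t')) * (a * c)
        + scaledKernel K b (e - t') * (a * (c - c')) := by ring
  rw [e1]
  refine (abs_add_le _ _).trans ?_
  rw [abs_mul, abs_mul, abs_mul, abs_mul, abs_of_nonneg (hK.scaledKernel_nonneg hb (e - t'))]
  have h1 := IsSmoothingKernel.abs_scaledKernel_sub_le hBL hb (e - t) (e - t')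
  have h2 := IsSmoothingKernel.scaledKernel_le hB hb (e - t')
  rw [sub_sub_sub_cancel_left, abs_sub_comm t' t] at h1
  gcongr

/-- The numerical conditions under which the averages are discretized. -/
structure MeshConditions (E : Experiment.{u} τ) (b ρ : ℝ) : Prop where
  one_le_N : 1 ≤ E.N
  s_le : (E.s : ℝ) ≤ E.N
  b_pos : 0 < b
  inv_b_le : 1 / b ≤ E.N
  b_le_one : b ≤ 1
  rho_pos : 0 < ρ
  rho_le_one : ρ ≤ 1

theorem MeshConditions.one_le (hM : MeshConditions E b ρ) : (1 : ℝ) ≤ E.N := by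
  exact_mod_cast hM.one_le_N

section Good

variable {G : Finset (Fin (E.p + 1) → ℝ)} {B b ρ t₁ t₂ t₃ : ℝ} {ω : E.Ω}

/-- Every linear form of a good sample point that is small in coordinates is small. -/
theorem IsGood.abs_dotProduct_le {δ : ℝ} (hgood : E.IsGood K G b ρ δ t₁ t₂ t₃ ω)
    (hM : MeshConditions E b ρ) (q : Fin E.m × Fin E.n) {y : Fin (E.p + 1) → ℝ} {c : ℝ}
    (hc : 0 ≤ c) (hy : ∀ j, j ∉ E.active → y j = 0) (hyc : ∀ j, |y j| ≤ c) :
    |(E.obs q ω).1 ⬝ᵥ y| ≤ (E.N : ℝ) ^ 2 * c := by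
  refine (abs_dotProduct_le_card_mul (Nat.cast_nonneg _) (hgood.bounded q) hy hyc).trans ?_
  have h1 : (E.active.card : ℝ) ≤ E.N := hM.s_le
  calc (E.active.card : ℝ) * (E.N * c) ≤ E.N * (E.N * c) := by gcongr
    _ = _ := by ring

/-- On a good sample point the empirical Hessian is close to `I`, first on the grid and then, by the
Lipschitz continuity of the kernel, between its points. -/
theorem abs_kernMean_sub_le (H : E.IsRegular f₂ L g lamMin) (hK : IsSmoothingKernel K)
    (hB0 : 0 < B) (hB : ∀ u, K u ≤ B) (hBL : ∀ u v, |K u - K v| ≤ B * |u - v|)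
    (hM : MeshConditions E b ρ) {δ : ℝ} (hG : IsGrid G E.active (1 / (E.N : ℝ) ^ 8))
    (hgood : E.IsGood K G b ρ δ t₁ t₂ t₃ ω)
    {u v : Fin (E.p + 1) → ℝ} (hu : ∀ j, j ∉ E.active → u j = 0) (hun : l2norm u ≤ 1)
    (hv : ∀ j, j ∉ E.active → v j = 0) (hvn : l2norm v ≤ ρ) (j : Fin (E.p + 1)) :
    |sampleMean E.centralObs E.obs (E.kernFn K b j u v) ω - (E.Info *ᵥ u) j|
      ≤ t₃ + L * (ρ + b * ∫ y, |y| * K y) * momentConst g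
        + (2 * B + f₂ * momentConst g) / E.N := by
  obtain ⟨hf, hL⟩ := H.dens_zero_bound
  have hN := hM.one_le
  have hN0 : (0 : ℝ) < E.N := by linarith
  obtain ⟨u', hu'G, hu'⟩ := hG.approx u hu hun
  obtain ⟨w, hwG, hw⟩ := hG.approx_smul hM.rho_pos hM.rho_le_one hv hvn
  have hx0 : (0 : ℝ) ≤ 1 / (E.N : ℝ) ^ 8 := by positivity
  have hdu : ∀ k, k ∉ E.active → (u - u') k = 0 := fun k hk => by
    simp [hu k hk, hG.supp u' hu'G k hk]
  have hdv : ∀ k, k ∉ E.active → (v - ρ • w) k = 0 := fun k hk => by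
    simp [hv k hk, hG.supp w hwG k hk]
  have hpt : ∀ q ∈ E.centralObs, |E.kernFn K b j u v (E.obs q ω)
      - E.kernFn K b j u' (ρ • w) (E.obs q ω)| ≤ 2 * B / E.N := by
    intro q _
    set z := E.obs q ω with hz
    have h1 := abs_kernel_mul_sub_le hK hB hBL hM.b_pos (E.err z) (z.1 ⬝ᵥ v)
      (z.1 ⬝ᵥ (ρ • w)) (z.1 j) (z.1 ⬝ᵥ u) (z.1 ⬝ᵥ u')
    rw [← dotProduct_sub, ← dotProduct_sub] at h1
    refine h1.trans ?_
    have a1 : |z.1 ⬝ᵥ (v - ρ • w)| ≤ (E.N : ℝ) ^ 2 * (1 / (E.N : ℝ) ^ 8) :=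
      hgood.abs_dotProduct_le hM q hx0 hdv hw
    have a2 : |z.1 ⬝ᵥ (u - u')| ≤ (E.N : ℝ) ^ 2 * (1 / (E.N : ℝ) ^ 8) :=
      hgood.abs_dotProduct_le hM q hx0 hdu hu'
    have a3 : |z.1 ⬝ᵥ u| ≤ (E.N : ℝ) ^ 2 * 1 :=
      hgood.abs_dotProduct_le hM q zero_le_one hu fun k => (abs_le_l2norm u k).trans hun
    have a4 : |z.1 j| ≤ E.N := hgood.bounded q j
    have a5 : B / b ≤ B * E.N := by
      rw [div_eq_mul_one_div]; exact mul_le_mul_of_nonneg_left hM.inv_b_le hB0.le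
    have a6 : B / b ^ 2 ≤ B * (E.N : ℝ) ^ 2 := by
      have : B / b ^ 2 = B * (1 / b) ^ 2 := by rw [one_div, inv_pow, div_eq_mul_inv]
      rw [this]
      have h0 : 0 ≤ 1 / b := by have := hM.b_pos; positivity
      have := hM.inv_b_le
      gcongr
    have hb0 := hM.b_pos
    calc _ ≤ B * (E.N : ℝ) ^ 2 * ((E.N : ℝ) ^ 2 * (1 / (E.N : ℝ) ^ 8))
          * (E.N * ((E.N : ℝ) ^ 2 * 1))
          + B * E.N * (E.N * ((E.N : ℝ) ^ 2 * (1 / (E.N : ℝ) ^ 8))) := by gcongr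
      _ = B / E.N + B / E.N * (1 / (E.N : ℝ) ^ 3) := by field_simp
      _ ≤ B / E.N + B / E.N * 1 := by
          gcongr
          rw [div_le_one (by positivity)]
          exact one_le_pow₀ hN
      _ = _ := by ring
  have h1 : |sampleMean E.centralObs E.obs (E.kernFn K b j u v) ω
      - sampleMean E.centralObs E.obs (E.kernFn K b j u' (ρ • w)) ω| ≤ 2 * B / E.N := by
    rw [← sampleMean_sub]
    refine (abs_sampleMean_le _ _ _ _).trans (sampleMean_le_of_le (by positivity) hpt)
  have h2 := hgood.kern j u' hu'G w hwG
  have h3 := H.kernFn_mean hK hB hM.b_pos hM.b_le_one hB0 j (hG.norm_le u' hu'G)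
    (hG.norm_le w hwG) hM.rho_pos.le hM.rho_le_one
  have h4 : |(E.Info *ᵥ u') j - (E.Info *ᵥ u) j| ≤ f₂ * momentConst g / E.N := by
    have e : (E.Info *ᵥ u') j - (E.Info *ᵥ u) j = -(E.Info *ᵥ (u - u')) j := by
      rw [mulVec_sub, Pi.sub_apply]; ring
    rw [e, abs_neg]
    have hn : l2norm (u - u') ≤ 1 / E.N := by
      refine (l2norm_le_of_support hx0 hdu fun k _ => hu' k).trans ?_
      have hs : Real.sqrt (E.active.card) ≤ E.N := by
        rw [Real.sqrt_le_iff]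
        exact ⟨hN0.le, (show (E.active.card : ℝ) ≤ E.N from hM.s_le).trans (by nlinarith)⟩
      calc Real.sqrt (E.active.card) * (1 / (E.N : ℝ) ^ 8)
          ≤ E.N * (1 / (E.N : ℝ) ^ 8) := by gcongr
        _ = 1 / E.N * (1 / (E.N : ℝ) ^ 6) := by field_simp
        _ ≤ 1 / E.N * 1 := by
            gcongr
            rw [div_le_one (by positivity)]
            exact one_le_pow₀ hN
        _ = _ := mul_one _
    have hmc := momentConst_pos g
    calc _ ≤ f₂ * momentConst g * l2norm (u - u') := H.abs_info_mulVec_le j _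
      _ ≤ f₂ * momentConst g * (1 / E.N) := by gcongr
      _ = _ := by ring
  have e : (2 * B + f₂ * momentConst g) / E.N = 2 * B / E.N + f₂ * momentConst g / E.N := by ring
  rw [e]
  rw [abs_le] at h1 h2 h3 h4 ⊢
  constructor <;> linarith [h1.1, h1.2, h2.1, h2.2, h3.1, h3.2, h4.1, h4.2]

/-- Uniformly over the initial estimators in the ball of radius `ρ`, the rows of the local
Hessian are close to those of `I`. -/
theorem abs_Dlocal_sub_info_le (H : E.IsRegular f₂ L g lamMin) (hK : IsSmoothingKernel K)
    (hB0 : 0 < B) (hB : ∀ u, K u ≤ B) (hBL : ∀ u v, |K u - K v| ≤ B * |u - v|)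
    (hM : MeshConditions E b ρ) {δ : ℝ} (hG : IsGrid G E.active (1 / (E.N : ℝ) ^ 8))
    (hgood : E.IsGood K G b ρ δ t₁ t₂ t₃ ω) {β₀ : Fin (E.p + 1) → ℝ}
    (hβ : ∀ j, j ∉ E.active → (β₀ - E.betaStar) j = 0) (hβn : l2norm (β₀ - E.betaStar) ≤ ρ)
    {u : Fin (E.p + 1) → ℝ} (hu : ∀ j, j ∉ E.active → u j = 0) (j : Fin (E.p + 1)) :
    |((E.Dlocal K β₀ b E.central ω - E.Info) *ᵥ u) j|
      ≤ (t₃ + L * (ρ + b * ∫ y, |y| * K y) * momentConst g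
        + (2 * B + f₂ * momentConst g) / E.N) * l2norm u := by
  rcases (l2norm_nonneg u).eq_or_lt with h0 | hpos
  · have : u = 0 := by
      ext k
      have := abs_le_l2norm u k
      rw [← h0] at this
      simpa using this
    simp [this, l2norm]
  · have h1 := abs_kernMean_sub_le H hK hB0 hB hBL hM hG hgood (u := (l2norm u)⁻¹ • u)
      (fun k hk => by simp [hu k hk])
      (by rw [l2norm_smul, abs_of_pos (inv_pos.2 hpos), inv_mul_cancel₀ hpos.ne']) hβ hβn j
    rw [← Dlocal_central_mulVec E hK β₀ hM.b_pos.le, ← Pi.sub_apply, ← sub_mulVec, mulVec_smul,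
      Pi.smul_apply, smul_eq_mul, abs_mul, abs_of_pos (inv_pos.2 hpos), inv_mul_le_iff₀ hpos]
      at h1
    linarith

/-- Uniformly over the ball of radius `ρ`, the increment of the empirical score is close to its
linearization. -/
theorem abs_scoreDiffMean_sub_le (H : E.IsRegular f₂ L g lamMin)
    (hM : MeshConditions E b ρ) (hG : IsGrid G E.active (1 / (E.N : ℝ) ^ 8))
    (hgood : E.IsGood K G b ρ (1 / (E.N : ℝ)) t₁ t₂ t₃ ω)
    {v : Fin (E.p + 1) → ℝ} (hv : ∀ j, j ∉ E.active → v j = 0) (hvn : l2norm v ≤ ρ)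
    (j : Fin (E.p + 1)) :
    |sampleMean Finset.univ E.obs (E.scoreDiff j v) ω - (E.Info *ᵥ v) j|
      ≤ 2 * t₂ + L * ρ ^ 2 * momentConst g + (3 * f₂ + 2 * L) * momentConst g / E.N := by
  obtain ⟨hf, hL⟩ := H.dens_zero_bound
  have hN := hM.one_le
  have hN0 : (0 : ℝ) < E.N := by linarith
  have hmc := momentConst_pos g
  obtain ⟨w, hwG, hw⟩ := hG.approx_smul hM.rho_pos hM.rho_le_one hv hvn
  have hx0 : (0 : ℝ) ≤ 1 / (E.N : ℝ) ^ 8 := by positivity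
  have hdv : ∀ k, k ∉ E.active → (v - ρ • w) k = 0 := fun k hk => by
    simp [hv k hk, hG.supp w hwG k hk]
  have hpt : ∀ q ∈ (Finset.univ : Finset (Fin E.m × Fin E.n)),
      |E.scoreDiff j v (E.obs q ω) - E.scoreDiff j (ρ • w) (E.obs q ω)|
        ≤ E.nearFn (1 / (E.N : ℝ)) j (ρ • w) (E.obs q ω) := by
    intro q _
    rw [Population.scoreDiff, Population.scoreDiff, ← mul_sub, abs_mul, Population.nearFn]
    refine mul_le_mul_of_nonneg_left (abs_stepDiff_sub_le ?_ _) (abs_nonneg _)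
    rw [← dotProduct_sub]
    refine (hgood.abs_dotProduct_le hM q hx0 hdv hw).trans ?_
    calc (E.N : ℝ) ^ 2 * (1 / (E.N : ℝ) ^ 8) = 1 / (E.N : ℝ) * (1 / (E.N : ℝ) ^ 5) := by field_simp
      _ ≤ 1 / (E.N : ℝ) * 1 := by
          gcongr
          rw [div_le_one (by positivity)]
          exact one_le_pow₀ hN
      _ = _ := mul_one _
  have h1 : |sampleMean Finset.univ E.obs (E.scoreDiff j v) ω
      - sampleMean Finset.univ E.obs (E.scoreDiff j (ρ • w)) ω|
      ≤ sampleMean Finset.univ E.obs (E.nearFn (1 / (E.N : ℝ)) j (ρ • w)) ω := by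
    rw [← sampleMean_sub]
    exact (abs_sampleMean_le _ _ _ _).trans (sampleMean_mono hpt)
  have h2 := hgood.near j w hwG
  have h3 := H.nearFn_mean j (hG.norm_le w hwG) hM.rho_pos.le hM.rho_le_one
    (δ := 1 / (E.N : ℝ)) (by positivity) (by rw [div_le_one hN0]; exact hN)
  have h4 := hgood.diff j w hwG
  have h5 := H.scoreDiff_mean j (hG.norm_le w hwG) ρ
  have h6 : |(E.Info *ᵥ (ρ • w)) j - (E.Info *ᵥ v) j| ≤ f₂ * momentConst g / E.N := by
    have e : (E.Info *ᵥ (ρ • w)) j - (E.Info *ᵥ v) j = -(E.Info *ᵥ (v - ρ • w)) j := by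
      rw [mulVec_sub, Pi.sub_apply]; ring
    rw [e, abs_neg]
    have hn : l2norm (v - ρ • w) ≤ 1 / E.N := by
      refine (l2norm_le_of_support hx0 hdv fun k _ => hw k).trans ?_
      have hs : Real.sqrt (E.active.card) ≤ E.N := by
        rw [Real.sqrt_le_iff]
        exact ⟨hN0.le, (show (E.active.card : ℝ) ≤ E.N from hM.s_le).trans (by nlinarith)⟩
      calc Real.sqrt (E.active.card) * (1 / (E.N : ℝ) ^ 8)
          ≤ E.N * (1 / (E.N : ℝ) ^ 8) := by gcongr
        _ = 1 / E.N * (1 / (E.N : ℝ) ^ 6) := by field_simp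
        _ ≤ 1 / E.N * 1 := by
            gcongr
            rw [div_le_one (by positivity)]
            exact one_le_pow₀ hN
        _ = _ := mul_one _
    calc _ ≤ f₂ * momentConst g * l2norm (v - ρ • w) := H.abs_info_mulVec_le j _
      _ ≤ f₂ * momentConst g * (1 / E.N) := by gcongr
      _ = _ := by ring
  have e : (3 * f₂ + 2 * L) * momentConst g / E.N
      = 2 * (1 / E.N) * (f₂ + L) * momentConst g + f₂ * momentConst g / E.N := by ring
  rw [e]
  rw [abs_le] at h1 h2 h4 h5 h6 ⊢
  constructor <;> linarith [h1.1, h1.2, h2.1, h2.2, h4.1, h4.2, h5.1, h5.2, h6.1, h6.2]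

/-- The gradient of the quadratic loss at `β*` is small in the maximum norm: the first-order
effects of the error of the initial estimator on the score and on the Hessian cancel. -/
theorem abs_gradient_le (H : E.IsRegular f₂ L g lamMin) (hτ : τ ∈ Set.Ioo (0 : ℝ) 1)
    (hK : IsSmoothingKernel K)
    (hB0 : 0 < B) (hB : ∀ u, K u ≤ B) (hBL : ∀ u v, |K u - K v| ≤ B * |u - v|)
    (hM : MeshConditions E b ρ) (hG : IsGrid G E.active (1 / (E.N : ℝ) ^ 8))
    (hgood : E.IsGood K G b ρ (1 / (E.N : ℝ)) t₁ t₂ t₃ ω) (ht₃ : 0 ≤ t₃)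
    {β₀ : Fin (E.p + 1) → ℝ}
    (hβ : ∀ j, j ∉ E.active → (β₀ - E.betaStar) j = 0) (hβn : l2norm (β₀ - E.betaStar) ≤ ρ)
    (h : ℝ) (j : Fin (E.p + 1)) :
    |(E.Dlocal K β₀ b E.central ω *ᵥ E.betaStar - E.linCoef K β₀ h b ω) j|
      ≤ t₁ + 2 * t₂ + L * ρ ^ 2 * momentConst g + (3 * f₂ + 2 * L) * momentConst g / E.N
        + (t₃ + L * (ρ + b * ∫ y, |y| * K y) * momentConst g
          + (2 * B + f₂ * momentConst g) / E.N) * ρ := by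
  have h1 := hgood.score j
  rw [H.integral_scoreFn hτ, sub_zero] at h1
  have h2 := abs_scoreDiffMean_sub_le H hM hG hgood hβ hβn j
  have h3 := abs_Dlocal_sub_info_le H hK hB0 hB hBL hM hG hgood hβ hβn hβ j
  obtain ⟨hf, hL⟩ := H.dens_zero_bound
  have hmc := momentConst_pos g
  have hm : 0 ≤ ∫ y, |y| * K y := integral_nonneg fun y => mul_nonneg (abs_nonneg _) (hK.nonneg y)
  have hb0 := hM.b_pos
  have hρ0 := hM.rho_pos
  have h4 := h3.trans (mul_le_mul_of_nonneg_left hβn (by positivity))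
  rw [gradient_apply E hK β₀ h hM.b_pos.le]
  rw [sub_mulVec, Pi.sub_apply, Dlocal_central_mulVec E hK β₀ hM.b_pos.le] at h4
  rw [abs_le] at h1 h2 h4 ⊢
  constructor <;> linarith [h1.1, h1.2, h2.1, h2.2, h4.1, h4.2]

/-- On a good sample point, an initial estimator with the right support in the ball of radius `ρ`
leads to the right support, where `κ` bounds the error of the Hessian and `λ` the gradient. -/
theorem support_recovery_of_isGood (H : E.IsRegular f₂ L g lamMin)
    (hlamMin : 0 < lamMin) {α lamMax : ℝ} (hα : α ∈ Set.Ioo (0 : ℝ) 1)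
    (hI : E.Irrepresentable α lamMin lamMax) (hτ : τ ∈ Set.Ioo (0 : ℝ) 1)
    (hK : IsSmoothingKernel K)
    (hB0 : 0 < B) (hB : ∀ u, K u ≤ B) (hBL : ∀ u v, |K u - K v| ≤ B * |u - v|)
    (hM : MeshConditions E b ρ) (hG : IsGrid G E.active (1 / (E.N : ℝ) ^ 8))
    (hgood : E.IsGood K G b ρ (1 / (E.N : ℝ)) t₁ t₂ t₃ ω) (ht₃ : 0 ≤ t₃) {κ lam : ℝ}
    (hlam : 0 < lam)
    (hκ : t₃ + L * (ρ + b * ∫ y, |y| * K y) * momentConst g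
        + (2 * B + f₂ * momentConst g) / E.N ≤ κ)
    (hκs : 16 * (Real.sqrt E.s * κ) ≤ α * lamMin)
    (hw : t₁ + 2 * t₂ + L * ρ ^ 2 * momentConst g + (3 * f₂ + 2 * L) * momentConst g / E.N
      + κ * ρ ≤ α / 8 * lam)
    {h : ℝ} {beta0 beta1 : E.Ω → Fin (E.p + 1) → ℝ}
    (hest : E.IsOneStepEstimator K h b lam beta0 beta1)
    (hsupp : ∀ j, beta0 ω j ≠ 0 → j ∈ E.active) (hnorm : l2norm (beta0 ω - E.betaStar) ≤ ρ) :
    slopeSupp (beta1 ω) ⊆ E.supp ∧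
      ((∀ j ∈ E.supp, rowSumNorm E.infoSS⁻¹ * (2 * lam) < |E.betaStar j|) →
        slopeSupp (beta1 ω) = E.supp) := by
  obtain ⟨hf, hL⟩ := H.dens_zero_bound
  have hmc := momentConst_pos g
  have hN := hM.one_le
  have hm : 0 ≤ ∫ y, |y| * K y := integral_nonneg fun y => mul_nonneg (abs_nonneg _) (hK.nonneg y)
  have hb0 := hM.b_pos
  have hρ0 := hM.rho_pos
  have hκ0 : 0 ≤ κ := le_trans (by positivity) hκ
  have hact : ∀ j, j ∉ E.active → E.betaStar j = 0 := fun j hj => by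
    by_contra hne; exact hj (by simp [Population.active, hne])
  have hβ : ∀ j, j ∉ E.active → (beta0 ω - E.betaStar) j = 0 := fun j hj => by
    have : beta0 ω j = 0 := by by_contra hne; exact hj (hsupp j hne)
    simp [this, hact j hj]
  have HC : CloseToIrrepresentable E.Info (E.Dlocal K (beta0 ω) b E.central ω) E.active
      lamMin α κ :=
    { symm := E.Dlocal_transpose _ _ _ _
      psd := fun v => by
        rw [dotProduct_Dlocal_mulVec]
        exact mul_nonneg (by positivity) (Finset.sum_nonneg fun i _ => sq_nonneg _)
      lamMin_pos := hlamMin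
      posDef := H.info_lower
      alpha_mem := hα
      irrep := hI.1
      kappa_nonneg := hκ0
      close := fun v hv j => (abs_Dlocal_sub_info_le H hK hB0 hB hBL hM hG hgood hβ hnorm hv
        j).trans (mul_le_mul_of_nonneg_right hκ (l2norm_nonneg v))
      kappa_small := hκs }
  have hgrad : ∀ j, |(E.Dlocal K (beta0 ω) b E.central ω *ᵥ E.betaStar
      - E.linCoef K (beta0 ω) h b ω) j| ≤ α / 8 * lam := fun j => by
    refine (abs_gradient_le H hτ hK hB0 hB hBL hM hG hgood ht₃ hβ hnorm h j).trans ?_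
    have := mul_le_mul_of_nonneg_right hκ hρ0.le
    linarith
  obtain ⟨⟨β, hβmin⟩, hall⟩ := HC.lasso_support_recovery hlam hact hgrad
  have hmin := hest.minimizes ω ⟨β, fun β' => by
    rw [shiftedLoss_add_eq_lassoLoss, shiftedLoss_add_eq_lassoLoss]; exact hβmin β'⟩
  obtain ⟨hoff, hclose⟩ := hall (beta1 ω) fun β' => by
    have := hmin β'
    rwa [shiftedLoss_add_eq_lassoLoss, shiftedLoss_add_eq_lassoLoss] at this
  have hsub : slopeSupp (beta1 ω) ⊆ E.supp := by
    intro j hj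
    simp only [slopeSupp, Finset.mem_filter, Finset.mem_univ, true_and] at hj
    have hjA : j ∈ E.active := by by_contra hn; exact hj.2 (hoff j hn)
    simp only [Population.active, Finset.mem_filter, Finset.mem_univ, true_and] at hjA
    simp only [Population.supp, Finset.mem_filter, Finset.mem_univ, true_and]
    exact ⟨hj.1, hjA⟩
  refine ⟨hsub, fun hbig => Finset.Subset.antisymm hsub fun j hj => ?_⟩
  have hbj := hbig j hj
  simp only [Population.supp, Finset.mem_filter, Finset.mem_univ, true_and] at hj
  have hjA : j ∈ E.active := by simp [Population.active, hj.2]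
  simp only [slopeSupp, Finset.mem_filter, Finset.mem_univ, true_and]
  refine ⟨hj.1, fun h0 => ?_⟩
  have := hclose j hjA
  rw [h0, zero_sub, abs_neg] at this
  exact absurd this (not_le.2 hbj)

end Good

end Experiment

/-! ### The asymptotic regime -/

/-- An experiment that is far enough in a sequence with the growth conditions. The condition
`sparsity` bounds both `√s η` and `s √(s log N / n)` by the threshold `ζ`; the total sample size is
at least `N₀`, and the bandwidth `b` and the initial rate `a` are of the prescribed orders. -/
structure InRegime {τ : ℝ} (E : Experiment.{u} τ) (ν c κ₁ κ₂ ζ N₀ b a : ℝ) : Prop where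
  three_le : (3 : ℝ) ≤ E.N
  le_N : N₀ ≤ E.N
  one_le_s : (1 : ℝ) ≤ E.s
  one_le_n : (1 : ℝ) ≤ E.n
  n_le : (E.n : ℝ) ≤ E.N
  log_le : c * Real.log E.N ≤ Real.log E.n
  one_le_log : 1 ≤ κ₁ * Real.log E.n
  dimension : (E.p + 1 : ℝ) ≤ (E.N : ℝ) ^ (ν + 1)
  sparsity : (E.s * Real.log E.N) ^ 3 ≤ ζ ^ 6 * E.n
  le_b : κ₁ * (E.s * Real.log E.n / E.n) ^ (1 / 3 : ℝ) ≤ b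
  b_le : b ≤ κ₂ * (E.s * Real.log E.n / E.n) ^ (1 / 3 : ℝ)
  le_a : κ₁ * Real.sqrt (E.s * Real.log E.N / E.n) ≤ a
  a_le : a ≤ κ₂ * Real.sqrt (E.s * Real.log E.N / E.n)

/-- Every sequence with the growth conditions enters the regime, whatever its thresholds: since
`r < 1/3`, the logarithm of `n` is negligible against `n^{1/3 - r}`. -/
theorem RateConditions.eventually_inRegime {τ : ℝ} {E : ℕ → Experiment.{u} τ}
    {ν c r κ₁ κ₂ : ℝ} {h b a : ℕ → ℝ} (R : RateConditions E ν c r κ₁ κ₂ h b a)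
    (hν : 0 < ν) (hc : 0 < c) (hr : r < 1 / 3) (hκ₁ : 0 < κ₁) {ζ : ℝ} (hζ : 0 < ζ) (N₀ : ℝ) :
    ∀ᶠ k in atTop, InRegime (E k) ν c κ₁ κ₂ ζ N₀ (b k) (a k) := by
  have hN : Tendsto (fun k => ((E k).N : ℝ)) atTop atTop :=
    tendsto_natCast_atTop_atTop.comp R.sample_size
  have hn : Tendsto (fun k => ((E k).n : ℝ)) atTop atTop :=
    tendsto_atTop_mono' _ R.local_size ((tendsto_rpow_atTop hc).comp hN)
  have hlogn : Tendsto (fun k => Real.log (E k).n) atTop atTop :=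
    Real.tendsto_log_atTop.comp hn
  obtain ⟨cp, hcp, hp⟩ := R.dimension.exists_pos
  obtain ⟨cs, hcs, hs⟩ := R.sparsity.exists_pos
  have hsmall : ∀ᶠ k in atTop, Real.log (E k).n
      ≤ c * ζ ^ 2 / cs * ((E k).n : ℝ) ^ (1 / 3 - r) := by
    have h1 := (isLittleO_log_rpow_atTop (sub_pos.2 hr)).bound
      (show 0 < c * ζ ^ 2 / cs by positivity)
    filter_upwards [hn.eventually h1] with k hk
    refine (le_abs_self _).trans (hk.trans (le_of_eq ?_))
    rw [Real.norm_of_nonneg (by positivity)]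
  filter_upwards [hN.eventually_ge_atTop 3, hN.eventually_ge_atTop N₀,
    hn.eventually_ge_atTop 1, R.local_size, hlogn.eventually_ge_atTop (1 / κ₁), hp.bound,
    hs.bound, hsmall, R.local_bandwidth, R.initial_rate,
    hN.eventually_ge_atTop (cp + 1)] with k h3 h0 h1 hl hlg hpk hsk hsm hb ha hcpk
  have hm : 1 ≤ (E k).m := Nat.one_le_iff_ne_zero.2 fun h => by
    have := (E k).central
    rw [h] at this
    exact this.elim0
  have hnN : ((E k).n : ℝ) ≤ (E k).N := by
    have : (E k).n ≤ (E k).N := Nat.le_mul_of_pos_left _ hm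
    exact_mod_cast this
  have hN0 : (0 : ℝ) < (E k).N := by linarith
  have hn0 : (0 : ℝ) < (E k).n := by linarith
  have hlog : c * Real.log (E k).N ≤ Real.log (E k).n := by
    rw [← Real.log_rpow hN0]
    exact Real.log_le_log (by positivity) hl
  have hlN : 0 ≤ Real.log (E k).N := Real.log_nonneg (by linarith)
  refine ⟨h3, h0, by exact_mod_cast R.sparsity_pos k, h1, hnN, hlog, ?_, ?_, ?_, hb.1, hb.2,
    ha.1, ha.2⟩
  · rwa [div_le_iff₀' hκ₁] at hlg
  · rw [Real.norm_of_nonneg (by positivity), Real.norm_of_nonneg (by positivity)] at hpk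
    have h4 : (1 : ℝ) ≤ ((E k).N : ℝ) ^ ν := Real.one_le_rpow (by linarith) hν.le
    rw [Real.rpow_add hN0, Real.rpow_one]
    calc ((E k).p + 1 : ℝ) ≤ cp * ((E k).N : ℝ) ^ ν + ((E k).N : ℝ) ^ ν := by linarith
      _ = ((E k).N : ℝ) ^ ν * (cp + 1) := by ring
      _ ≤ _ := by gcongr
  · rw [Real.norm_of_nonneg (by positivity), Real.norm_of_nonneg (by positivity)] at hsk
    have h5 : (E k).s * Real.log (E k).N ≤ ζ ^ 2 * ((E k).n : ℝ) ^ (1 / 3 : ℝ) := by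
      have h6 : Real.log (E k).N ≤ Real.log (E k).n / c := by
        rwa [le_div_iff₀ hc, mul_comm]
      calc (E k).s * Real.log (E k).N
          ≤ (cs * ((E k).n : ℝ) ^ r)
            * (c * ζ ^ 2 / cs * ((E k).n : ℝ) ^ (1 / 3 - r) / c) := by
            refine mul_le_mul hsk (h6.trans ?_) hlN (by positivity)
            gcongr
        _ = ζ ^ 2 * (((E k).n : ℝ) ^ r * ((E k).n : ℝ) ^ (1 / 3 - r)) := by field_simp
        _ = _ := by rw [← Real.rpow_add hn0]; ring_nf
    calc ((E k).s * Real.log (E k).N) ^ 3 ≤ (ζ ^ 2 * ((E k).n : ℝ) ^ (1 / 3 : ℝ)) ^ 3 := by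
          gcongr
      _ = ζ ^ 6 * (((E k).n : ℝ) ^ (1 / 3 : ℝ)) ^ 3 := by ring
      _ = _ := by
          congr 1
          rw [← Real.rpow_natCast, ← Real.rpow_mul hn0.le]
          norm_num

namespace InRegime

variable {τ : ℝ} {E : Experiment.{u} τ} {ν c κ₁ κ₂ ζ N₀ b a : ℝ}

theorem one_le_log_N (h : InRegime E ν c κ₁ κ₂ ζ N₀ b a) : 1 ≤ Real.log E.N := by
  rw [Real.le_log_iff_exp_le (by linarith [h.three_le])]
  linarith [Real.exp_one_lt_d9, h.three_le]

theorem log_n_le (h : InRegime E ν c κ₁ κ₂ ζ N₀ b a) : Real.log E.n ≤ Real.log E.N :=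
  Real.log_le_log (by linarith [h.one_le_n]) h.n_le

theorem log_n_nonneg (h : InRegime E ν c κ₁ κ₂ ζ N₀ b a) : 0 ≤ Real.log E.n :=
  Real.log_nonneg h.one_le_n

theorem cube_root_pow (h : InRegime E ν c κ₁ κ₂ ζ N₀ b a) :
    ((E.s * Real.log E.n / E.n) ^ (1 / 3 : ℝ)) ^ 3 = E.s * Real.log E.n / E.n := by
  have := h.log_n_nonneg
  rw [← Real.rpow_natCast, ← Real.rpow_mul (by positivity)]
  norm_num

theorem sqrt_sq_eq (h : InRegime E ν c κ₁ κ₂ ζ N₀ b a) :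
    Real.sqrt (E.s * Real.log E.N / E.n) ^ 2 = E.s * Real.log E.N / E.n := by
  have := h.one_le_log_N
  exact Real.sq_sqrt (by positivity)

theorem sqrt_s_mul_cube_root_le (h : InRegime E ν c κ₁ κ₂ ζ N₀ b a) :
    Real.sqrt E.s * (E.s * Real.log E.n / E.n) ^ (1 / 3 : ℝ) ≤ ζ ^ 2 := by
  have hlN := h.one_le_log_N
  have hs := h.one_le_s
  have hn : (0 : ℝ) < E.n := by linarith [h.one_le_n]
  have hln := h.log_n_nonneg
  refine le_of_pow_le_pow_left₀ (n := 6) (by norm_num) (by positivity) ?_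
  have e : (Real.sqrt E.s * (E.s * Real.log E.n / E.n) ^ (1 / 3 : ℝ)) ^ 6
      = (Real.sqrt E.s ^ 2) ^ 3 * (((E.s * Real.log E.n / E.n) ^ (1 / 3 : ℝ)) ^ 3) ^ 2 := by ring
  rw [e, h.cube_root_pow, Real.sq_sqrt (by linarith)]
  have h1 : (E.s * Real.log E.N) ^ 3 / E.n ≤ ζ ^ 6 := by
    rw [div_le_iff₀ hn]; exact h.sparsity
  calc (E.s : ℝ) ^ 3 * (E.s * Real.log E.n / E.n) ^ 2
      ≤ (E.s : ℝ) ^ 3 * (E.s * Real.log E.N / E.n) ^ 2 * (E.s * Real.log E.N ^ 4) := by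
        have h2 : (1 : ℝ) ≤ E.s * Real.log E.N ^ 4 :=
          one_le_mul_of_one_le_of_one_le hs (one_le_pow₀ hlN)
        have h3 := h.log_n_le
        refine le_trans ?_ (le_mul_of_one_le_right (by positivity) h2)
        gcongr
    _ = ((E.s * Real.log E.N) ^ 3 / E.n) ^ 2 := by ring
    _ ≤ (ζ ^ 6) ^ 2 := by gcongr
    _ = _ := by ring

theorem s_mul_sqrt_le (h : InRegime E ν c κ₁ κ₂ ζ N₀ b a) (hζ : 0 ≤ ζ) :
    E.s * Real.sqrt (E.s * Real.log E.N / E.n) ≤ ζ ^ 3 := by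
  have hlN := h.one_le_log_N
  have hs := h.one_le_s
  have hn : (0 : ℝ) < E.n := by linarith [h.one_le_n]
  refine le_of_pow_le_pow_left₀ (n := 2) (by norm_num) (by positivity) ?_
  rw [mul_pow, h.sqrt_sq_eq]
  have h1 : (E.s * Real.log E.N) ^ 3 / E.n ≤ ζ ^ 6 := by
    rw [div_le_iff₀ hn]; exact h.sparsity
  calc (E.s : ℝ) ^ 2 * (E.s * Real.log E.N / E.n)
      ≤ (E.s : ℝ) ^ 2 * (E.s * Real.log E.N / E.n) * Real.log E.N ^ 2 :=
        le_mul_of_one_le_right (by positivity) (one_le_pow₀ hlN)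
    _ = (E.s * Real.log E.N) ^ 3 / E.n := by ring
    _ ≤ ζ ^ 6 := h1
    _ = _ := by ring

theorem sqrt_s_mul_eta_le (h : InRegime E ν c κ₁ κ₂ ζ N₀ b a) (hζ : 0 ≤ ζ) (hζ1 : ζ ≤ 1) :
    Real.sqrt E.s * eta E ≤ ζ := by
  have hs := h.one_le_s
  have hlN := h.one_le_log_N
  rw [eta, mul_max_of_nonneg _ _ (Real.sqrt_nonneg _)]
  refine max_le (h.sqrt_s_mul_cube_root_le.trans (pow_le_of_le_one hζ hζ1 two_ne_zero)) ?_
  refine le_trans ?_ ((h.s_mul_sqrt_le hζ).trans (pow_le_of_le_one hζ hζ1 three_ne_zero))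
  refine mul_le_mul_of_nonneg_right ?_ (Real.sqrt_nonneg _)
  rw [Real.sqrt_le_iff]
  exact ⟨by linarith, by nlinarith⟩

theorem cube_root_le_eta : (E.s * Real.log E.n / E.n) ^ (1 / 3 : ℝ) ≤ eta E := le_max_left _ _

theorem sqrt_le_eta : Real.sqrt (E.s * Real.log E.N / E.n) ≤ eta E := le_max_right _ _

theorem eta_le (h : InRegime E ν c κ₁ κ₂ ζ N₀ b a) (hζ : 0 ≤ ζ) (hζ1 : ζ ≤ 1) : eta E ≤ ζ := by
  have h0 : 0 ≤ eta E := (Real.sqrt_nonneg _).trans sqrt_le_eta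
  refine le_trans (le_mul_of_one_le_left h0 ?_) (h.sqrt_s_mul_eta_le hζ hζ1)
  rw [Real.one_le_sqrt]
  exact h.one_le_s

theorem sqrt_log_div_N_le (h : InRegime E ν c κ₁ κ₂ ζ N₀ b a) :
    Real.sqrt (Real.log E.N / E.N) ≤ Real.sqrt (E.s * Real.log E.N / E.n) := by
  have hlN := h.one_le_log_N
  have hs := h.one_le_s
  have hn : (0 : ℝ) < E.n := by linarith [h.one_le_n]
  have := h.n_le
  refine Real.sqrt_le_sqrt (div_le_div₀ (by positivity) ?_ hn this)
  nlinarith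

theorem inv_N_le (h : InRegime E ν c κ₁ κ₂ ζ N₀ b a) :
    1 / (E.N : ℝ) ≤ Real.sqrt (Real.log E.N / E.N) := by
  have hlN := h.one_le_log_N
  have hN : (1 : ℝ) ≤ E.N := by linarith [h.three_le]
  refine Real.le_sqrt_of_sq_le ?_
  rw [div_pow, one_pow, div_le_div_iff₀ (by positivity) (by positivity)]
  nlinarith

theorem inv_N_le_eta (h : InRegime E ν c κ₁ κ₂ ζ N₀ b a) : 1 / (E.N : ℝ) ≤ eta E :=
  h.inv_N_le.trans (h.sqrt_log_div_N_le.trans sqrt_le_eta)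

theorem a_pos (h : InRegime E ν c κ₁ κ₂ ζ N₀ b a) (hκ₁ : 0 < κ₁) : 0 < a := by
  have hlN := h.one_le_log_N
  have hs := h.one_le_s
  have hn : (0 : ℝ) < E.n := by linarith [h.one_le_n]
  refine lt_of_lt_of_le (mul_pos hκ₁ (Real.sqrt_pos.2 ?_)) h.le_a
  have : (0 : ℝ) < E.s * Real.log E.N := by nlinarith
  positivity

/-- The bandwidth is bounded below through `x ≤ x^{1/3}` for `x = s log n / n ≤ 1`. -/
theorem inv_N_le_b (h : InRegime E ν c κ₁ κ₂ ζ N₀ b a) (hκ₁ : 0 < κ₁) (hζ : 0 ≤ ζ)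
    (hζ1 : ζ ≤ 1) : 1 / (E.N : ℝ) ≤ b := by
  have hs := h.one_le_s
  have hn : (0 : ℝ) < E.n := by linarith [h.one_le_n]
  have hln := h.log_n_nonneg
  have hN := h.n_le
  have hx0 : 0 ≤ (E.s * Real.log E.n / E.n) ^ (1 / 3 : ℝ) := by positivity
  have hx1 : (E.s * Real.log E.n / E.n) ^ (1 / 3 : ℝ) ≤ 1 :=
    cube_root_le_eta.trans ((h.eta_le hζ hζ1).trans hζ1)
  refine le_trans ?_ h.le_b
  calc 1 / (E.N : ℝ) ≤ 1 / E.n := by gcongr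
    _ ≤ κ₁ * Real.log E.n / E.n := by gcongr; exact h.one_le_log
    _ ≤ κ₁ * (E.s * Real.log E.n / E.n) := by
        rw [mul_div_assoc]
        gcongr
        exact le_mul_of_one_le_left hln hs
    _ ≤ _ := by
        gcongr
        nth_rewrite 1 [← h.cube_root_pow]
        exact pow_le_of_le_one hx0 hx1 three_ne_zero

theorem meshConditions (h : InRegime E ν c κ₁ κ₂ ζ N₀ b a) (hκ₁ : 0 < κ₁) (hκ₂ : 0 < κ₂)
    (hζ : 0 ≤ ζ) (hζ1 : ζ ≤ 1) (hζκ : κ₂ * ζ ≤ 1) {M : ℝ} (hM : 0 < M) (hζM : M * (κ₂ * ζ) ≤ 1) :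
    Experiment.MeshConditions E b (M * a) := by
  have hN := h.three_le
  have hb := h.inv_N_le_b hκ₁ hζ hζ1
  have hN0 : (0 : ℝ) < E.N := by linarith
  have hb0 : 0 < b := lt_of_lt_of_le (by positivity) hb
  have hη := h.eta_le hζ hζ1
  refine ⟨?_, ?_, hb0, ?_, ?_, mul_pos hM (h.a_pos hκ₁), ?_⟩
  · have : (1 : ℝ) ≤ E.N := by linarith
    exact_mod_cast this
  · have hs := h.one_le_s
    have hlN := h.one_le_log_N
    have h1 : (1 : ℝ) ≤ E.s * Real.log E.N := one_le_mul_of_one_le_of_one_le hs hlN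
    calc (E.s : ℝ) ≤ E.s * Real.log E.N := le_mul_of_one_le_right (by linarith) hlN
      _ ≤ (E.s * Real.log E.N) ^ 3 := le_self_pow₀ h1 three_ne_zero
      _ ≤ ζ ^ 6 * E.n := h.sparsity
      _ ≤ 1 * E.n := by gcongr; exact pow_le_one₀ hζ hζ1
      _ ≤ E.N := by rw [one_mul]; exact h.n_le
  · rw [div_le_iff₀ hb0]
    rwa [div_le_iff₀' hN0] at hb
  · refine h.b_le.trans (le_trans ?_ hζκ)
    gcongr
    exact cube_root_le_eta.trans hη
  · refine le_trans ?_ hζM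
    gcongr
    refine h.a_le.trans ?_
    gcongr
    exact sqrt_le_eta.trans hη

end InRegime

/-! ### The good event in the asymptotic regime -/

namespace InRegime

variable {τ : ℝ} {E : Experiment.{u} τ} {ν c κ₁ κ₂ ζ N₀ b a : ℝ} {K : ℝ → ℝ}
  {f₂ L g lamMin B M : ℝ}

/-- The counting factor `(2 N⁸ + 1)^s` of the grid is at most `N^{9 s}`. -/
theorem two_mul_pow_add_one_pow_le (h : InRegime E ν c κ₁ κ₂ ζ N₀ b a) :
    (2 * (E.N : ℝ) ^ 8 + 1) ^ E.s ≤ Real.exp (9 * (E.s * Real.log E.N)) := by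
  have hN := h.three_le
  have hN0 : (0 : ℝ) < E.N := by linarith
  have h1 : 2 * (E.N : ℝ) ^ 8 + 1 ≤ (E.N : ℝ) ^ 9 := by
    have h2 : (1 : ℝ) ≤ (E.N : ℝ) ^ 8 := one_le_pow₀ (by linarith)
    calc 2 * (E.N : ℝ) ^ 8 + 1 ≤ 3 * (E.N : ℝ) ^ 8 := by linarith
      _ ≤ E.N * (E.N : ℝ) ^ 8 := by gcongr
      _ = _ := by ring
  calc (2 * (E.N : ℝ) ^ 8 + 1) ^ E.s ≤ ((E.N : ℝ) ^ 9) ^ E.s := by gcongr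
    _ = Real.exp (Real.log (((E.N : ℝ) ^ 9) ^ E.s)) := (Real.exp_log (by positivity)).symm
    _ = _ := by
      rw [Real.log_pow, Real.log_pow]
      congr 1
      push_cast
      ring

/-- The union bound over the coordinates, the observations and pairs of grid points. -/
theorem union_bound_le (h : InRegime E ν c κ₁ κ₂ ζ N₀ b a) (hν : 0 < ν) :
    5 * (E.N * (E.p + 1) * Real.exp (-((ν + 3) * Real.log E.N)))
      + 6 * ((E.p + 1) * Real.exp (9 * (E.s * Real.log E.N)) ^ 2
        * Real.exp (-((ν + 20) * (E.s * Real.log E.N)))) ≤ 11 / E.N := by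
  have hN0 : (0 : ℝ) < E.N := by linarith [h.three_le]
  have hlN := h.one_le_log_N
  have hs := h.one_le_s
  have hp : (E.p + 1 : ℝ) ≤ Real.exp ((ν + 1) * Real.log E.N) := by
    refine h.dimension.trans (le_of_eq ?_)
    rw [Real.rpow_def_of_pos hN0, mul_comm]
  have hNe : (E.N : ℝ) = Real.exp (Real.log E.N) := (Real.exp_log hN0).symm
  have h1 : (E.N : ℝ) * (E.p + 1) * Real.exp (-((ν + 3) * Real.log E.N)) ≤ 1 / E.N := by
    calc (E.N : ℝ) * (E.p + 1) * Real.exp (-((ν + 3) * Real.log E.N))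
        ≤ Real.exp (Real.log E.N) * Real.exp ((ν + 1) * Real.log E.N)
          * Real.exp (-((ν + 3) * Real.log E.N)) := by
          rw [← hNe]; gcongr
      _ = Real.exp (-Real.log E.N) := by
          rw [← Real.exp_add, ← Real.exp_add]; congr 1; ring
      _ = 1 / E.N := by rw [Real.exp_neg, ← hNe, one_div]
  have h2 : (E.p + 1 : ℝ) * Real.exp (9 * (E.s * Real.log E.N)) ^ 2
      * Real.exp (-((ν + 20) * (E.s * Real.log E.N))) ≤ 1 / E.N := by
    calc (E.p + 1 : ℝ) * Real.exp (9 * (E.s * Real.log E.N)) ^ 2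
          * Real.exp (-((ν + 20) * (E.s * Real.log E.N)))
        ≤ Real.exp ((ν + 1) * Real.log E.N) * Real.exp (9 * (E.s * Real.log E.N)) ^ 2
          * Real.exp (-((ν + 20) * (E.s * Real.log E.N))) := by gcongr
      _ = Real.exp ((ν + 1) * Real.log E.N - (ν + 2) * (E.s * Real.log E.N)) := by
          rw [← Real.exp_nat_mul, ← Real.exp_add, ← Real.exp_add]
          congr 1
          push_cast
          ring
      _ ≤ Real.exp (-Real.log E.N) := by
          refine Real.exp_le_exp.2 ?_
          have : Real.log E.N ≤ E.s * Real.log E.N := le_mul_of_one_le_left (by linarith) hs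
          nlinarith
      _ = 1 / E.N := by rw [Real.exp_neg, ← hNe, one_div]
  have e : 11 / (E.N : ℝ) = 5 * (1 / E.N) + 6 * (1 / E.N) := by ring
  rw [e]
  linarith

/-- The exponent for the score increments: their variance is of order `a`, and `s a` is small, so
that the exponent exceeds the logarithm `s log N` of the size of the grid. -/
theorem le_scoreDiff_exponent (h : InRegime E ν c κ₁ κ₂ ζ N₀ b a) (hν : 0 < ν) (hκ₁ : 0 < κ₁)
    (hκ₂ : 0 < κ₂) (hζ : 0 ≤ ζ) (hζ1 : ζ ≤ 1) {V : ℝ} (hV : 0 < V)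
    (hζ₂ : 4 * V * (ν + 20) * κ₂ * ζ ≤ 1) :
    (ν + 20) * (E.s * Real.log E.N)
      ≤ E.N * Real.sqrt (Real.log E.N / E.N) ^ 2 / (4 * (V * a)) := by
  have hN0 : (0 : ℝ) < E.N := by linarith [h.three_le]
  have hlN := h.one_le_log_N
  have ha := h.a_pos hκ₁
  have hs := h.one_le_s
  have hsA := (h.s_mul_sqrt_le hζ).trans (pow_le_of_le_one hζ hζ1 three_ne_zero)
  have haA := h.a_le
  set lN := Real.log E.N
  set A := Real.sqrt (E.s * lN / E.n)
  rw [Real.sq_sqrt (by positivity), le_div_iff₀ (by positivity)]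
  have h1 : (E.N : ℝ) * (lN / E.N) = lN := by field_simp
  have h2 : E.s * a ≤ κ₂ * ζ := by
    calc E.s * a ≤ E.s * (κ₂ * A) := by gcongr
      _ = κ₂ * (E.s * A) := by ring
      _ ≤ _ := by gcongr
  rw [h1]
  calc (ν + 20) * (E.s * lN) * (4 * (V * a)) = 4 * V * (ν + 20) * (E.s * a) * lN := by ring
    _ ≤ 4 * V * (ν + 20) * (κ₂ * ζ) * lN := by gcongr
    _ = (4 * V * (ν + 20) * κ₂ * ζ) * lN := by ring
    _ ≤ 1 * lN := by gcongr
    _ = lN := one_mul _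

/-- The exponent for `nearFn`, with variance proxy `√(log N / N) / 2`. -/
theorem le_nearFn_exponent (h : InRegime E ν c κ₁ κ₂ ζ N₀ b a) (hν : 0 < ν)
    (hζ : 0 ≤ ζ) (hζ1 : ζ ≤ 1) (hζ₃ : 2 * (ν + 20) * ζ ≤ 1) :
    (ν + 20) * (E.s * Real.log E.N) ≤ E.N * Real.sqrt (Real.log E.N / E.N) ^ 2
      / (4 * (Real.sqrt (Real.log E.N / E.N) / 2)) := by
  have hN0 : (0 : ℝ) < E.N := by linarith [h.three_le]
  have hlN := h.one_le_log_N
  have hs := h.one_le_s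
  have hsp := h.sparsity
  have hn := h.n_le
  set lN := Real.log E.N
  have hl0 : 0 < Real.sqrt (lN / E.N) := Real.sqrt_pos.2 (by positivity)
  have hl2 : Real.sqrt (lN / E.N) ^ 2 = lN / E.N := Real.sq_sqrt (by positivity)
  set l := Real.sqrt (lN / E.N)
  have e : (E.N : ℝ) * l ^ 2 / (4 * (l / 2)) = E.N * l / 2 := by field_simp; ring
  rw [e, le_div_iff₀ two_pos]
  refine le_of_pow_le_pow_left₀ (n := 2) two_ne_zero (by positivity) ?_
  have e2 : (E.N * l) ^ 2 = E.N * lN := by rw [mul_pow, hl2]; field_simp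
  rw [e2]
  have h1 : 1 ≤ E.s * lN := one_le_mul_of_one_le_of_one_le hs hlN
  calc ((ν + 20) * (E.s * lN) * 2) ^ 2 = (2 * (ν + 20)) ^ 2 * (E.s * lN) ^ 2 := by ring
    _ ≤ (2 * (ν + 20)) ^ 2 * (E.s * lN) ^ 3 :=
        mul_le_mul_of_nonneg_left (pow_le_pow_right₀ h1 (by norm_num)) (by positivity)
    _ ≤ (2 * (ν + 20)) ^ 2 * (ζ ^ 6 * E.n) := by gcongr
    _ ≤ (2 * (ν + 20)) ^ 2 * (ζ ^ 2 * E.n) := by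
        have := pow_le_pow_of_le_one hζ hζ1 (show 2 ≤ 6 by norm_num)
        gcongr
    _ = (2 * (ν + 20) * ζ) ^ 2 * E.n := by ring
    _ ≤ 1 ^ 2 * E.N := by gcongr
    _ ≤ E.N * lN := by nlinarith

/-- The exponent for the Hessian summands: the deviation `(s log n / n)^{1/3}` balances their
variance `1 / b` against the size of the grid. -/
theorem le_kernFn_exponent (h : InRegime E ν c κ₁ κ₂ ζ N₀ b a) (hν : 0 < ν) (hc : 0 < c)
    (hκ₁ : 0 < κ₁) {C'' D : ℝ} (hD : 0 < D)
    (hC''2 : C'' ^ 2 = 4 * D * (ν + 20) / (κ₁ * c)) (hb : 0 < b) :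
    (ν + 20) * (E.s * Real.log E.N)
      ≤ E.n * (C'' * (E.s * Real.log E.n / E.n) ^ (1 / 3 : ℝ)) ^ 2 / (4 * (D / b)) := by
  have hn0 : (0 : ℝ) < E.n := by linarith [h.one_le_n]
  have hlog := h.log_le
  have hs := h.one_le_s
  have hx3 := h.cube_root_pow
  have hxb := h.le_b
  have hln := h.log_n_nonneg
  have hx0 : 0 ≤ (E.s * Real.log E.n / E.n) ^ (1 / 3 : ℝ) := by positivity
  set lN := Real.log E.N
  set ln := Real.log E.n
  set x := (E.s * ln / E.n) ^ (1 / 3 : ℝ)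
  have e : (E.n : ℝ) * (C'' * x) ^ 2 / (4 * (D / b)) = E.n * C'' ^ 2 * x ^ 2 * b / (4 * D) := by
    field_simp
  rw [e, hC''2]
  calc (ν + 20) * (E.s * lN) = (ν + 20) / c * E.s * (c * lN) := by field_simp
    _ ≤ (ν + 20) / c * E.s * ln := by gcongr
    _ = (ν + 20) / c * E.n * x ^ 3 := by rw [hx3]; field_simp
    _ = E.n * (4 * D * (ν + 20) / (κ₁ * c)) * x ^ 2 * (κ₁ * x) / (4 * D) := by field_simp
    _ ≤ _ := by gcongr

/-- The deviations `t₁ = C' √(log N / N)`, `t₂ = √(log N / N)` and `t₃ = C'' (s log n / n)^{1/3}`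
are exceeded with probability of order at most `1 / N`. -/
theorem measure_not_isGood_le (h : InRegime E ν c κ₁ κ₂ ζ N₀ b a)
    (H : E.IsRegular f₂ L g lamMin) (hτ : τ ∈ Set.Ioo (0 : ℝ) 1)
    (hK : IsSmoothingKernel K) (hB0 : 0 < B) (hB : ∀ u, K u ≤ B)
    (hν : 0 < ν) (hc : 0 < c) (hκ₁ : 0 < κ₁) (hκ₂ : 0 < κ₂) (hM : 0 < M)
    (hζ : 0 ≤ ζ) (hζ1 : ζ ≤ 1) (hζκ : κ₂ * ζ ≤ 1) (hζM : M * (κ₂ * ζ) ≤ 1)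
    {C' C'' D V : ℝ} (hC' : 0 < C') (hC'2 : C' ^ 2 = 4 * momentConst g * (ν + 3))
    (hC'' : 0 < C'') (hC''2 : C'' ^ 2 = 4 * D * (ν + 20) / (κ₁ * c))
    (hD : B * (f₂ + L * (1 + ∫ y, |y| * K y)) * momentConst g ≤ D) (hD0 : 0 < D)
    (hV : (f₂ + L) * M * momentConst g ≤ V) (hVκ : 1 / κ₁ ≤ V)
    (hζ₁ : C' * ζ ≤ 2 * momentConst g) (hζ₂ : 4 * V * (ν + 20) * κ₂ * ζ ≤ 1)
    (hζ₃ : 2 * (ν + 20) * ζ ≤ 1) (hζ₄ : C'' * ζ ≤ 2 * D * (g / (3 * B)))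
    (hN₁ : (ν + 3) / g ≤ N₀) (hN₂ : (4 * (f₂ + L) * momentConst g) ^ 2 ≤ N₀)
    {G : Finset (Fin (E.p + 1) → ℝ)} (hG : ∀ w ∈ G, l2norm w ≤ 1)
    (hGc : (G.card : ℝ) ≤ (2 * (E.N : ℝ) ^ 8 + 1) ^ E.s) :
    E.P.real {ω | ¬ E.IsGood K G b (M * a) (1 / (E.N : ℝ))
      (C' * Real.sqrt (Real.log E.N / E.N)) (Real.sqrt (Real.log E.N / E.N))
      (C'' * (E.s * Real.log E.n / E.n) ^ (1 / 3 : ℝ)) ω} ≤ 11 / E.N := by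
  obtain ⟨hf, hL⟩ := H.dens_zero_bound
  have hmc := momentConst_pos g
  have hg := H.g_pos
  have hMC := h.meshConditions hκ₁ hκ₂ hζ hζ1 hζκ hM hζM
  have hN3 := h.three_le
  have hN0 : (0 : ℝ) < E.N := by linarith
  have hn1 := h.one_le_n
  have hn0 : (0 : ℝ) < E.n := by linarith
  have hlN := h.one_le_log_N
  have hlN0 : 0 < Real.log E.N := by linarith
  have hs := h.one_le_s
  have ha := h.a_pos hκ₁
  have hb := hMC.b_pos
  have hη := h.eta_le hζ hζ1
  have hlog := h.log_le
  have hln0 : 0 < Real.log E.n := lt_of_lt_of_le (by positivity) hlog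
  set lN := Real.log E.N with hlN_def
  set ln := Real.log E.n with hln_def
  set l := Real.sqrt (lN / E.N) with hl_def
  set A := Real.sqrt (E.s * lN / E.n) with hA_def
  set x := (E.s * ln / E.n) ^ (1 / 3 : ℝ) with hx_def
  have hl0 : 0 < l := Real.sqrt_pos.2 (by positivity)
  have hl2 : l ^ 2 = lN / E.N := Real.sq_sqrt (by positivity)
  have hlA : l ≤ A := h.sqrt_log_div_N_le
  have hAζ : A ≤ ζ := sqrt_le_eta.trans hη
  have hx0 : 0 < x := by positivity
  have hxζ : x ≤ ζ := cube_root_le_eta.trans hη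
  have hV0 : 0 < V := lt_of_lt_of_le (by positivity) hVκ
  have hV4 : 0 < D / b := by positivity
  have key := Experiment.measure_not_isGood_le (E := E) H hτ hK hB0 hB hG (b := b) (ρ := M * a)
    (δ := 1 / (E.N : ℝ)) (t₁ := C' * l) (t₂ := l) (t₃ := C'' * x) hb hMC.b_le_one
    hMC.rho_pos hMC.rho_le_one (by positivity) (by rw [div_le_one hN0]; linarith)
    (by positivity) hl0.le (by positivity) (V₂ := V * a) (V₃ := l / 2) (V₄ := D / b)
    (x := Real.exp (-((ν + 20) * (E.s * lN)))) (y := Real.exp (-((ν + 3) * lN)))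
    (Γ := Real.exp (9 * (E.s * lN))) (by positivity) (by positivity) hV4
    ?_ ?_ ?_ ?_ ?_ ?_ ?_ ?_ ?_ ?_ ?_ ?_ ?_ ?_ hMC.one_le_N
  · exact key.trans (h.union_bound_le hν)
  · calc (f₂ + L) * (M * a) * momentConst g = (f₂ + L) * M * momentConst g * a := by ring
      _ ≤ V * a := by gcongr
  · -- `√(log N / N)` is much larger than `1 / N`
    have h1 : 4 * (f₂ + L) * momentConst g ≤ E.N * l := by
      refine le_of_pow_le_pow_left₀ (n := 2) two_ne_zero (by positivity) ?_
      refine (hN₂.trans h.le_N).trans ?_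
      have e : (E.N * l) ^ 2 = E.N * lN := by rw [mul_pow, hl2]; field_simp
      rw [e]
      exact le_mul_of_one_le_right hN0.le hlN
    have e : 2 * (1 / (E.N : ℝ)) * (f₂ + L) * momentConst g
        = 4 * (f₂ + L) * momentConst g / E.N / 2 := by ring
    rw [e]
    have : 4 * (f₂ + L) * momentConst g / E.N ≤ l := by rwa [div_le_iff₀' hN0]
    linarith
  · have e : B / b * (f₂ + L * (1 + ∫ y, |y| * K y)) * momentConst g
        = B * (f₂ + L * (1 + ∫ y, |y| * K y)) * momentConst g / b := by ring
    rw [e]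
    gcongr
  · rw [mul_one]
    exact (mul_le_mul_of_nonneg_left (hlA.trans hAζ) hC'.le).trans hζ₁
  · rw [mul_one]
    have h1 : l ≤ V * a := by
      calc l ≤ A := hlA
        _ = 1 / κ₁ * (κ₁ * A) := by field_simp
        _ ≤ V * a := mul_le_mul hVκ h.le_a (by positivity) hV0.le
    have : 0 < V * a := by positivity
    linarith
  · linarith
  · have e : 2 * (D / b) * (g / (3 * B) * b) = 2 * D * (g / (3 * B)) := by field_simp
    rw [e]
    exact (mul_le_mul_of_nonneg_left hxζ hC''.le).trans hζ₄
  · refine Real.exp_le_exp.2 (neg_le_neg ?_)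
    have h1 : ν + 3 ≤ g * E.N := by
      have := hN₁.trans h.le_N
      rwa [div_le_iff₀' hg] at this
    have h2 : lN ≤ E.N := (Real.log_le_sub_one_of_pos hN0).trans (by linarith)
    calc (ν + 3) * lN ≤ (g * E.N) * E.N := mul_le_mul h1 h2 hlN0.le (by positivity)
      _ = _ := by ring
  · refine Real.exp_le_exp.2 (neg_le_neg (le_of_eq ?_))
    rw [mul_pow, hl2, hC'2]
    field_simp
  · exact Real.exp_le_exp.2 (neg_le_neg (h.le_scoreDiff_exponent hν hκ₁ hκ₂ hζ hζ1 hV0 hζ₂))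
  · exact Real.exp_le_exp.2 (neg_le_neg (h.le_nearFn_exponent hν hζ hζ1 hζ₃))
  · exact Real.exp_le_exp.2 (neg_le_neg (h.le_kernFn_exponent hν hc hκ₁ hD0 hC''2 hb))
  · exact hGc.trans h.two_mul_pow_add_one_pow_le
  · exact Real.one_le_exp (by positivity)

/-- The bound on the error of the Hessian is of order `η`. -/
theorem hessian_bound_le (h : InRegime E ν c κ₁ κ₂ ζ N₀ b a)
    (hK : IsSmoothingKernel K) (hB0 : 0 < B) (hf : 0 ≤ f₂) (hL : 0 ≤ L)
    (hM : 0 < M) (C'' : ℝ) (hC'' : 0 ≤ C'') (hκ₂ : 0 < κ₂) :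
    C'' * (E.s * Real.log E.n / E.n) ^ (1 / 3 : ℝ)
      + L * (M * a + b * ∫ y, |y| * K y) * momentConst g + (2 * B + f₂ * momentConst g) / E.N
      ≤ (C'' + L * (M * κ₂ + κ₂ * ∫ y, |y| * K y) * momentConst g
        + (2 * B + f₂ * momentConst g)) * eta E := by
  have hmc := momentConst_pos g
  have hm : 0 ≤ ∫ y, |y| * K y := integral_nonneg fun y => mul_nonneg (abs_nonneg _) (hK.nonneg y)
  have ha : a ≤ κ₂ * eta E := h.a_le.trans (mul_le_mul_of_nonneg_left sqrt_le_eta hκ₂.le)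
  have hb : b ≤ κ₂ * eta E := h.b_le.trans (mul_le_mul_of_nonneg_left cube_root_le_eta hκ₂.le)
  have e : (2 * B + f₂ * momentConst g) / E.N = (2 * B + f₂ * momentConst g) * (1 / E.N) := by
    ring
  rw [e]
  calc _ ≤ C'' * eta E
      + L * (M * (κ₂ * eta E) + (κ₂ * eta E) * ∫ y, |y| * K y) * momentConst g
      + (2 * B + f₂ * momentConst g) * eta E := by
        gcongr
        · exact cube_root_le_eta
        · exact h.inv_N_le_eta
    _ = _ := by ring

/-- The bound on the gradient is of the order of the penalty level. -/
theorem gradient_bound_le (h : InRegime E ν c κ₁ κ₂ ζ N₀ b a) (hf : 0 ≤ f₂) (hL : 0 ≤ L)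
    (hκ₁ : 0 < κ₁) (hκ₂ : 0 < κ₂) (hM : 0 < M) {C' C₄ : ℝ} (hC' : 0 ≤ C') (hC₄ : 0 ≤ C₄) :
    C' * Real.sqrt (Real.log E.N / E.N) + 2 * Real.sqrt (Real.log E.N / E.N)
      + L * (M * a) ^ 2 * momentConst g + (3 * f₂ + 2 * L) * momentConst g / E.N
      + C₄ * eta E * (M * a)
      ≤ (C' + 2 + L * M ^ 2 * κ₂ * momentConst g + (3 * f₂ + 2 * L) * momentConst g + C₄ * M)
        * rate E a := by
  have hmc := momentConst_pos g
  have ha0 := h.a_pos hκ₁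
  have ha : a ≤ κ₂ * eta E := h.a_le.trans (mul_le_mul_of_nonneg_left sqrt_le_eta hκ₂.le)
  have hη : 0 ≤ eta E := (Real.sqrt_nonneg _).trans sqrt_le_eta
  have h1 : Real.sqrt (Real.log E.N / E.N) ≤ rate E a :=
    le_add_of_nonneg_right (mul_nonneg ha0.le hη)
  have h2 : a * eta E ≤ rate E a := le_add_of_nonneg_left (Real.sqrt_nonneg _)
  have h3 : (M * a) ^ 2 ≤ M ^ 2 * κ₂ * rate E a := by
    calc (M * a) ^ 2 = M ^ 2 * (a * a) := by ring
      _ ≤ M ^ 2 * (a * (κ₂ * eta E)) := by gcongr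
      _ = M ^ 2 * κ₂ * (a * eta E) := by ring
      _ ≤ _ := by gcongr
  have e1 : (3 * f₂ + 2 * L) * momentConst g / E.N
      = (3 * f₂ + 2 * L) * momentConst g * (1 / E.N) := by ring
  have e2 : C₄ * eta E * (M * a) = C₄ * M * (a * eta E) := by ring
  rw [e1, e2]
  have h4 := h.inv_N_le.trans h1
  calc _ ≤ C' * rate E a + 2 * rate E a + L * (M ^ 2 * κ₂ * rate E a) * momentConst g
      + (3 * f₂ + 2 * L) * momentConst g * rate E a + C₄ * M * rate E a := by gcongr
    _ = _ := by ring

theorem rate_pos (h : InRegime E ν c κ₁ κ₂ ζ N₀ b a) (hκ₁ : 0 < κ₁) : 0 < rate E a := by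
  have hη : 0 ≤ eta E := (Real.sqrt_nonneg _).trans sqrt_le_eta
  have hlN := h.one_le_log_N
  have hN : (0 : ℝ) < E.N := by linarith [h.three_le]
  have h1 : 0 < Real.sqrt (Real.log E.N / E.N) := Real.sqrt_pos.2 (by positivity)
  exact add_pos_of_pos_of_nonneg h1 (mul_nonneg (h.a_pos hκ₁).le hη)

end InRegime

/-- There are thresholds that depend on the constants only, such that in the regime they define
there is an event of probability at least `1 - 11 / N` on which every initial estimator with the
right support and error at most `M a_N` leads to the right support. -/
theorem exists_recovery_event {K : ℝ → ℝ} (hK : IsSmoothingKernel K) {τ : ℝ}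
    (hτ : τ ∈ Set.Ioo (0 : ℝ) 1) {f₂ L g lamMin lamMax α ν c κ₁ κ₂ M : ℝ} (hf : 0 ≤ f₂)
    (hL : 0 ≤ L) (hg : 0 < g) (hα : α ∈ Set.Ioo (0 : ℝ) 1) (hlamMin : 0 < lamMin) (hν : 0 < ν)
    (hc : 0 < c) (hκ₁ : 0 < κ₁) (hκ₂ : 0 < κ₂) (hM : 0 < M) :
    ∃ C₀ > 0, ∃ ζ > 0, ∃ N₀ : ℝ, ∀ C ≥ C₀, ∀ (E : Experiment.{u} τ) (h b a : ℝ)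
      (beta0 beta1 : E.Ω → Fin (E.p + 1) → ℝ), E.IsRegular f₂ L g lamMin →
      E.Irrepresentable α lamMin lamMax → InRegime E ν c κ₁ κ₂ ζ N₀ b a →
      E.IsOneStepEstimator K h b (C * rate E a) beta0 beta1 →
      ∃ T : Set E.Ω, E.P.real Tᶜ ≤ 11 / E.N ∧ ∀ ω ∈ T,
        (∀ j, beta0 ω j ≠ 0 → j ∈ E.active) → l2norm (beta0 ω - E.betaStar) ≤ M * a →
        slopeSupp (beta1 ω) ⊆ E.supp ∧
          ((∀ j ∈ E.supp, rowSumNorm E.infoSS⁻¹ * (2 * (C * rate E a)) < |E.betaStar j|) →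
            slopeSupp (beta1 ω) = E.supp) := by
  obtain ⟨B, hB0, hB, hBL⟩ := hK.exists_bounds
  have hmc := momentConst_pos g
  have hm : 0 ≤ ∫ y, |y| * K y := integral_nonneg fun y => mul_nonneg (abs_nonneg _) (hK.nonneg y)
  set D := B * (f₂ + L * (1 + ∫ y, |y| * K y)) * momentConst g + 1 with hD
  have hD0 : 0 < D := by positivity
  set V := (f₂ + L) * M * momentConst g + 1 / κ₁ with hV
  have hV0 : 0 < V := by positivity
  set C' := Real.sqrt (4 * momentConst g * (ν + 3)) with hC'
  have hC'0 : 0 < C' := Real.sqrt_pos.2 (by positivity)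
  have hC'2 : C' ^ 2 = 4 * momentConst g * (ν + 3) := Real.sq_sqrt (by positivity)
  set C'' := Real.sqrt (4 * D * (ν + 20) / (κ₁ * c)) with hC''
  have hC''0 : 0 < C'' := Real.sqrt_pos.2 (by positivity)
  have hC''2 : C'' ^ 2 = 4 * D * (ν + 20) / (κ₁ * c) := Real.sq_sqrt (by positivity)
  set C₄ := C'' + L * (M * κ₂ + κ₂ * ∫ y, |y| * K y) * momentConst g
    + (2 * B + f₂ * momentConst g) with hC₄
  have hC₄0 : 0 < C₄ := by positivity
  set C₅ := C' + 2 + L * M ^ 2 * κ₂ * momentConst g + (3 * f₂ + 2 * L) * momentConst g + C₄ * M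
    with hC₅
  have hC₅0 : 0 < C₅ := by positivity
  have hα0 := hα.1
  -- finitely many upper bounds on `ζ`, met at once
  obtain ⟨ζ, ⟨hζ0, hζ1, hζκ, hζM, hζ₁, hζ₂, hζ₃, hζ₄, hζ₅⟩⟩ : ∃ ζ : ℝ, 0 < ζ ∧ ζ ≤ 1 ∧
      κ₂ * ζ ≤ 1 ∧ M * (κ₂ * ζ) ≤ 1 ∧ C' * ζ ≤ 2 * momentConst g ∧
      4 * V * (ν + 20) * κ₂ * ζ ≤ 1 ∧ 2 * (ν + 20) * ζ ≤ 1 ∧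
      C'' * ζ ≤ 2 * D * (g / (3 * B)) ∧ 16 * (C₄ * ζ) ≤ α * lamMin := by
    have hsmall : ∀ x y : ℝ, 0 < y → ∀ᶠ ζ : ℝ in 𝓝[>] 0, x * ζ ≤ y := fun x y hy => by
      have : Tendsto (fun ζ : ℝ => x * ζ) (𝓝[>] 0) (𝓝 (x * 0)) :=
        ((continuous_const_mul x).tendsto 0).mono_left nhdsWithin_le_nhds
      rw [mul_zero] at this
      exact this.eventually_le_const hy
    refine Filter.Eventually.exists (f := 𝓝[>] (0 : ℝ)) ?_
    filter_upwards [self_mem_nhdsWithin, hsmall 1 1 one_pos, hsmall κ₂ 1 one_pos,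
      hsmall (M * κ₂) 1 one_pos, hsmall C' _ (show 0 < 2 * momentConst g by positivity),
      hsmall (4 * V * (ν + 20) * κ₂) 1 one_pos, hsmall (2 * (ν + 20)) 1 one_pos,
      hsmall C'' (2 * D * (g / (3 * B))) (by positivity),
      hsmall (16 * C₄) (α * lamMin) (by positivity)] with ζ h0 h1 h2 h3 h4 h5 h6 h7 h8
    exact ⟨h0, by linarith, h2, by linarith, h4, h5, h6, h7, by linarith⟩
  refine ⟨8 * C₅ / α, by positivity, ζ, hζ0,
    max ((ν + 3) / g) ((4 * (f₂ + L) * momentConst g) ^ 2), ?_⟩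
  intro C hC E h b a beta0 beta1 H hI hR hest
  have hMC := hR.meshConditions hκ₁ hκ₂ hζ0.le hζ1 hζκ hM hζM
  have hNpos : 0 < E.N ^ 8 := pow_pos hMC.one_le_N 8
  obtain ⟨G, hGc, hG, hGa⟩ := exists_grid E.active hNpos
  have hgrid : IsGrid G E.active (1 / (E.N : ℝ) ^ 8) :=
    ⟨fun w hw => (hG w hw).1, fun w hw => (hG w hw).2, fun v hv hvn => by
      simpa using hGa v hv hvn⟩
  have hGc' : (G.card : ℝ) ≤ (2 * (E.N : ℝ) ^ 8 + 1) ^ E.s := by exact_mod_cast hGc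
  have hbad := hR.measure_not_isGood_le H hτ hK hB0 hB hν hc hκ₁ hκ₂ hM hζ0.le hζ1 hζκ hζM hC'0
    hC'2 hC''0 hC''2 (by rw [hD]; linarith) hD0 (by rw [hV]; linarith [one_div_pos.2 hκ₁])
    (by rw [hV]; have : 0 ≤ (f₂ + L) * M * momentConst g := by positivity
        linarith) hζ₁ hζ₂ hζ₃ hζ₄ (le_max_left _ _) (le_max_right _ _) hgrid.norm_le hGc'
  refine ⟨_, by rw [Set.compl_ofPred]; exact hbad, fun ω hω hsupp hnorm => ?_⟩
  have hrate := hR.rate_pos hκ₁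
  have hC0 : 0 < C := lt_of_lt_of_le (by positivity) hC
  have hη := hR.sqrt_s_mul_eta_le hζ0.le hζ1
  refine Experiment.support_recovery_of_isGood H hlamMin hα hI hτ hK hB0 hB hBL hMC hgrid hω
    (by have := hR.log_n_nonneg; positivity) (mul_pos hC0 hrate)
    (hR.hessian_bound_le hK hB0 hf hL hM C'' hC''0.le hκ₂) ?_ ?_ hest hsupp hnorm
  · calc 16 * (Real.sqrt E.s * (C₄ * eta E)) = 16 * (C₄ * (Real.sqrt E.s * eta E)) := by ring
      _ ≤ 16 * (C₄ * ζ) := by gcongr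
      _ ≤ _ := hζ₅
  · refine (hR.gradient_bound_le hf hL hκ₁ hκ₂ hM hC'0.le hC₄0.le).trans ?_
    calc C₅ * rate E a = α / 8 * (8 * C₅ / α * rate E a) := by field_simp
      _ ≤ α / 8 * (C * rate E a) := by gcongr

/-! ### Passage to the limit -/

section Limits

variable {Ω : ℕ → Type*} [∀ k, MeasurableSpace (Ω k)] {P : ∀ k, Measure (Ω k)}
  [∀ k, IsProbabilityMeasure (P k)]

theorem tendsto_measure_compl_zero {A : ∀ k, Set (Ω k)} (hA : ∀ k, MeasurableSet (A k))
    (h : Tendsto (fun k => P k (A k)) atTop (𝓝 1)) :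
    Tendsto (fun k => P k (A k)ᶜ) atTop (𝓝 0) := by
  have h1 : Tendsto (fun k => 1 - P k (A k)) atTop (𝓝 (1 - 1)) :=
    ENNReal.Tendsto.sub tendsto_const_nhds h (Or.inl ENNReal.one_ne_top)
  rw [tsub_self] at h1
  exact h1.congr fun k => (prob_compl_eq_one_sub (hA k)).symm

/-- No measurability is needed here, since an outer measure is subadditive. -/
theorem tendsto_measure_one_of_compl {A : ∀ k, Set (Ω k)}
    (h : Tendsto (fun k => P k (A k)ᶜ) atTop (𝓝 0)) :
    Tendsto (fun k => P k (A k)) atTop (𝓝 1) := by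
  have h1 : Tendsto (fun k => 1 - P k (A k)ᶜ) atTop (𝓝 (1 - 0)) :=
    ENNReal.Tendsto.sub tendsto_const_nhds h (Or.inl ENNReal.one_ne_top)
  rw [tsub_zero] at h1
  refine tendsto_of_tendsto_of_tendsto_of_le_of_le h1 tendsto_const_nhds (fun k => ?_)
    fun k => prob_le_one
  rw [tsub_le_iff_right]
  calc (1 : ENNReal) = P k (A k ∪ (A k)ᶜ) := by rw [Set.union_compl_self, measure_univ]
    _ ≤ _ := measure_union_le _ _

theorem limsup_le_of_le_add {u v e : ℕ → ENNReal} (he : Tendsto e atTop (𝓝 0))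
    (h : ∀ᶠ k in atTop, v k ≤ u k + e k) {ε : ENNReal} (hu : limsup u atTop ≤ ε) :
    limsup v atTop ≤ ε := by
  refine le_of_forall_gt fun b hb => ?_
  obtain ⟨d, hd, hdb⟩ := exists_between hb
  obtain ⟨d', hd', hdb'⟩ := exists_between hdb
  have h1 : ∀ᶠ k in atTop, u k < d := eventually_lt_of_limsup_lt (hu.trans_lt hd)
  have h2 : ∀ᶠ k in atTop, e k < d' - d := he.eventually_lt_const (tsub_pos_of_lt hd')
  refine lt_of_le_of_lt (limsup_le_of_le (a := d') (by isBoundedDefault) ?_) hdb'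
  filter_upwards [h, h1, h2] with k h0 h1 h2
  calc v k ≤ u k + e k := h0
    _ ≤ d + (d' - d) := add_le_add h1.le h2.le
    _ = d' := add_tsub_cancel_of_le hd'.le

end Limits

theorem measurable_l2norm {ι : Type*} [Fintype ι] : Measurable (l2norm : (ι → ℝ) → ℝ) := by
  unfold l2norm
  fun_prop

end DHSQR

end

theorem theorem3
    (K : ℝ → ℝ) (hK : DHSQR.IsSmoothingKernel K)
    (τ : ℝ) (hτ : τ ∈ Set.Ioo (0 : ℝ) 1)
    (f₁ f₂ l₀ c₁ α lamMin lamMax ν c r κ₁ κ₂ M : ℝ)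
    (hf₁ : 0 < f₁) (hf₂ : f₁ ≤ f₂) (hc₁ : 0 < c₁)
    (hα : α ∈ Set.Ioo (0 : ℝ) 1) (hlamMin : 0 < lamMin) (hlamMax : 0 < lamMax)
    (hν : 0 < ν) (hc : c ∈ Set.Ioo (0 : ℝ) 1) (hr : r ∈ Set.Ico (0 : ℝ) (1 / 3))
    (hκ₁ : 0 < κ₁) (hκ₂ : 0 < κ₂) (hM : 0 < M) :
    ∃ C₀ > 0, ∀ C ≥ C₀, ∃ C₁ > 0,
      ∀ (E : ℕ → DHSQR.Experiment.{u} τ) (h b a : ℕ → ℝ)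
        (beta0 beta1 : ∀ k, (E k).Ω → Fin ((E k).p + 1) → ℝ),
        (∀ k, (E k).DensityCondition f₁ f₂ l₀) →
        (∀ k, (E k).SubGaussian c₁) →
        (∀ k, (E k).Irrepresentable α lamMin lamMax) →
        DHSQR.RateConditions E ν c r κ₁ κ₂ h b a →
        (∀ k, Measurable (beta0 k)) →
        Tendsto (fun k => (E k).P {ω | ∀ j, beta0 k ω j ≠ 0 → j ∈ (E k).active}) atTop (𝓝 1) →
        (∀ k, (E k).IsOneStepEstimator K (h k) (b k) (C * DHSQR.rate (E k) (a k))
          (beta0 k) (beta1 k)) →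
        -- the initial error is at most `M a_N` with probability tending to one
        (Tendsto (fun k => (E k).P
            {ω | DHSQR.l2norm (beta0 k ω - (E k).betaStar) ≤ M * a k}) atTop (𝓝 1) →
          Tendsto (fun k => (E k).P
            {ω | DHSQR.slopeSupp (beta1 k ω) ⊆ (E k).supp}) atTop (𝓝 1) ∧
          ((∀ᶠ k in atTop, ∀ j ∈ (E k).supp,
              C₁ * DHSQR.rowSumNorm (E k).infoSS⁻¹ * DHSQR.rate (E k) (a k)
                ≤ |(E k).betaStar j|) →
            Tendsto (fun k => (E k).P
              {ω | DHSQR.slopeSupp (beta1 k ω) = (E k).supp}) atTop (𝓝 1))) ∧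
        -- the initial error exceeds `M a_N` with asymptotic probability at most `ε`
        (∀ ε : ENNReal,
          limsup (fun k => (E k).P
            {ω | M * a k < DHSQR.l2norm (beta0 k ω - (E k).betaStar)}) atTop ≤ ε →
          limsup (fun k => (E k).P
            {ω | ¬ DHSQR.slopeSupp (beta1 k ω) ⊆ (E k).supp}) atTop ≤ ε ∧
          ((∀ᶠ k in atTop, ∀ j ∈ (E k).supp,
              C₁ * DHSQR.rowSumNorm (E k).infoSS⁻¹ * DHSQR.rate (E k) (a k)
                ≤ |(E k).betaStar j|) →
            limsup (fun k => (E k).P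
              {ω | DHSQR.slopeSupp (beta1 k ω) ≠ (E k).supp}) atTop ≤ ε)) := by
  have hf₂' : 0 ≤ f₂ := (hf₁.trans_le hf₂).le
  have hg : 0 < 1 / (4 * (c₁ ^ 2 * (lamMax / f₁))) := by positivity
  obtain ⟨C₀, hC₀, ζ, hζ, N₀, hev⟩ := DHSQR.exists_recovery_event.{u} hK hτ (lamMax := lamMax)
    hf₂' (abs_nonneg l₀) hg hα hlamMin hν hc.1 hκ₁ hκ₂ hM
  refine ⟨C₀, hC₀, fun C hC => ⟨3 * C, by linarith, ?_⟩⟩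
  intro E h b a beta0 beta1 hd hsub hI hR hm0 hsupp hest
  have hC0 : 0 < C := hC₀.trans_le hC
  have hreg := hR.eventually_inRegime hν hc.1 hr.2 hκ₁ hζ N₀
  set I : ∀ k, Set (E k).Ω := fun k => {ω | ∀ j, beta0 k ω j ≠ 0 → j ∈ (E k).active} with hIdef
  set J : ∀ k, Set (E k).Ω := fun k =>
    {ω | M * a k < DHSQR.l2norm (beta0 k ω - (E k).betaStar)} with hJdef
  have hImeas : ∀ k, MeasurableSet (I k) := fun k => by
    rw [hIdef]
    simp only [Set.ofPred_forall]
    refine MeasurableSet.iInter fun j => ?_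
    refine MeasurableSet.imp ?_ (MeasurableSet.const _)
    exact ((measurable_pi_apply j).comp (hm0 k)) (measurableSet_singleton 0).compl
  have hI0 : Tendsto (fun k => (E k).P (I k)ᶜ) atTop (𝓝 0) :=
    DHSQR.tendsto_measure_compl_zero hImeas hsupp
  have hN : Tendsto (fun k => ENNReal.ofReal (11 / ((E k).N : ℝ))) atTop (𝓝 0) := by
    rw [← ENNReal.ofReal_zero]
    refine ENNReal.tendsto_ofReal ?_
    exact (tendsto_natCast_atTop_atTop.comp hR.sample_size).const_div_atTop 11
  have herr : Tendsto (fun k => (E k).P (I k)ᶜ + ENNReal.ofReal (11 / ((E k).N : ℝ))) atTop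
      (𝓝 0) := by simpa using hI0.add hN
  -- any event that contains the recovery event is missed with small probability
  have hmain : ∀ᶠ k in atTop, ∃ T : Set (E k).Ω, (∀ F : Set (E k).Ω,
      I k ∩ (J k)ᶜ ∩ T ⊆ F →
        (E k).P Fᶜ ≤ (E k).P (J k) + ((E k).P (I k)ᶜ + ENNReal.ofReal (11 / ((E k).N : ℝ)))) ∧
      ∀ ω ∈ I k ∩ (J k)ᶜ ∩ T, DHSQR.slopeSupp (beta1 k ω) ⊆ (E k).supp ∧
        ((∀ j ∈ (E k).supp, 3 * C * DHSQR.rowSumNorm (E k).infoSS⁻¹ * DHSQR.rate (E k) (a k)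
            ≤ |(E k).betaStar j|) → DHSQR.slopeSupp (beta1 k ω) = (E k).supp) := by
    filter_upwards [hreg] with k hk
    obtain ⟨T, hT, hrec⟩ := hev C hC (E k) (h k) (b k) (a k) (beta0 k) (beta1 k)
      ((E k).isRegular hf₁ hc₁ hlamMax hτ (hd k) (hsub k) (hI k)) (hI k) hk (hest k)
    refine ⟨T, fun F hF => ?_, fun ω hω => ?_⟩
    · have h1 : Fᶜ ⊆ J k ∪ ((I k)ᶜ ∪ Tᶜ) := by
        intro ω hω
        by_contra hn
        simp only [Set.mem_union, Set.mem_compl_iff, not_or, not_not] at hn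
        exact hω (hF ⟨⟨hn.2.1, hn.1⟩, hn.2.2⟩)
      refine (measure_mono h1).trans ((measure_union_le _ _).trans ?_)
      gcongr
      refine (measure_union_le _ _).trans ?_
      gcongr
      rw [← ENNReal.ofReal_toReal (measure_ne_top (E k).P Tᶜ)]
      exact ENNReal.ofReal_le_ofReal hT
    · obtain ⟨⟨hωI, hωJ⟩, hωT⟩ := hω
      obtain ⟨h1, h2⟩ := hrec ω hωT hωI (not_lt.1 hωJ)
      refine ⟨h1, fun hbig => h2 fun j hj => ?_⟩
      have hj' := hbig j hj
      have hpos : 0 < |(E k).betaStar j| := by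
        simp only [DHSQR.Population.supp, Finset.mem_filter] at hj
        exact abs_pos.2 hj.2.2
      have hrate := hk.rate_pos hκ₁
      have h0 := mul_nonneg (mul_nonneg hC0.le (DHSQR.rowSumNorm_nonneg (E k).infoSS⁻¹)) hrate.le
      rcases h0.eq_or_lt with h0 | h0 <;> nlinarith
  have hb : ∀ ε : ENNReal, limsup (fun k => (E k).P (J k)) atTop ≤ ε →
      limsup (fun k => (E k).P {ω | DHSQR.slopeSupp (beta1 k ω) ⊆ (E k).supp}ᶜ) atTop ≤ ε ∧
      ((∀ᶠ k in atTop, ∀ j ∈ (E k).supp,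
          3 * C * DHSQR.rowSumNorm (E k).infoSS⁻¹ * DHSQR.rate (E k) (a k)
            ≤ |(E k).betaStar j|) →
        limsup (fun k => (E k).P {ω | DHSQR.slopeSupp (beta1 k ω) = (E k).supp}ᶜ) atTop ≤ ε) := by
    refine fun ε hε => ⟨DHSQR.limsup_le_of_le_add herr ?_ hε, fun hbig =>
      DHSQR.limsup_le_of_le_add herr ?_ hε⟩
    · filter_upwards [hmain] with k ⟨T, hT, hrec⟩
      exact hT _ fun ω hω => (hrec ω hω).1
    · filter_upwards [hmain, hbig] with k ⟨T, hT, hrec⟩ hk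
      exact hT _ fun ω hω => (hrec ω hω).2 hk
  refine ⟨fun hJ => ?_, hb⟩
  have hJ0 : Tendsto (fun k => (E k).P (J k)) atTop (𝓝 0) := by
    refine (DHSQR.tendsto_measure_compl_zero (fun k => ?_) hJ).congr fun k => ?_
    · exact measurableSet_le (DHSQR.measurable_l2norm.comp ((hm0 k).sub_const _)) measurable_const
    · congr 1
      ext ω
      simp [hJdef]
  obtain ⟨h1, h2⟩ := hb 0 hJ0.limsup_eq.le
  have hlim : ∀ {u : ℕ → ENNReal}, limsup u atTop ≤ 0 → Tendsto u atTop (𝓝 0) := fun hu =>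
    tendsto_of_le_liminf_of_limsup_le bot_le hu
  exact ⟨DHSQR.tendsto_measure_one_of_compl (hlim h1), fun hbig =>
    DHSQR.tendsto_measure_one_of_compl (hlim (h2 hbig))⟩
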